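/- Let $N\ge 2$, let $\mu:\mathbb{R}^N\to\mathbb{R}$ be a function, nonnegative almost everywhere, and let $d\mu=\mu(x)\,dx$. For real $M$ put $c_0(M)=\left(\frac{M-2}{2}\right)^2$, let $B_R$ be the open ball of radius $R$ centred at $0$, and set $$U_\mu=\frac14\left|\frac{\nabla\mu}{\mu}\right|^2-\frac12\frac{\Delta\mu}{\mu},\qquad c_{0,\mu}=\liminf_{x\to0}\bigl(c_0(N)-|x|^2U_\mu(x)\bigr),\qquad U=U_\mu-\frac1{|x|^2}\limsup_{y\to0}|y|^2U_\mu(y).$$ Here derivatives are weak derivatives; $U_\mu$ and $U$ are defined $d\mu$-almost everywhere, so lower and upper limits and bounds involving them are understood in the essential sense with respect to $d\mu$. Assume: (H2) i) $\mu^{1/2}\in H^1_{loc}(\mathbb{R}^N)$ and $\Delta\mu\in L^1_{loc}(\mathbb{R}^N)$; ii) $c_{0,\mu}$ is finite; iii) for every $R>0$, $U$ is bounded from above on $\mathbb{R}^N\setminus B_R$; iv) there is $R_0>0$ such that $|x|^2U(x)\le\frac14\frac1{|\log|x||^2}$ for $x\in B_{R_0}$. (H3) i) $\mu\in L^1_{loc}(\mathbb{R}^N)$;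 ii) $N_0:=\sup\{\delta\in\mathbb{R}: |x|^{-\delta}\in L^1_{loc}(\mathbb{R}^N,d\mu)\}$ is finite. Assume moreover that $c_{0,\mu}=c_0(N_0)$. Let $H^1_\mu$ be the space of real functions $\varphi\in L^2(\mathbb{R}^N,d\mu)$ that have a (locally integrable) weak gradient $\nabla\varphi$ belonging to $L^2(\mathbb{R}^N,d\mu)$. Then, for every $c\in\mathbb{R}$, there is a constant $C\in\mathbb{R}$ such that $$c\int_{\mathbb{R}^N}\frac{\varphi^2}{|x|^2}\,d\mu\le\int_{\mathbb{R}^N}|\nabla\varphi|^2\,d\mu+C\int_{\mathbb{R}^N}\varphi^2\,d\mu\qquad\text{for all }\varphi\in H^1_\mu$$ if and only if $c\le c_0(N_0)$. (The first integral may a priori be $+\infty$, with $0\cdot\infty=0$; for $c>0$ the inequality includes its finiteness.) In particular, the constant $c_0(N_0)$ is attained and is optimal. -/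

import Mathlib

open MeasureTheory Filter Topology
open scoped ContDiff

noncomputable section

/-- Euclidean space `ℝ^N`. -/
abbrev RN (N : ℕ) : Type := EuclideanSpace ℝ (Fin N)

/-- `c_0(M) = ((M - 2) / 2)^2`, for real `M`. -/
def hardyConst (M : ℝ) : ℝ := ((M - 2) / 2) ^ 2

/-- Test functions: the space `C_c^∞(ℝ^N)`. -/
def IsTestFunction {N : ℕ} (ψ : RN N → ℝ) : Prop :=
  ContDiff ℝ ∞ ψ ∧ HasCompactSupport ψ

/-- `g` is a weak gradient of `f`: both are locally integrable for Lebesgue measure, and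
`∫ f ∂_v ψ dx = - ∫ ⟨g, v⟩ ψ dx` for every test function `ψ` and every direction `v`. -/
structure HasWeakGradient {N : ℕ} (f : RN N → ℝ) (g : RN N → RN N) : Prop where
  locallyIntegrable : LocallyIntegrable f volume
  locallyIntegrable_grad : LocallyIntegrable g volume
  integral_eq : ∀ ψ : RN N → ℝ, IsTestFunction ψ → ∀ v : RN N,
    ∫ x, f x * fderiv ℝ ψ x v = - ∫ x, inner ℝ (g x) v * ψ x

/-- `g` is the distributional Laplacian of `f`, and it is a locally integrable function:
`∫ f Δψ dx = ∫ g ψ dx` for every test function `ψ`. -/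
structure HasWeakLaplacian {N : ℕ} (f g : RN N → ℝ) : Prop where
  locallyIntegrable : LocallyIntegrable f volume
  locallyIntegrable_lap : LocallyIntegrable g volume
  integral_eq : ∀ ψ : RN N → ℝ, IsTestFunction ψ →
    ∫ x, f x * Laplacian.laplacian ψ x = ∫ x, g x * ψ x

open Classical in
/-- The weak gradient `∇f` (a representative; it is unique almost everywhere). The value `0` is
used when `f` has no weak gradient. -/
def weakGrad {N : ℕ} (f : RN N → ℝ) : RN N → RN N :=
  if h : ∃ g, HasWeakGradient f g then h.choose else 0

open Classical in
/-- The distributional Laplacian `Δf` (a representative; it is unique almost everywhere). The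
value `0` is used when `Δf` is not a locally integrable function. -/
def weakLaplacian {N : ℕ} (f : RN N → ℝ) : RN N → ℝ :=
  if h : ∃ g, HasWeakLaplacian f g then h.choose else 0

/-- `f ∈ H^1_loc(ℝ^N)`: `f` and its weak gradient are square integrable on compact sets. -/
structure MemH1Loc {N : ℕ} (f : RN N → ℝ) : Prop where
  memLp : ∀ K : Set (RN N), IsCompact K → MemLp f 2 (volume.restrict K)
  exists_weakGrad : ∃ g, HasWeakGradient f g
  memLp_grad : ∀ K : Set (RN N), IsCompact K → MemLp (weakGrad f) 2 (volume.restrict K)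

/-- The measure `dμ = μ(x) dx` with density `μ`. -/
def densityMeasure {N : ℕ} (μ : RN N → ℝ) : Measure (RN N) :=
  volume.withDensity fun x => ENNReal.ofReal (μ x)

/-- `φ ∈ H^1_μ = H^1(ℝ^N, dμ)`: `φ` belongs to `L^2_μ` and has a weak gradient, which belongs
to `L^2_μ`. -/
structure MemH1Mu {N : ℕ} (μ φ : RN N → ℝ) : Prop where
  memLp : MemLp φ 2 (densityMeasure μ)
  exists_weakGrad : ∃ g, HasWeakGradient φ g
  memLp_grad : MemLp (weakGrad φ) 2 (densityMeasure μ)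

/-- The potential `U_μ = (1/4) |∇μ / μ|^2 - (1/2) Δμ / μ`. It is meaningful where `μ > 0`, that
is, `dμ`-almost everywhere, and only its values up to `dμ`-null sets are ever used. -/
def potentialMu {N : ℕ} (μ : RN N → ℝ) (x : RN N) : ℝ :=
  1 / 4 * ‖(μ x)⁻¹ • weakGrad μ x‖ ^ 2 - 1 / 2 * (weakLaplacian μ x / μ x)

/-- The filter of the limit `x → 0` for functions that are defined `dμ`-almost everywhere: upper
and lower limits along it are the essential ones. -/
def essNhdsZero {N : ℕ} (μ : RN N → ℝ) : Filter (RN N) :=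
  𝓝[≠] 0 ⊓ ae (densityMeasure μ)

/-- `c_{0,μ} = liminf_{x → 0} (c_0(N) - |x|^2 U_μ(x))`, as an extended real number. -/
def hardyConstMu {N : ℕ} (μ : RN N → ℝ) : EReal :=
  liminf (fun x => ((hardyConst N - ‖x‖ ^ 2 * potentialMu μ x : ℝ) : EReal)) (essNhdsZero μ)

/-- `limsup_{x → 0} |x|^2 U_μ(x)`, as an extended real number; it equals `c_0(N) - c_{0,μ}`. -/
def limsupPotential {N : ℕ} (μ : RN N → ℝ) : EReal :=
  limsup (fun x => ((‖x‖ ^ 2 * potentialMu μ x : ℝ) : EReal)) (essNhdsZero μ)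

/-- `U = U_μ - |x|^{-2} limsup_{y → 0} |y|^2 U_μ(y)`; used only when the upper limit is finite. -/
def potentialU {N : ℕ} (μ : RN N → ℝ) (x : RN N) : ℝ :=
  potentialMu μ x - 1 / ‖x‖ ^ 2 * (limsupPotential μ).toReal

/-- Hypothesis (H2) on the density `μ`. -/
structure HypH2 {N : ℕ} (μ : RN N → ℝ) : Prop where
  nonneg : ∀ᵐ x, 0 ≤ μ x
  sqrt_memH1Loc : MemH1Loc fun x => Real.sqrt (μ x)
  laplacian_memL1Loc : ∃ g, HasWeakLaplacian μ g
  finite_const : ∃ r : ℝ, hardyConstMu μ = (r : EReal)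
  bddAbove_away : ∀ R : ℝ, 0 < R →
    ∃ K : ℝ, ∀ᵐ x ∂(densityMeasure μ), R ≤ ‖x‖ → potentialU μ x ≤ K
  log_bound : ∃ R₀ : ℝ, 0 < R₀ ∧
    ∀ᵐ x ∂(densityMeasure μ), ‖x‖ < R₀ →
      ‖x‖ ^ 2 * potentialU μ x ≤ 1 / 4 * (1 / |Real.log ‖x‖| ^ 2)

/-- Hypothesis (H3) on the density `μ`, with `N₀` the (finite) supremum of all real `δ` for which
`|x|^{-δ}` is locally integrable with respect to `dμ`. -/
structure HypH3 {N : ℕ} (μ : RN N → ℝ) (N₀ : ℝ) : Prop where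
  memL1Loc : LocallyIntegrable μ volume
  isLUB : IsLUB {δ : ℝ | LocallyIntegrable (fun x : RN N => 1 / ‖x‖ ^ δ) (densityMeasure μ)} N₀

/-- The inequality `c ∫ φ^2/|x|^2 dμ ≤ ∫ |∇φ|^2 dμ + C ∫ φ^2 dμ` for one function `φ`. The
integrals of nonnegative functions take values in `[0, ∞]`, so for `c > 0` the inequality contains
the finiteness of the integral on the left. -/
def HardyIneq {N : ℕ} (μ : RN N → ℝ) (c C : ℝ) (φ : RN N → ℝ) : Prop :=
  (c : EReal) * ((∫⁻ x, ENNReal.ofReal (φ x ^ 2 / ‖x‖ ^ 2) ∂(densityMeasure μ) : ENNReal) : EReal)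
    ≤ ((∫⁻ x, ENNReal.ofReal (‖weakGrad φ x‖ ^ 2) ∂(densityMeasure μ) : ENNReal) : EReal)
      + (C : EReal) * ((∫⁻ x, ENNReal.ofReal (φ x ^ 2) ∂(densityMeasure μ) : ENNReal) : EReal)

/-- The weighted Hardy inequality with constant `c` holds on `H^1_μ`, for some constant `C`. -/
def WeightedHardy {N : ℕ} (μ : RN N → ℝ) (c : ℝ) : Prop :=
  ∃ C : ℝ, ∀ φ : RN N → ℝ, MemH1Mu μ φ → HardyIneq μ c C φ

end

/-! Sufficiency is a ground state argument. Put w = √μ. For φ bounded with compact support and G a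
smooth vector field, integrate |∇(φw) - φwG|² ≥ 0 and integrate the cross terms by parts: 2φw ∇φ·∇w
= ½ ∇(φ²)·∇μ produces -½ φ²Δμ, and -∇(φ²μ)·G produces φ²μ div G. Since |∇w|² - ½Δμ = μ U_μ where μ >
0, this gives ∫ μ|∇φ|² ≥ -∫ φ²μ(|G|² + div G) - ∫ φ²μ U_μ, which is `IsRegularDensity.energy`.

Take for G a regularisation of ∇h/h, where h behaves like |x|^{-(N-2)/2} |log|x||^{1/2} at the
origin. Up to an additive constant, -(|G|² + div G) is then at least c_0(N)/|x|² plus the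
logarithmic term that (H2) iv) allows in U (`le_neg_divergence_hardyField`,
`log_weight_comparison`). Because c_0(N) - limsup |y|²U_μ(y) = c_{0,μ}, what survives is
c_{0,μ}/|x|², up to a constant. Fatou's lemma removes the regularisation, and truncation passes to
all of H^1_μ (`hardy_of_forall_bounded`).

The delicate point is the integration by parts: Δμ is only locally integrable, μ may be unbounded or
vanish, and only √μ ∇φ is square integrable. The whole square is therefore multiplied by a cutoff
P(μ) that vanishes at μ = 0 and at infinity. The identity div(Θ(μ)∇μ) = Θ(μ)Δμ + Θ'(μ)|∇μ|² is
proved by mollifying μ. The bound |∇μ_n|² ≤ 4 μ_n (|∇√μ|²)_n, together with boundedness of tΘ'(t),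
supplies the domination. As P tends to the indicator of {μ ≠ 0}, the extra terms carry tP'(t), which
is bounded and tends to 0.

Necessity: suppose the inequality holds with c > c_0(N₀) = a², a = (2 - N₀)/2. Pick γ slightly below
a with γ² < c, and test with (|x|² + ε²)^{γ/2}, cut off away from the origin. Near 0 the gradient
term is at most γ² times the integral of (|x|² + ε²)^{γ-1}, while the Hardy term is at least c times
it. Absorbing and letting ε → 0 shows that |x|^{2γ-2} is dμ-integrable near 0
(`WeightedHardy.lintegral_lt_top`). As 2 - 2γ > N₀, this contradicts the definition of N₀. -/

noncomputable section

/-! ### Mollification: L¹ convergence, dominated subsequences, Cauchy–Schwarz. -/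

section Mollification

variable {N : ℕ} {E : Type*} [NormedAddCommGroup E] [NormedSpace ℝ E]

/-- Mollification of `f` by the kernel `ρ`. -/
def mollify (ρ : RN N → ℝ) (f : RN N → E) (x : RN N) : E := ∫ y, ρ (x - y) • f y

/-- Smooth probability densities supported in the unit ball. -/
structure IsMollifier (ρ : RN N → ℝ) : Prop where
  contDiff : ContDiff ℝ ∞ ρ
  hasCompactSupport : HasCompactSupport ρ
  nonneg : ∀ x, 0 ≤ ρ x
  integral_eq_one : ∫ x, ρ x = 1
  eq_zero : ∀ x, 1 ≤ ‖x‖ → ρ x = 0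

lemma mollify_eq_convolution (ρ : RN N → ℝ) (f : RN N → E) :
    mollify ρ f = MeasureTheory.convolution ρ f (ContinuousLinearMap.lsmul ℝ ℝ) volume := by
  ext x
  rw [convolution_eq_swap]
  rfl

/-- A sequence of bump functions concentrating at the origin. -/
def bumpSeq (N n : ℕ) : ContDiffBump (0 : RN N) where
  rIn := 1 / (2 * (n + 1))
  rOut := 1 / (n + 1)
  rIn_pos := by positivity
  rIn_lt_rOut := by
    apply one_div_lt_one_div_of_lt <;> nlinarith [(Nat.cast_nonneg n : (0 : ℝ) ≤ n)]

lemma bumpSeq_rOut (n : ℕ) : (bumpSeq N n).rOut = 1 / ((n : ℝ) + 1) := rfl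

lemma bumpSeq_rOut_tendsto : Tendsto (fun n => (bumpSeq N n).rOut) atTop (𝓝 0) := by
  simp only [bumpSeq_rOut]
  exact tendsto_one_div_add_atTop_nhds_zero_nat

/-- The normalised bump functions. -/
def bumpKernel (N n : ℕ) : RN N → ℝ := (bumpSeq N n).normed volume

lemma bumpKernel_eq_zero {n : ℕ} {x : RN N} (hx : 1 ≤ ‖x‖) : bumpKernel N n x = 0 := by
  have h : x ∉ Function.support (bumpKernel N n) := by
    rw [bumpKernel, ContDiffBump.support_normed_eq, Metric.mem_ball, dist_zero_right, bumpSeq_rOut,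
      not_lt]
    refine le_trans ?_ hx
    rw [div_le_one (by positivity)]
    linarith [(Nat.cast_nonneg n : (0 : ℝ) ≤ n)]
  simpa using h

lemma isMollifier_bumpKernel (n : ℕ) : IsMollifier (bumpKernel N n) where
  contDiff := (bumpSeq N n).contDiff_normed
  hasCompactSupport := (bumpSeq N n).hasCompactSupport_normed
  nonneg := (bumpSeq N n).nonneg_normed
  integral_eq_one := (bumpSeq N n).integral_normed
  eq_zero _ := bumpKernel_eq_zero

lemma IsMollifier.mollify_eq_zero {ρ : RN N → ℝ} (hρ : IsMollifier ρ) {f : RN N → E} {x : RN N}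
    (hx : x ∉ Metric.cthickening 1 (tsupport f)) : mollify ρ f x = 0 := by
  refine integral_eq_zero_of_ae (Eventually.of_forall fun y => ?_)
  by_cases hy : 1 ≤ ‖x - y‖
  · simp [hρ.eq_zero _ hy]
  · have : f y = 0 := by
      by_contra hne
      refine hx (Metric.mem_cthickening_of_dist_le x y 1 _ (subset_tsupport f hne) ?_)
      rw [dist_eq_norm]
      exact (not_le.mp hy).le
    simp [this]

lemma IsMollifier.integrable_smul {ρ : RN N → ℝ} (hρ : IsMollifier ρ) {f : RN N → E}
    (hf : LocallyIntegrable f volume) (x : RN N) : Integrable (fun y => ρ (x - y) • f y) := by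
  have hc : Continuous fun y => ρ (x - y) :=
    hρ.contDiff.continuous.comp (continuous_const.sub continuous_id)
  have hs : HasCompactSupport fun y => ρ (x - y) :=
    hρ.hasCompactSupport.comp_homeomorph (Homeomorph.subLeft x)
  exact hf.integrable_smul_left_of_hasCompactSupport hc hs

lemma IsMollifier.integral_comp_sub_left {ρ : RN N → ℝ} (hρ : IsMollifier ρ) (x : RN N) :
    ∫ y, ρ (x - y) = 1 := by
  rw [integral_sub_left_eq_self ρ volume x, hρ.integral_eq_one]

lemma IsMollifier.integrable {ρ : RN N → ℝ} (hρ : IsMollifier ρ) : Integrable ρ :=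
  hρ.contDiff.continuous.integrable_of_hasCompactSupport hρ.hasCompactSupport

lemma IsMollifier.norm_mollify_le {ρ : RN N → ℝ} (hρ : IsMollifier ρ) (f : RN N → E) (x : RN N) :
    ‖mollify ρ f x‖ ≤ mollify ρ (fun y => ‖f y‖) x := by
  refine (norm_integral_le_integral_norm _).trans_eq ?_
  simp only [mollify, norm_smul, Real.norm_eq_abs, abs_of_nonneg (hρ.nonneg _), smul_eq_mul]

lemma IsMollifier.integrable_mollify {ρ : RN N → ℝ} (hρ : IsMollifier ρ) {f : RN N → E}
    (hf : Integrable f) : Integrable (mollify ρ f) := by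
  rw [mollify_eq_convolution]
  exact hρ.integrable.integrable_convolution _ hf

/-- Fubini and ∫ρ = 1: mollification is an L¹ contraction. -/
lemma IsMollifier.integral_norm_mollify_le {ρ : RN N → ℝ} (hρ : IsMollifier ρ) {f : RN N → E}
    (hf : Integrable f) : ∫ x, ‖mollify ρ f x‖ ≤ ∫ x, ‖f x‖ := by
  refine (integral_mono (hρ.integrable_mollify hf).norm (hρ.integrable_mollify hf.norm)
    (hρ.norm_mollify_le f)).trans_eq ?_
  rw [mollify_eq_convolution, integral_convolution _ hρ.integrable hf.norm, hρ.integral_eq_one]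
  simp

lemma IsMollifier.mollify_sub {ρ : RN N → ℝ} (hρ : IsMollifier ρ) {f g : RN N → E}
    (hf : LocallyIntegrable f volume) (hg : LocallyIntegrable g volume) (x : RN N) :
    mollify ρ (fun y => f y - g y) x = mollify ρ f x - mollify ρ g x := by
  simp only [mollify, smul_sub]
  exact integral_sub (hρ.integrable_smul hf x) (hρ.integrable_smul hg x)

lemma IsMollifier.mollify_add {ρ : RN N → ℝ} (hρ : IsMollifier ρ) {f g : RN N → E}
    (hf : LocallyIntegrable f volume) (hg : LocallyIntegrable g volume) (x : RN N) :
    mollify ρ (fun y => f y + g y) x = mollify ρ f x + mollify ρ g x := by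
  simp only [mollify, smul_add]
  exact integral_add (hρ.integrable_smul hf x) (hρ.integrable_smul hg x)

lemma IsMollifier.contDiff_mollify {ρ : RN N → ℝ} (hρ : IsMollifier ρ) {f : RN N → E}
    (hf : LocallyIntegrable f volume) : ContDiff ℝ ∞ (mollify ρ f) := by
  rw [mollify_eq_convolution]
  exact hρ.hasCompactSupport.contDiff_convolution_left _ hρ.contDiff hf

variable [CompleteSpace E]

/-- Uniform continuity makes the error uniformly small, and all errors vanish outside one compact
set of finite volume. -/
lemma tendsto_integral_norm_mollify_sub_of_continuous {g : RN N → E} (hg : Continuous g)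
    (hs : HasCompactSupport g) :
    Tendsto (fun n => ∫ x, ‖mollify (bumpKernel N n) g x - g x‖) atTop (𝓝 0) := by
  set K : Set (RN N) := Metric.cthickening 1 (tsupport g) with hK
  have hKc : IsCompact K := hs.isCompact.cthickening
  have hzero : ∀ n x, x ∉ K → mollify (bumpKernel N n) g x - g x = 0 := by
    intro n x hx
    have hgx : g x = 0 := by
      by_contra hne
      exact hx (Metric.self_subset_cthickening _ (subset_tsupport g hne))
    rw [(isMollifier_bumpKernel n).mollify_eq_zero hx, hgx, sub_zero]
  have huc := hs.uniformContinuous_of_continuous hg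
  rw [Metric.tendsto_atTop]
  intro ε hε
  set V : ℝ := volume.real K
  have hV : 0 ≤ V := measureReal_nonneg
  -- The denominator is V + 1 rather than V so that the quotient makes sense even when V = 0.
  obtain ⟨δ, hδ, hδε⟩ := Metric.uniformContinuous_iff.mp huc (ε / (V + 1)) (by positivity)
  obtain ⟨n₀, hn₀⟩ := (Metric.tendsto_atTop.mp (bumpSeq_rOut_tendsto (N := N))) δ hδ
  refine ⟨n₀, fun n hn => ?_⟩
  have hb : ∀ x, ‖mollify (bumpKernel N n) g x - g x‖ ≤ ε / (V + 1) := by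
    intro x
    rw [← dist_eq_norm, mollify_eq_convolution]
    refine (bumpSeq N n).dist_normed_convolution_le hg.aestronglyMeasurable fun y hy => ?_
    refine (hδε (lt_of_lt_of_le hy ?_)).le
    have := hn₀ n hn
    rw [Real.dist_eq, sub_zero] at this
    exact (le_abs_self _).trans this.le
  rw [Real.dist_eq, sub_zero, abs_of_nonneg (integral_nonneg fun _ => norm_nonneg _)]
  rw [← setIntegral_eq_integral_of_forall_compl_eq_zero (s := K)
    (fun x hx => by rw [hzero n x hx, norm_zero])]
  have h1 := norm_setIntegral_le_of_norm_le_const (μ := volume) (s := K)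
    (f := fun x => ‖mollify (bumpKernel N n) g x - g x‖) (C := ε / (V + 1))
    hKc.measure_lt_top (fun x _ => by rw [norm_norm]; exact hb x)
  refine (le_abs_self _).trans_lt (lt_of_le_of_lt h1 ?_)
  change ε / (V + 1) * V < ε
  rw [div_mul_eq_mul_div, div_lt_iff₀ (by positivity)]
  nlinarith

/-- Density of compactly supported continuous functions in L¹ reduces to the previous lemma; the L¹
contraction controls the mollified remainder. -/
lemma tendsto_integral_norm_mollify_sub {f : RN N → E} (hf : Integrable f) :
    Tendsto (fun n => ∫ x, ‖mollify (bumpKernel N n) f x - f x‖) atTop (𝓝 0) := by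
  rw [Metric.tendsto_atTop]
  intro ε hε
  obtain ⟨g, hgs, hg, hgc, hgi⟩ := hf.exists_hasCompactSupport_integral_sub_le
    (show 0 < ε / 4 by positivity)
  obtain ⟨n₀, hn₀⟩ := Metric.tendsto_atTop.mp
    (tendsto_integral_norm_mollify_sub_of_continuous hgc hgs) (ε / 4) (by positivity)
  refine ⟨n₀, fun n hn => ?_⟩
  have hρ := isMollifier_bumpKernel (N := N) n
  have h1 := hn₀ n hn
  rw [Real.dist_eq, sub_zero, abs_of_nonneg (integral_nonneg fun _ => norm_nonneg _)] at h1 ⊢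
  have hfg : Integrable fun x => f x - g x := hf.sub hgi
  have h2 := hρ.integral_norm_mollify_le hfg
  have hi1 : Integrable fun x => ‖mollify (bumpKernel N n) (fun y => f y - g y) x‖ :=
    (hρ.integrable_mollify hfg).norm
  have hi2 : Integrable fun x => ‖mollify (bumpKernel N n) g x - g x‖ :=
    ((hρ.integrable_mollify hgi).sub hgi).norm
  have h3 : ∫ x, ‖mollify (bumpKernel N n) f x - f x‖ ≤
      ∫ x, (‖mollify (bumpKernel N n) (fun y => f y - g y) x‖ +
        ‖mollify (bumpKernel N n) g x - g x‖ + ‖f x - g x‖) := by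
    refine integral_mono ((hρ.integrable_mollify hf).sub hf).norm ((hi1.add hi2).add hfg.norm)
      fun x => ?_
    dsimp only
    rw [hρ.mollify_sub hf.locallyIntegrable hgi.locallyIntegrable]
    have : mollify (bumpKernel N n) f x - f x = (mollify (bumpKernel N n) f x -
      mollify (bumpKernel N n) g x) + (mollify (bumpKernel N n) g x - g x) - (f x - g x) := by abel
    rw [this]
    refine (norm_sub_le _ _).trans ?_
    gcongr
    exact norm_add_le _ _
  have h4 := integral_add (hi1.add hi2) hfg.norm
  have h5 := integral_add hi1 hi2
  simp only [Pi.add_apply] at h4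
  linarith

/-- Mollifications converge almost everywhere, along a sequence that is dominated on a given
compact set by an integrable function. -/
theorem exists_mollifier_seq {f : RN N → E} (hf : LocallyIntegrable f volume) {K : Set (RN N)}
    (hK : IsCompact K) :
    ∃ ρ : ℕ → RN N → ℝ, (∀ n, IsMollifier (ρ n)) ∧ ∃ H : RN N → ℝ, IntegrableOn H K ∧
      (∀ᵐ x ∂(volume.restrict K), ∀ n, ‖mollify (ρ n) f x‖ ≤ H x) ∧
      ∀ᵐ x ∂(volume.restrict K), Tendsto (fun n => mollify (ρ n) f x) atTop (𝓝 (f x)) := by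
  set K' : Set (RN N) := Metric.cthickening 1 K
  have hK' : IsCompact K' := hK.cthickening
  -- The kernels live in the unit ball, so truncating to the unit thickening of `K` leaves the
  -- mollifications on `K` unchanged and makes the function globally integrable.
  set F : RN N → E := K'.indicator f
  have hF : Integrable F := (hf.integrableOn_isCompact hK').integrable_indicator
    hK'.isClosed.measurableSet
  have heq : ∀ n, ∀ x ∈ K, mollify (bumpKernel N n) f x = mollify (bumpKernel N n) F x := by
    intro n x hx
    refine integral_congr_ae (Eventually.of_forall fun y => ?_)
    by_cases hy : ‖x - y‖ < 1
    · have : y ∈ K' := Metric.mem_cthickening_of_dist_le y x 1 _ hx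
        (by rw [dist_comm, dist_eq_norm]; exact hy.le)
      simp [F, this]
    · simp [bumpKernel_eq_zero (not_lt.mp hy)]
  have hlim := tendsto_integral_norm_mollify_sub hF
  -- As in the Riesz–Fischer theorem: along a fast subsequence the L¹ errors are summable, so the
  -- pointwise sum of the errors is integrable and serves in the dominating function. The condition
  -- k ≤ n keeps the subsequence cofinal.
  have hex : ∀ k : ℕ, ∃ n, k ≤ n ∧
      ∫ x, ‖mollify (bumpKernel N n) F x - F x‖ ≤ (1 / 2 : ℝ) ^ k := by
    intro k
    have h1 : ∀ᶠ n in atTop, ∫ x, ‖mollify (bumpKernel N n) F x - F x‖ < (1 / 2 : ℝ) ^ k :=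
      hlim.eventually_lt_const (by positivity)
    obtain ⟨n, hn1, hn2⟩ := (h1.and (eventually_ge_atTop k)).exists
    exact ⟨n, hn2, hn1.le⟩
  choose s hs1 hs2 using hex
  have hint : ∀ k, Integrable fun x => mollify (bumpKernel N (s k)) F x - F x := fun k =>
    ((isMollifier_bumpKernel _).integrable_mollify hF).sub hF
  have hsum : ∑' k, ∫⁻ x, ‖mollify (bumpKernel N (s k)) F x - F x‖ₑ ≠ ⊤ := by
    have : ∀ k, ∫⁻ x, ‖mollify (bumpKernel N (s k)) F x - F x‖ₑ ≤ ENNReal.ofReal ((1 / 2) ^ k) := by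
      intro k
      rw [← ofReal_integral_norm_eq_lintegral_enorm (hint k)]
      exact ENNReal.ofReal_le_ofReal (hs2 k)
    refine ne_top_of_le_ne_top ?_ (ENNReal.tsum_le_tsum this)
    rw [← ENNReal.ofReal_tsum_of_nonneg (fun k => by positivity)
      (summable_geometric_of_lt_one (by norm_num) (by norm_num))]
    exact ENNReal.ofReal_ne_top
  rw [← lintegral_tsum fun k => (hint k).aestronglyMeasurable.enorm] at hsum
  have hmeas : AEMeasurable fun x => ∑' k, ‖mollify (bumpKernel N (s k)) F x - F x‖ₑ :=
    AEMeasurable.tsum fun k => (hint k).aestronglyMeasurable.enorm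
  have hS : Integrable fun x => (∑' k, ‖mollify (bumpKernel N (s k)) F x - F x‖ₑ).toReal :=
    integrable_toReal_of_lintegral_ne_top hmeas hsum
  have hfin := ae_lt_top' hmeas hsum
  refine ⟨fun k => bumpKernel N (s k), fun k => isMollifier_bumpKernel _, fun x => ‖F x‖ +
    (∑' k, ‖mollify (bumpKernel N (s k)) F x - F x‖ₑ).toReal, (hF.norm.add hS).integrableOn, ?_, ?_⟩
  · rw [ae_restrict_iff' hK.isClosed.measurableSet]
    filter_upwards [hfin] with x hx hxK k
    rw [heq _ x hxK]
    have h1 : ‖mollify (bumpKernel N (s k)) F x - F x‖ ≤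
        (∑' k, ‖mollify (bumpKernel N (s k)) F x - F x‖ₑ).toReal := by
      rw [← toReal_enorm]
      exact ENNReal.toReal_mono hx.ne (ENNReal.le_tsum k)
    have h2 : mollify (bumpKernel N (s k)) F x =
      F x + (mollify (bumpKernel N (s k)) F x - F x) := by abel
    rw [h2]
    exact (norm_add_le _ _).trans (by simpa using h1)
  · rw [ae_restrict_iff' hK.isClosed.measurableSet]
    have hst : Tendsto s atTop atTop := tendsto_atTop_mono hs1 tendsto_id
    -- Lebesgue differentiation for bumps of comparable radii; here the outer radius is exactly
    -- twice the inner one.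
    have := ContDiffBump.ae_convolution_tendsto_right_of_locallyIntegrable
      (φ := fun k => bumpSeq N (s k)) (l := atTop) (K := 2) (μ := (volume : Measure (RN N)))
      (bumpSeq_rOut_tendsto.comp hst)
      (Eventually.of_forall fun k => by
        simp only [bumpSeq]
        apply le_of_eq
        field_simp) hf
    filter_upwards [this] with x hx _
    simp only [mollify_eq_convolution]
    exact hx

variable {ρ : RN N → ℝ}

lemma IsMollifier.mollify_nonneg (hρ : IsMollifier ρ) {f : RN N → ℝ} (hf : ∀ᵐ x, 0 ≤ f x)
    (x : RN N) : 0 ≤ mollify ρ f x := by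
  refine integral_nonneg_of_ae ?_
  filter_upwards [hf] with y hy
  exact mul_nonneg (hρ.nonneg _) hy

lemma IsMollifier.mollify_mono (hρ : IsMollifier ρ) {f g : RN N → ℝ}
    (hf : LocallyIntegrable f volume) (hg : LocallyIntegrable g volume)
    (hfg : ∀ᵐ x, f x ≤ g x) (x : RN N) : mollify ρ f x ≤ mollify ρ g x := by
  refine integral_mono_ae (hρ.integrable_smul hf x) (hρ.integrable_smul hg x) ?_
  filter_upwards [hfg] with y hy
  exact mul_le_mul_of_nonneg_left hy (hρ.nonneg _)

lemma mollify_const_mul (c : ℝ) (f : RN N → ℝ) (x : RN N) :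
    mollify ρ (fun y => c * f y) x = c * mollify ρ f x := by
  simp only [mollify, smul_eq_mul, ← integral_const_mul]
  congr 1; ext y; ring

lemma IsMollifier.mollify_const (hρ : IsMollifier ρ) (c : ℝ) (x : RN N) :
    mollify ρ (fun _ => c) x = c := by
  simp only [mollify, smul_eq_mul, integral_mul_const, hρ.integral_comp_sub_left, one_mul]

/-- Cauchy–Schwarz inequality for mollifications. -/
lemma IsMollifier.norm_mollify_sq_le {F : Type*} [NormedAddCommGroup F] [NormedSpace ℝ F]
    (hρ : IsMollifier ρ) {f : RN N → F} {p q : RN N → ℝ}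
    (hf : LocallyIntegrable f volume) (hp : LocallyIntegrable p volume)
    (hq : LocallyIntegrable q volume) (hp0 : ∀ᵐ x, 0 ≤ p x) (hq0 : ∀ᵐ x, 0 ≤ q x)
    (h : ∀ᵐ x, ‖f x‖ ^ 2 ≤ p x * q x) (x : RN N) :
    ‖mollify ρ f x‖ ^ 2 ≤ mollify ρ p x * mollify ρ q x := by
  set P := mollify ρ p x
  set Q := mollify ρ q x
  set F := mollify ρ (fun y => ‖f y‖) x
  have hP : 0 ≤ P := hρ.mollify_nonneg hp0 x
  have hQ : 0 ≤ Q := hρ.mollify_nonneg hq0 x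
  have hF : 0 ≤ F := hρ.mollify_nonneg (Eventually.of_forall fun _ => norm_nonneg _) x
  have hlf : LocallyIntegrable (fun y => ‖f y‖) volume := fun y => by
    obtain ⟨s, hs, h⟩ := hf y
    exact ⟨s, hs, h.norm⟩
  -- Discriminant argument: mollify the pointwise inequality 2t‖f‖ ≤ t²p + q for t > 0; for t ≤ 0
  -- every term is nonnegative.
  have key : ∀ t : ℝ, 0 ≤ P * (t * t) + (-2 * F) * t + Q := by
    intro t
    rcases le_or_gt t 0 with ht | ht
    · nlinarith [mul_nonneg hF (neg_nonneg.mpr ht), mul_nonneg hP (mul_self_nonneg t)]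
    · have h1 : mollify ρ (fun y => 2 * t * ‖f y‖) x ≤ mollify ρ (fun y => t * t * p y + q y) x := by
        refine hρ.mollify_mono (hlf.smul (2 * t)) ((hp.smul (t * t)).add hq) ?_ x
        filter_upwards [hp0, hq0, h] with y h1 h2 h3
        have h4 : (2 * t * ‖f y‖) ^ 2 ≤ (t * t * p y + q y) ^ 2 := by
          have : t ^ 2 * ‖f y‖ ^ 2 ≤ t ^ 2 * (p y * q y) := by gcongr
          nlinarith [sq_nonneg (t * t * p y - q y)]
        exact (le_abs_self _).trans (abs_le_of_sq_le_sq h4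
          (add_nonneg (mul_nonneg (mul_self_nonneg t) h1) h2))
      rw [mollify_const_mul, hρ.mollify_add (f := fun y => t * t * p y) (hp.smul (t * t)) hq,
        mollify_const_mul] at h1
      linarith
  have hd := discrim_le_zero key
  have h2 : ‖mollify ρ f x‖ ^ 2 ≤ F ^ 2 := by gcongr; exact hρ.norm_mollify_le f x
  rw [discrim] at hd
  nlinarith

lemma mollify_clm_comp {E' : Type*} [NormedAddCommGroup E'] [NormedSpace ℝ E'] [CompleteSpace E']
    (hρ : IsMollifier ρ) (L : E →L[ℝ] E') {f : RN N → E} (hf : LocallyIntegrable f volume)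
    (x : RN N) : mollify ρ (fun y => L (f y)) x = L (mollify ρ f x) := by
  simp only [mollify, ← L.map_smul]
  exact L.integral_comp_comm (hρ.integrable_smul hf x)

end Mollification

/-! ### Weak gradients: uniqueness and compatibility with mollification. -/

section WeakGradient

variable {N : ℕ}

section LocallyIntegrable

variable {E F : Type*} [NormedAddCommGroup E] [NormedAddCommGroup F]

lemma MeasureTheory.LocallyIntegrable.norm' {f : RN N → E} (hf : LocallyIntegrable f volume) :
    LocallyIntegrable (fun x => ‖f x‖) volume := fun x => by
  obtain ⟨s, hs, h⟩ := hf x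
  exact ⟨s, hs, h.norm⟩

lemma MeasureTheory.LocallyIntegrable.prodMk {f : RN N → E} {g : RN N → F}
    (hf : LocallyIntegrable f volume) (hg : LocallyIntegrable g volume) :
    LocallyIntegrable (fun x => (f x, g x)) volume := fun x => by
  obtain ⟨s, hs, h⟩ := hf x
  obtain ⟨t, ht, h'⟩ := hg x
  exact ⟨s ∩ t, inter_mem hs ht, (h.mono_set Set.inter_subset_left).prodMk
    (h'.mono_set Set.inter_subset_right)⟩

lemma MeasureTheory.LocallyIntegrable.bdd_smul [NormedSpace ℝ E] {f : RN N → E} {c : RN N → ℝ}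
    {C : ℝ} (hf : LocallyIntegrable f volume) (hc : AEStronglyMeasurable c volume)
    (hC : ∀ᵐ x, |c x| ≤ C) : LocallyIntegrable (fun x => c x • f x) volume := by
  refine (hf.smul C).mono (hc.smul hf.aestronglyMeasurable) ?_
  filter_upwards [hC] with x hx
  rw [norm_smul, Pi.smul_apply, norm_smul, Real.norm_eq_abs, Real.norm_eq_abs]
  exact mul_le_mul_of_nonneg_right (hx.trans (le_abs_self C)) (norm_nonneg _)

end LocallyIntegrable

lemma IsTestFunction.exists_bound {ψ : RN N → ℝ} (hψ : IsTestFunction ψ) (v : RN N) :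
    ∃ B, 0 ≤ B ∧ ∀ x, |ψ x| ≤ B ∧ |fderiv ℝ ψ x v| ≤ B := by
  obtain ⟨B₁, h₁⟩ := hψ.2.exists_bound_of_continuous hψ.1.continuous
  obtain ⟨B₂, h₂⟩ := (hψ.2.fderiv_apply (𝕜 := ℝ) v).exists_bound_of_continuous
    ((hψ.1.continuous_fderiv (by simp)).clm_apply continuous_const)
  refine ⟨max B₁ B₂, ((norm_nonneg _).trans (h₁ 0)).trans (le_max_left _ _), fun x => ⟨?_, ?_⟩⟩
  · exact (h₁ x).trans (le_max_left _ _)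
  · exact (h₂ x).trans (le_max_right _ _)

lemma IsMollifier.isTestFunction_comp_sub {ρ : RN N → ℝ} (hρ : IsMollifier ρ) (x : RN N) :
    IsTestFunction fun y => ρ (x - y) :=
  ⟨hρ.contDiff.comp (contDiff_const.sub contDiff_id),
    hρ.hasCompactSupport.comp_homeomorph (Homeomorph.subLeft x)⟩

lemma IsMollifier.fderiv_comp_sub {ρ : RN N → ℝ} (hρ : IsMollifier ρ) (x y v : RN N) :
    fderiv ℝ (fun y => ρ (x - y)) y v = - fderiv ℝ ρ (x - y) v := by
  have h : HasFDerivAt ρ (fderiv ℝ ρ (x - y)) (x - y) :=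
    (hρ.contDiff.differentiable (by simp) _).hasFDerivAt
  have h2 : HasFDerivAt (fun y => x - y) (-ContinuousLinearMap.id ℝ (RN N)) y :=
    (hasFDerivAt_id y).const_sub x
  have h3 := (h.comp y h2).fderiv
  change fderiv ℝ (ρ ∘ fun y => x - y) y v = _
  rw [h3]
  simp

lemma IsMollifier.fderiv_mollify {ρ : RN N → ℝ} (hρ : IsMollifier ρ) {f : RN N → ℝ}
    (hf : LocallyIntegrable f volume) (x v : RN N) :
    fderiv ℝ (mollify ρ f) x v = ∫ y, fderiv ℝ ρ (x - y) v * f y := by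
  rw [mollify_eq_convolution]
  have h := hρ.hasCompactSupport.hasFDerivAt_convolution_left
    (ContinuousLinearMap.lsmul ℝ ℝ : ℝ →L[ℝ] ℝ →L[ℝ] ℝ) (μ := volume)
    (hρ.contDiff.of_le (by simp)) hf x
  rw [h.fderiv, convolution_eq_swap]
  have hint : Integrable fun y => ((ContinuousLinearMap.lsmul ℝ ℝ : ℝ →L[ℝ] ℝ →L[ℝ] ℝ).precompL
      (RN N)) (fderiv ℝ ρ (x - y)) (f y) := by
    have := (hρ.hasCompactSupport.fderiv (𝕜 := ℝ)).convolutionExists_left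
      ((ContinuousLinearMap.lsmul ℝ ℝ : ℝ →L[ℝ] ℝ →L[ℝ] ℝ).precompL (RN N)) (μ := volume)
      (hρ.contDiff.continuous_fderiv (by simp)) hf x
    exact this.integrable_swap
  rw [ContinuousLinearMap.integral_apply hint]
  rfl

/-- Test the weak gradient against y ↦ ρ(x - y); the sign from the reflection cancels the one in the
definition. -/
lemma HasWeakGradient.fderiv_mollify {ρ : RN N → ℝ} (hρ : IsMollifier ρ) {f : RN N → ℝ}
    {g : RN N → RN N} (h : HasWeakGradient f g) (x v : RN N) :
    fderiv ℝ (mollify ρ f) x v = inner ℝ (mollify ρ g x) v := by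
  rw [hρ.fderiv_mollify h.locallyIntegrable]
  have h1 := h.integral_eq _ (hρ.isTestFunction_comp_sub x) v
  simp only [hρ.fderiv_comp_sub, mul_neg, integral_neg, neg_inj] at h1
  have h2 : (fun y => fderiv ℝ ρ (x - y) v * f y) = fun y => f y * fderiv ℝ ρ (x - y) v := by
    ext y; ring
  rw [h2, h1]
  have h3 := mollify_clm_comp hρ (innerSL ℝ v) h.locallyIntegrable_grad x
  rw [innerSL_apply_apply, real_inner_comm] at h3
  rw [← h3, mollify]
  congr 1; ext y
  rw [innerSL_apply_apply, real_inner_comm, smul_eq_mul, mul_comm]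

lemma HasWeakGradient.ae_eq {f : RN N → ℝ} {g g' : RN N → RN N} (h : HasWeakGradient f g)
    (h' : HasWeakGradient f g') : g =ᵐ[volume] g' := by
  refine ae_eq_of_integral_contDiff_smul_eq h.locallyIntegrable_grad h'.locallyIntegrable_grad
    fun ψ hψ hψc => ?_
  have hi : ∀ k : RN N → RN N, LocallyIntegrable k volume → Integrable fun x => ψ x • k x :=
    fun k hk => hk.integrable_smul_left_of_hasCompactSupport hψ.continuous hψc
  refine ext_inner_left ℝ fun v => ?_
  rw [← integral_inner (hi _ h.locallyIntegrable_grad),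
    ← integral_inner (hi _ h'.locallyIntegrable_grad)]
  have h1 := h.integral_eq ψ ⟨hψ, hψc⟩ v
  rw [h'.integral_eq ψ ⟨hψ, hψc⟩ v, neg_inj] at h1
  simp only [inner_smul_right, real_inner_comm, mul_comm] at h1 ⊢
  exact h1.symm

/-- Makes the arbitrary choice in `weakGrad` harmless: any explicit gradient may replace it almost
everywhere. -/
lemma HasWeakGradient.weakGrad_ae_eq {f : RN N → ℝ} {g : RN N → RN N} (h : HasWeakGradient f g) :
    weakGrad f =ᵐ[volume] g := by
  have hex : ∃ g, HasWeakGradient f g := ⟨g, h⟩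
  have : HasWeakGradient f (weakGrad f) := by
    rw [weakGrad, dif_pos hex]; exact hex.choose_spec
  exact this.ae_eq h

lemma hasWeakGradient_weakGrad {f : RN N → ℝ} (h : ∃ g, HasWeakGradient f g) :
    HasWeakGradient f (weakGrad f) := by
  rw [weakGrad, dif_pos h]; exact h.choose_spec

lemma hasWeakLaplacian_weakLaplacian {f : RN N → ℝ} (h : ∃ g, HasWeakLaplacian f g) :
    HasWeakLaplacian f (weakLaplacian f) := by
  rw [weakLaplacian, dif_pos h]; exact h.choose_spec

/-- Integration by parts of a `C^1` function against a compactly supported `C^1` function. -/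
lemma integral_mul_fderiv_eq_neg {f ψ : RN N → ℝ} (hf : ContDiff ℝ 1 f) (hψ : ContDiff ℝ 1 ψ)
    (hs : HasCompactSupport ψ) (v : RN N) :
    ∫ x, f x * fderiv ℝ ψ x v = - ∫ x, fderiv ℝ f x v * ψ x := by
  have hf' : Continuous fun x => fderiv ℝ f x v :=
    (hf.continuous_fderiv (by simp)).clm_apply continuous_const
  have hψ' : Continuous fun x => fderiv ℝ ψ x v :=
    (hψ.continuous_fderiv (by simp)).clm_apply continuous_const
  refine integral_mul_fderiv_eq_neg_fderiv_mul_of_integrable ?_ ?_ ?_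
    (fun x _ => hf.differentiable (by simp) x) (fun x _ => hψ.differentiable (by simp) x)
  · exact (hf'.mul hψ.continuous).integrable_of_hasCompactSupport hs.mul_left
  · exact (hf.continuous.mul hψ').integrable_of_hasCompactSupport
      (hs.fderiv_apply (𝕜 := ℝ) v).mul_left
  · exact (hf.continuous.mul hψ.continuous).integrable_of_hasCompactSupport hs.mul_left

lemma hasWeakGradient_of_contDiff {f : RN N → ℝ} (hf : ContDiff ℝ 1 f) :
    HasWeakGradient f (gradient f) where
  locallyIntegrable := hf.continuous.locallyIntegrable
  locallyIntegrable_grad := by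
    apply Continuous.locallyIntegrable
    exact (InnerProductSpace.toDual ℝ (RN N)).symm.continuous.comp
      (hf.continuous_fderiv (by simp))
  integral_eq ψ hψ v := by
    rw [integral_mul_fderiv_eq_neg hf (hψ.1.of_le (by simp)) hψ.2]
    simp only [gradient, InnerProductSpace.toDual_symm_apply]

end WeakGradient

/-! ### Chain and product rules for weak gradients. -/

section ChainRule

variable {N : ℕ}

lemma HasWeakGradient.congr_left {f f' : RN N → ℝ} {g : RN N → RN N} (h : HasWeakGradient f g)
    (hf : f =ᵐ[volume] f') : HasWeakGradient f' g where
  locallyIntegrable := h.locallyIntegrable.congr hf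
  locallyIntegrable_grad := h.locallyIntegrable_grad
  integral_eq ψ hψ v := by
    rw [← h.integral_eq ψ hψ v]
    refine integral_congr_ae ?_
    filter_upwards [hf] with x hx
    rw [hx]

lemma hasWeakGradient_zero : HasWeakGradient (fun _ : RN N => (0 : ℝ)) (fun _ => 0) where
  locallyIntegrable := locallyIntegrable_const 0
  locallyIntegrable_grad := locallyIntegrable_const 0
  integral_eq ψ hψ v := by simp

lemma mollify_prodMk {E F : Type*} [NormedAddCommGroup E] [NormedSpace ℝ E] [CompleteSpace E]
    [NormedAddCommGroup F] [NormedSpace ℝ F] [CompleteSpace F] {ρ : RN N → ℝ}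
    (hρ : IsMollifier ρ) {f : RN N → E} {g : RN N → F} (hf : LocallyIntegrable f volume)
    (hg : LocallyIntegrable g volume) (x : RN N) :
    mollify ρ (fun y => (f y, g y)) x = (mollify ρ f x, mollify ρ g x) := by
  have h1 := mollify_clm_comp hρ (ContinuousLinearMap.fst ℝ E F) (hf.prodMk hg) x
  have h2 := mollify_clm_comp hρ (ContinuousLinearMap.snd ℝ E F) (hf.prodMk hg) x
  exact Prod.ext h1.symm h2.symm

lemma HasWeakGradient.fderiv_mollify_eq {ρ : RN N → ℝ} (hρ : IsMollifier ρ) {f : RN N → ℝ}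
    {g : RN N → RN N} (h : HasWeakGradient f g) (x : RN N) :
    fderiv ℝ (mollify ρ f) x = innerSL ℝ (mollify ρ g x) := by
  ext v
  rw [h.fderiv_mollify hρ, innerSL_apply_apply]

lemma IsMollifier.abs_mollify_le {ρ : RN N → ℝ} (hρ : IsMollifier ρ) {f : RN N → ℝ} {M : ℝ}
    (hf : LocallyIntegrable f volume) (hM : ∀ᵐ x, |f x| ≤ M) (x : RN N) : |mollify ρ f x| ≤ M := by
  refine (hρ.norm_mollify_le f x).trans ?_
  refine (hρ.mollify_mono hf.norm' (locallyIntegrable_const M) hM x).trans_eq ?_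
  exact hρ.mollify_const M x

/-- Chain rule for `T(u) R(v)`, where `u` is bounded and `R`, `R'` are bounded. -/
theorem HasWeakGradient.comp_mul_comp {u v : RN N → ℝ} {gu gv : RN N → RN N}
    (hu : HasWeakGradient u gu) (hv : HasWeakGradient v gv) {M : ℝ} (hM : ∀ᵐ x, |u x| ≤ M)
    {T T' R R' : ℝ → ℝ} (hT : ∀ s, HasDerivAt T (T' s) s) (hT' : Continuous T')
    (hR : ∀ s, HasDerivAt R (R' s) s) (hR' : Continuous R') {C : ℝ} (hRC : ∀ t, |R t| ≤ C)
    (hRC' : ∀ t, |R' t| ≤ C) :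
    HasWeakGradient (fun x => T (u x) * R (v x))
      (fun x => (T' (u x) * R (v x)) • gu x + (T (u x) * R' (v x)) • gv x) := by
  have hTc : Continuous T := continuous_iff_continuousAt.mpr fun s => (hT s).continuousAt
  have hRc : Continuous R := continuous_iff_continuousAt.mpr fun s => (hR s).continuousAt
  have hT1 : ContDiff ℝ 1 T := by
    refine contDiff_one_iff_deriv.mpr ⟨fun s => (hT s).differentiableAt, ?_⟩
    rwa [show deriv T = T' from funext fun s => (hT s).deriv]
  have hR1 : ContDiff ℝ 1 R := by
    refine contDiff_one_iff_deriv.mpr ⟨fun s => (hR s).differentiableAt, ?_⟩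
    rwa [show deriv R = R' from funext fun s => (hR s).deriv]
  -- `T` and `T'` are bounded only on [-M, M]; this is enough, since mollifications of `u` stay in
  -- that interval.
  obtain ⟨D₁, hD₁⟩ := (isCompact_Icc (a := -M) (b := M)).exists_bound_of_continuousOn
    hTc.continuousOn
  obtain ⟨D₂, hD₂⟩ := (isCompact_Icc (a := -M) (b := M)).exists_bound_of_continuousOn
    hT'.continuousOn
  set D := max 0 (max D₁ D₂)
  have hD0 : 0 ≤ D := le_max_left _ _
  have hDT : ∀ s, |s| ≤ M → |T s| ≤ D := fun s hs =>
    (hD₁ s (abs_le.mp hs)).trans ((le_max_left _ _).trans (le_max_right _ _))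
  have hDT' : ∀ s, |s| ≤ M → |T' s| ≤ D := fun s hs =>
    (hD₂ s (abs_le.mp hs)).trans ((le_max_right _ _).trans (le_max_right _ _))
  have hC0 : 0 ≤ C := (abs_nonneg _).trans (hRC 0)
  have hub := hu.locallyIntegrable.aestronglyMeasurable
  have hvb := hv.locallyIntegrable.aestronglyMeasurable
  have b1 : ∀ s t, |s| ≤ M → |T s * R t| ≤ D * C := fun s t hs => by
    rw [abs_mul]; exact mul_le_mul (hDT s hs) (hRC t) (abs_nonneg _) hD0
  have b2 : ∀ s t, |s| ≤ M → |T' s * R t| ≤ D * C := fun s t hs => by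
    rw [abs_mul]; exact mul_le_mul (hDT' s hs) (hRC t) (abs_nonneg _) hD0
  have b3 : ∀ s t, |s| ≤ M → |T s * R' t| ≤ D * C := fun s t hs => by
    rw [abs_mul]; exact mul_le_mul (hDT s hs) (hRC' t) (abs_nonneg _) hD0
  refine ⟨?_, ?_, ?_⟩
  · refine (locallyIntegrable_const (D * C)).mono ((hTc.comp_aestronglyMeasurable hub).mul
      (hRc.comp_aestronglyMeasurable hvb)) ?_
    filter_upwards [hM] with x hx
    exact (b1 _ _ hx).trans (le_abs_self _)
  · refine (hu.locallyIntegrable_grad.bdd_smul (C := D * C) ((hT'.comp_aestronglyMeasurable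
      hub).mul (hRc.comp_aestronglyMeasurable hvb)) ?_).add
      (hv.locallyIntegrable_grad.bdd_smul (C := D * C) ((hTc.comp_aestronglyMeasurable
      hub).mul (hR'.comp_aestronglyMeasurable hvb)) ?_)
    · filter_upwards [hM] with x hx using b2 _ _ hx
    · filter_upwards [hM] with x hx using b3 _ _ hx
  · intro ψ hψ e
    set K := tsupport ψ
    have hK : IsCompact K := hψ.2
    -- Mollifying the tuple of all functions involved yields one sequence of kernels and one
    -- dominating function for all of them.
    obtain ⟨ρ, hρ, H, hH, hdom, hlim⟩ := exists_mollifier_seq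
      (hu.locallyIntegrable_grad.prodMk (hv.locallyIntegrable_grad.prodMk
        (hu.locallyIntegrable.prodMk hv.locallyIntegrable))) hK
    have hmol : ∀ n x, mollify (ρ n) (fun y => (gu y, gv y, u y, v y)) x =
        (mollify (ρ n) gu x, mollify (ρ n) gv x, mollify (ρ n) u x, mollify (ρ n) v x) := by
      intro n x
      rw [mollify_prodMk (hρ n) hu.locallyIntegrable_grad (hv.locallyIntegrable_grad.prodMk
        (hu.locallyIntegrable.prodMk hv.locallyIntegrable)), mollify_prodMk (hρ n)
        hv.locallyIntegrable_grad (hu.locallyIntegrable.prodMk hv.locallyIntegrable),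
        mollify_prodMk (hρ n) hu.locallyIntegrable hv.locallyIntegrable]
    simp only [hmol] at hdom hlim
    obtain ⟨B, hB0, hB⟩ := hψ.exists_bound e
    have cu : ∀ n, ContDiff ℝ ∞ (mollify (ρ n) u) := fun n =>
      (hρ n).contDiff_mollify hu.locallyIntegrable
    have cv : ∀ n, ContDiff ℝ ∞ (mollify (ρ n) v) := fun n =>
      (hρ n).contDiff_mollify hv.locallyIntegrable
    have cgu : ∀ n, Continuous (mollify (ρ n) gu) := fun n =>
      ((hρ n).contDiff_mollify hu.locallyIntegrable_grad).continuous
    have cgv : ∀ n, Continuous (mollify (ρ n) gv) := fun n =>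
      ((hρ n).contDiff_mollify hv.locallyIntegrable_grad).continuous
    have cψ : Continuous ψ := hψ.1.continuous
    have cψ' : Continuous fun x => fderiv ℝ ψ x e :=
      (hψ.1.continuous_fderiv (by simp)).clm_apply continuous_const
    have hun : ∀ n x, |mollify (ρ n) u x| ≤ M := fun n x =>
      (hρ n).abs_mollify_le hu.locallyIntegrable hM x
    have happrox : ∀ n, ∫ x in K, (T (mollify (ρ n) u x) * R (mollify (ρ n) v x)) *
        fderiv ℝ ψ x e = - ∫ x in K, inner ℝ ((T' (mollify (ρ n) u x) * R (mollify (ρ n) v x)) •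
          mollify (ρ n) gu x + (T (mollify (ρ n) u x) * R' (mollify (ρ n) v x)) •
          mollify (ρ n) gv x) e * ψ x := by
      intro n
      rw [setIntegral_eq_integral_of_forall_compl_eq_zero,
        setIntegral_eq_integral_of_forall_compl_eq_zero]
      · refine (integral_mul_fderiv_eq_neg (((hT1.comp ((cu n).of_le (by simp))).mul
          (hR1.comp ((cv n).of_le (by simp))))) (hψ.1.of_le (by simp)) hψ.2 e).trans ?_
        congr 2; ext x; congr 1
        have h1 := (hT (mollify (ρ n) u x)).comp_hasFDerivAt x
          ((cu n).differentiable (by simp) x).hasFDerivAt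
        have h2 := (hR (mollify (ρ n) v x)).comp_hasFDerivAt x
          ((cv n).differentiable (by simp) x).hasFDerivAt
        refine (congrArg (fun L : RN N →L[ℝ] ℝ => L e) (h1.mul h2).fderiv).trans ?_
        rw [hu.fderiv_mollify_eq (hρ n), hv.fderiv_mollify_eq (hρ n)]
        simp only [Function.comp, add_apply, smul_apply,
          innerSL_apply_apply, smul_eq_mul, inner_add_left, inner_smul_left,
          RCLike.conj_to_real]
        ring
      · intro x hx
        rw [image_eq_zero_of_notMem_tsupport hx, mul_zero]
      · intro x hx
        rw [fderiv_of_notMem_tsupport ℝ hx]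
        simp
    have l1 : Tendsto (fun n => ∫ x in K, (T (mollify (ρ n) u x) * R (mollify (ρ n) v x)) *
        fderiv ℝ ψ x e) atTop (𝓝 (∫ x in K, (T (u x) * R (v x)) * fderiv ℝ ψ x e)) := by
      refine tendsto_integral_of_dominated_convergence (fun _ => D * C * B) (fun n => ?_)
        (integrableOn_const hK.measure_lt_top.ne) (fun n => ?_) ?_
      · exact (((hTc.comp (cu n).continuous).mul (hRc.comp (cv n).continuous)).mul
          cψ').aestronglyMeasurable
      · refine Eventually.of_forall fun x => ?_
        rw [norm_mul]
        exact mul_le_mul (b1 _ _ (hun n x)) (hB x).2 (norm_nonneg _) (by positivity)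
      · filter_upwards [hlim] with x hx
        have hx1 := ((continuous_fst.comp (continuous_snd.comp continuous_snd)).tendsto _).comp hx
        have hx2 := ((continuous_snd.comp (continuous_snd.comp continuous_snd)).tendsto _).comp hx
        exact (((hTc.tendsto _).comp hx1).mul ((hRc.tendsto _).comp hx2)).mul_const _
    have l2 : Tendsto (fun n => ∫ x in K, inner ℝ ((T' (mollify (ρ n) u x) *
        R (mollify (ρ n) v x)) • mollify (ρ n) gu x + (T (mollify (ρ n) u x) *
        R' (mollify (ρ n) v x)) • mollify (ρ n) gv x) e * ψ x) atTop (𝓝 (∫ x in K,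
        inner ℝ ((T' (u x) * R (v x)) • gu x + (T (u x) * R' (v x)) • gv x) e * ψ x)) := by
      refine tendsto_integral_of_dominated_convergence
        (fun x => (D * C * H x + D * C * H x) * ‖e‖ * B) (fun n => ?_)
        ((((hH.const_mul _).add (hH.const_mul _)).mul_const _).mul_const _) (fun n => ?_) ?_
      · have c1 := hT'.comp (cu n).continuous
        have c2 := hRc.comp (cv n).continuous
        have c3 := hTc.comp (cu n).continuous
        have c4 := hR'.comp (cv n).continuous
        exact (((((c1.mul c2).smul (cgu n)).add ((c3.mul c4).smul (cgv n))).inner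
          continuous_const).mul cψ).aestronglyMeasurable
      · filter_upwards [hdom] with x hx
        have hx0 := hx n
        have hx1 : ‖mollify (ρ n) gu x‖ ≤ H x := (norm_fst_le _).trans hx0
        have hx2 : ‖mollify (ρ n) gv x‖ ≤ H x :=
          (norm_fst_le _).trans ((norm_snd_le _).trans hx0)
        have hH0 : 0 ≤ H x := (norm_nonneg _).trans hx1
        rw [norm_mul]
        refine mul_le_mul ((norm_inner_le_norm _ _).trans ?_) (hB x).1 (norm_nonneg _)
          (by positivity)
        refine mul_le_mul_of_nonneg_right ((norm_add_le _ _).trans ?_) (norm_nonneg _)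
        rw [norm_smul, norm_smul]
        exact add_le_add
          (mul_le_mul (b2 _ _ (hun n x)) hx1 (norm_nonneg _) (by positivity))
          (mul_le_mul (b3 _ _ (hun n x)) hx2 (norm_nonneg _) (by positivity))
      · filter_upwards [hlim] with x hx
        have hx1 := ((continuous_fst.comp (continuous_snd.comp continuous_snd)).tendsto _).comp hx
        have hx2 := ((continuous_snd.comp (continuous_snd.comp continuous_snd)).tendsto _).comp hx
        have hx3 := (continuous_fst.tendsto _).comp hx
        have hx4 := ((continuous_fst.comp continuous_snd).tendsto _).comp hx
        exact ((((((hT'.tendsto _).comp hx1).mul ((hRc.tendsto _).comp hx2)).smul hx3).add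
          ((((hTc.tendsto _).comp hx1).mul ((hR'.tendsto _).comp hx2)).smul hx4)).inner
          tendsto_const_nhds).mul_const _
    have := tendsto_nhds_unique l1 ((l2.neg).congr fun n => (happrox n).symm)
    rw [setIntegral_eq_integral_of_forall_compl_eq_zero,
      setIntegral_eq_integral_of_forall_compl_eq_zero] at this
    · exact this
    · intro x hx
      rw [image_eq_zero_of_notMem_tsupport hx, mul_zero]
    · intro x hx
      rw [fderiv_of_notMem_tsupport ℝ hx]
      simp

/-- Chain rule for bounded `C^1` functions with bounded derivative. -/
theorem HasWeakGradient.comp {v : RN N → ℝ} {gv : RN N → RN N} (hv : HasWeakGradient v gv)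
    {R R' : ℝ → ℝ} (hR : ∀ s, HasDerivAt R (R' s) s) (hR' : Continuous R') {C : ℝ}
    (hRC : ∀ t, |R t| ≤ C) (hRC' : ∀ t, |R' t| ≤ C) :
    HasWeakGradient (fun x => R (v x)) (fun x => R' (v x) • gv x) := by
  -- The product rule with `u = 0` and `T` constantly 1.
  have := hasWeakGradient_zero.comp_mul_comp hv (M := 0) (T := fun _ => 1) (T' := fun _ => 0)
    (Eventually.of_forall fun x => by simp) (fun s => hasDerivAt_const s 1) continuous_const
    hR hR' hRC hRC'
  simpa using this

/-- Product rule with a smooth factor. -/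
theorem HasWeakGradient.smooth_mul {u χ : RN N → ℝ} {gu : RN N → RN N} (hu : HasWeakGradient u gu)
    (hχ : ContDiff ℝ ∞ χ) :
    HasWeakGradient (fun x => χ x * u x) (fun x => χ x • gu x + u x • gradient χ x) := by
  have hgc : Continuous (gradient χ) :=
    (InnerProductSpace.toDual ℝ (RN N)).symm.continuous.comp (hχ.continuous_fderiv (by simp))
  have hloc : ∀ {E : Type} [NormedAddCommGroup E] [NormedSpace ℝ E] (g : RN N → E),
      LocallyIntegrable g volume → LocallyIntegrable (fun x => χ x • g x) volume := by
    intro E _ _ g hg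
    rw [locallyIntegrable_iff] at hg ⊢
    intro K hK
    exact (hg K hK).continuousOn_smul hχ.continuous.continuousOn hK
  have hloc' : LocallyIntegrable (fun x => u x • gradient χ x) volume := by
    have hu := hu.locallyIntegrable
    rw [locallyIntegrable_iff] at hu ⊢
    intro K hK
    exact (hu K hK).smul_continuousOn hgc.continuousOn hK
  refine ⟨hloc u hu.locallyIntegrable, (hloc gu hu.locallyIntegrable_grad).add hloc', ?_⟩
  intro ψ hψ v
  have hχψ : IsTestFunction fun x => χ x * ψ x := ⟨hχ.mul hψ.1, hψ.2.mul_left⟩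
  have h1 := hu.integral_eq _ hχψ v
  have hd : ∀ x, fderiv ℝ (fun x => χ x * ψ x) x v =
      χ x * fderiv ℝ ψ x v + ψ x * inner ℝ (gradient χ x) v := by
    intro x
    have e1 := (hχ.differentiable (by simp) x).hasFDerivAt
    have e2 := (hψ.1.differentiable (by simp) x).hasFDerivAt
    refine (congrArg (fun L : RN N →L[ℝ] ℝ => L v) (e1.mul e2).fderiv).trans ?_
    simp [gradient, InnerProductSpace.toDual_symm_apply]
  simp only [hd] at h1
  have cψ' : Continuous fun x => fderiv ℝ ψ x v :=
    (hψ.1.continuous_fderiv (by simp)).clm_apply continuous_const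
  have i1 : Integrable fun x => χ x * u x * fderiv ℝ ψ x v := by
    have := (hloc u hu.locallyIntegrable).integrable_smul_right_of_hasCompactSupport cψ'
      (hψ.2.fderiv_apply (𝕜 := ℝ) v)
    simpa using this
  have i2 : Integrable fun x => u x * ψ x * inner ℝ (gradient χ x) v := by
    have := hu.locallyIntegrable.integrable_smul_right_of_hasCompactSupport
      (g := fun x => ψ x * inner ℝ (gradient χ x) v)
      (hψ.1.continuous.mul (hgc.inner continuous_const)) hψ.2.mul_right
    refine this.congr (Eventually.of_forall fun x => ?_)
    simp [mul_assoc]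
  have i3 : Integrable fun x => inner ℝ (gu x) v * (χ x * ψ x) := by
    have := (hu.locallyIntegrable_grad.integrable_smul_left_of_hasCompactSupport
      (g := fun x => χ x * ψ x) hχψ.1.continuous hχψ.2).inner_const (𝕜 := ℝ) v
    refine this.congr (Eventually.of_forall fun x => ?_)
    simp only [inner_smul_left, RCLike.conj_to_real]
    ring
  have e1 : ∫ x, u x * (χ x * fderiv ℝ ψ x v + ψ x * inner ℝ (gradient χ x) v) =
      (∫ x, χ x * u x * fderiv ℝ ψ x v) + ∫ x, u x * ψ x * inner ℝ (gradient χ x) v := by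
    rw [← integral_add i1 i2]
    congr 1; ext x; ring
  have e2 : ∫ x, inner ℝ (χ x • gu x + u x • gradient χ x) v * ψ x =
      (∫ x, inner ℝ (gu x) v * (χ x * ψ x)) + ∫ x, u x * ψ x * inner ℝ (gradient χ x) v := by
    rw [← integral_add i3 i2]
    congr 1; ext x
    simp only [inner_add_left, inner_smul_left, RCLike.conj_to_real]
    ring
  linarith

end ChainRule

/-! ### The Laplacian as the divergence of the weak gradient. -/

section Divergence

variable {N : ℕ}

lemma laplacian_eq_sum_fderiv {ψ : RN N → ℝ} (hψ : ContDiff ℝ ∞ ψ) (x : RN N) :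
    Laplacian.laplacian ψ x = ∑ i, fderiv ℝ (fun y => fderiv ℝ ψ y (EuclideanSpace.basisFun
      (Fin N) ℝ i)) x (EuclideanSpace.basisFun (Fin N) ℝ i) := by
  rw [InnerProductSpace.laplacian_eq_iteratedFDeriv_orthonormalBasis ψ
    (EuclideanSpace.basisFun (Fin N) ℝ)]
  refine Finset.sum_congr rfl fun i _ => ?_
  rw [iteratedFDeriv_two_apply]
  have h : DifferentiableAt ℝ (fderiv ℝ ψ) x :=
    (hψ.fderiv_right (m := ∞) (by simp)).differentiable (by simp) x
  have h2 := (h.hasFDerivAt.clm_apply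
    (hasFDerivAt_const (EuclideanSpace.basisFun (Fin N) ℝ i) x)).fderiv
  rw [h2]
  simp

/-- A locally integrable Laplacian is the divergence of the weak gradient. -/
lemma HasWeakLaplacian.integral_sum_inner {f L : RN N → ℝ} {g : RN N → RN N}
    (hL : HasWeakLaplacian f L) (hg : HasWeakGradient f g) {ψ : RN N → ℝ}
    (hψ : IsTestFunction ψ) :
    ∫ x, ∑ i, inner ℝ (g x) (EuclideanSpace.basisFun (Fin N) ℝ i) *
      fderiv ℝ ψ x (EuclideanSpace.basisFun (Fin N) ℝ i) = - ∫ x, L x * ψ x := by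
  have htest : ∀ v, IsTestFunction fun y => fderiv ℝ ψ y v := fun v =>
    ⟨(hψ.1.fderiv_right (by simp)).clm_apply contDiff_const, hψ.2.fderiv_apply (𝕜 := ℝ) v⟩
  rw [← hL.integral_eq ψ hψ, integral_finsetSum]
  · simp only [laplacian_eq_sum_fderiv hψ.1, Finset.mul_sum]
    rw [integral_finsetSum, ← Finset.sum_neg_distrib]
    · refine Finset.sum_congr rfl fun i _ => ?_
      rw [hg.integral_eq _ (htest _), neg_neg]
    · intro i _
      have h2 := (htest (EuclideanSpace.basisFun (Fin N) ℝ i))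
      exact hg.locallyIntegrable.integrable_smul_right_of_hasCompactSupport
        ((h2.1.continuous_fderiv (by simp)).clm_apply continuous_const)
        (h2.2.fderiv_apply (𝕜 := ℝ) _)
  · intro i _
    have h2 := (hg.locallyIntegrable_grad.integrable_smul_left_of_hasCompactSupport
      (htest (EuclideanSpace.basisFun (Fin N) ℝ i)).1.continuous
      (htest (EuclideanSpace.basisFun (Fin N) ℝ i)).2).inner_const (𝕜 := ℝ)
      (EuclideanSpace.basisFun (Fin N) ℝ i)
    refine h2.congr (Eventually.of_forall fun x => ?_)
    simp only [inner_smul_left, RCLike.conj_to_real]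
    ring

lemma HasWeakLaplacian.sum_fderiv_mollify {f L : RN N → ℝ} {g : RN N → RN N}
    (hL : HasWeakLaplacian f L) (hg : HasWeakGradient f g) {ρ : RN N → ℝ} (hρ : IsMollifier ρ)
    (x : RN N) :
    ∑ i, fderiv ℝ (fun y => inner ℝ (mollify ρ g y) (EuclideanSpace.basisFun (Fin N) ℝ i)) x
      (EuclideanSpace.basisFun (Fin N) ℝ i) = mollify ρ L x := by
  have hloc : ∀ v : RN N, LocallyIntegrable (fun y => inner ℝ (g y) v) volume := by
    intro v y
    obtain ⟨s, hs, h⟩ := hg.locallyIntegrable_grad y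
    exact ⟨s, hs, Integrable.inner_const (𝕜 := ℝ) h v⟩
  have h1 : ∀ v : RN N, (fun y => inner ℝ (mollify ρ g y) v) =
      mollify ρ (fun y => inner ℝ (g y) v) := by
    intro v
    ext y
    have := mollify_clm_comp hρ (innerSL ℝ v) hg.locallyIntegrable_grad y
    simp only [innerSL_apply_apply] at this
    rw [real_inner_comm]
    rw [← this]
    simp only [real_inner_comm]
  have hψ := hρ.isTestFunction_comp_sub x
  have h2 := hL.integral_sum_inner hg hψ
  simp only [hρ.fderiv_comp_sub] at h2
  rw [integral_finsetSum] at h2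
  · simp only [h1]
    have h3 : ∀ v, fderiv ℝ (mollify ρ fun y => inner ℝ (g y) v) x v =
        - ∫ y, inner ℝ (g y) v * -fderiv ℝ ρ (x - y) v := by
      intro v
      rw [hρ.fderiv_mollify (hloc v), ← integral_neg]
      congr 1; ext y; ring
    simp only [h3]
    rw [Finset.sum_neg_distrib, h2, neg_neg, mollify]
    congr 1; ext y
    rw [smul_eq_mul, mul_comm]
  · intro i _
    have h4 := (hloc (EuclideanSpace.basisFun (Fin N) ℝ i)).integrable_smul_right_of_hasCompactSupport
      ((hψ.1.continuous_fderiv (by simp)).clm_apply (continuous_const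
      (y := (EuclideanSpace.basisFun (Fin N) ℝ i)))) (hψ.2.fderiv_apply (𝕜 := ℝ) _)
    simpa only [hρ.fderiv_comp_sub, smul_eq_mul] using h4

/-- After mollification the Laplacian is the classical divergence of the mollified gradient, so `ξ`
need only be C¹. It will be applied to ξ = ζ Θ(μ_n), which depends on the mollified density itself.
-/
lemma HasWeakLaplacian.integral_fderiv_mollify {f L : RN N → ℝ} {g : RN N → RN N}
    (hL : HasWeakLaplacian f L) (hg : HasWeakGradient f g) {ρ : RN N → ℝ} (hρ : IsMollifier ρ)
    {ξ : RN N → ℝ} (hξ : ContDiff ℝ 1 ξ) (hs : HasCompactSupport ξ) :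
    ∫ x, fderiv ℝ ξ x (mollify ρ g x) = - ∫ x, mollify ρ L x * ξ x := by
  have hgc : ContDiff ℝ ∞ (mollify ρ g) := hρ.contDiff_mollify hg.locallyIntegrable_grad
  have hc : ∀ v : RN N, ContDiff ℝ 1 fun y => inner ℝ (mollify ρ g y) v := fun v =>
    (hgc.of_le (by simp)).inner ℝ contDiff_const
  have hξ' : ∀ v, Continuous fun x => fderiv ℝ ξ x v := fun v =>
    (hξ.continuous_fderiv (by simp)).clm_apply continuous_const
  have e1 : ∀ x, fderiv ℝ ξ x (mollify ρ g x) = ∑ i, inner ℝ (mollify ρ g x)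
      (EuclideanSpace.basisFun (Fin N) ℝ i) * fderiv ℝ ξ x (EuclideanSpace.basisFun (Fin N) ℝ i) := by
    intro x
    conv_lhs => rw [← (EuclideanSpace.basisFun (Fin N) ℝ).sum_repr' (mollify ρ g x)]
    rw [map_sum]
    refine Finset.sum_congr rfl fun i _ => ?_
    rw [map_smul, smul_eq_mul, real_inner_comm]
  simp only [e1]
  rw [integral_finsetSum]
  · simp only [integral_mul_fderiv_eq_neg (hc _) hξ hs]
    rw [Finset.sum_neg_distrib, ← integral_finsetSum]
    · simp only [← Finset.sum_mul, hL.sum_fderiv_mollify hg hρ]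
    · intro i _
      exact ((((hc _).continuous_fderiv (by simp)).clm_apply continuous_const).mul
        hξ.continuous).integrable_of_hasCompactSupport hs.mul_left
  · intro i _
    exact ((hc _).continuous.mul (hξ' _)).integrable_of_hasCompactSupport
      (hs.fderiv_apply (𝕜 := ℝ) _).mul_left

end Divergence

/-! ### The equation for div(Θ(μ)∇μ) with smooth test functions. -/

section RegularDensity

variable {N : ℕ}

/-- A nonnegative density `μ` whose square root has the gradient `gw`, locally square integrable,
and whose Laplacian is the locally integrable function `L`. -/
structure IsRegularDensity (μ : RN N → ℝ) (gw : RN N → RN N) (L : RN N → ℝ) : Prop where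
  nonneg : ∀ᵐ x, 0 ≤ μ x
  grad : HasWeakGradient μ fun x => (2 * √(μ x)) • gw x
  grad_sq : LocallyIntegrable (fun x => ‖gw x‖ ^ 2) volume
  aestronglyMeasurable_grad : AEStronglyMeasurable gw volume
  lap : HasWeakLaplacian μ L

variable {μ : RN N → ℝ} {gw : RN N → RN N} {L : RN N → ℝ}

/-- With v = ∇√μ this is |∇μ|² = 4μ|∇√μ|², the form of the gradient used throughout because it never
divides by μ. -/
lemma norm_two_sqrt_smul_sq {m : ℝ} (hm : 0 ≤ m) (v : RN N) :
    ‖(2 * √m) • v‖ ^ 2 = 4 * m * ‖v‖ ^ 2 := by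
  rw [norm_smul, Real.norm_eq_abs, mul_pow, sq_abs, mul_pow, Real.sq_sqrt hm]
  ring

/-- The equation `div (Θ(μ) ∇μ) = Θ(μ) Δμ + Θ'(μ) |∇μ|²`, tested with a smooth function. -/
theorem IsRegularDensity.integral_test (hμ : IsRegularDensity μ gw L) {Θ Θ' : ℝ → ℝ}
    (hΘ : ∀ s, HasDerivAt Θ (Θ' s) s) (hΘ' : Continuous Θ') {C : ℝ} (hC : ∀ t, |Θ t| ≤ C)
    (hC' : ∀ t, 0 ≤ t → |t * Θ' t| ≤ C) {ζ : RN N → ℝ} (hζ : IsTestFunction ζ) :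
    ∫ x, (Θ (μ x) * fderiv ℝ ζ x ((2 * √(μ x)) • gw x) +
      ζ x * Θ' (μ x) * ‖(2 * √(μ x)) • gw x‖ ^ 2) = - ∫ x, L x * (ζ x * Θ (μ x)) := by
  set g : RN N → RN N := fun x => (2 * √(μ x)) • gw x with hg
  have hC0 : 0 ≤ C := (abs_nonneg _).trans (hC 0)
  have hΘc : Continuous Θ := continuous_iff_continuousAt.mpr fun s => (hΘ s).continuousAt
  have hΘ1 : ContDiff ℝ 1 Θ := by
    refine contDiff_one_iff_deriv.mpr ⟨fun s => (hΘ s).differentiableAt, ?_⟩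
    rwa [show deriv Θ = Θ' from funext fun s => (hΘ s).deriv]
  set K := tsupport ζ
  have hK : IsCompact K := hζ.2
  have i1 := hμ.grad.locallyIntegrable
  have i2 : LocallyIntegrable g volume := hμ.grad.locallyIntegrable_grad
  have i3 := hμ.lap.locallyIntegrable_lap
  have i4 := hμ.grad_sq
  obtain ⟨ρ, hρ, H, hH, hdom, hlim⟩ := exists_mollifier_seq
    (i2.prodMk (i1.prodMk (i3.prodMk i4))) hK
  have hmol : ∀ n x, mollify (ρ n) (fun y => (g y, μ y, L y, ‖gw y‖ ^ 2)) x =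
      (mollify (ρ n) g x, mollify (ρ n) μ x, mollify (ρ n) L x,
        mollify (ρ n) (fun y => ‖gw y‖ ^ 2) x) := by
    intro n x
    rw [mollify_prodMk (hρ n) i2 (i1.prodMk (i3.prodMk i4)), mollify_prodMk (hρ n) i1
      (i3.prodMk i4), mollify_prodMk (hρ n) i3 i4]
  simp only [hmol] at hdom hlim
  obtain ⟨B₁, hB₁⟩ := hζ.2.exists_bound_of_continuous hζ.1.continuous
  obtain ⟨B₂, hB₂⟩ := (hζ.2.fderiv (𝕜 := ℝ)).exists_bound_of_continuous
    (hζ.1.continuous_fderiv (by simp))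
  have hB₁0 : 0 ≤ B₁ := (norm_nonneg _).trans (hB₁ 0)
  have hB₂0 : 0 ≤ B₂ := (norm_nonneg _).trans (hB₂ 0)
  have cμ : ∀ n, ContDiff ℝ ∞ (mollify (ρ n) μ) := fun n => (hρ n).contDiff_mollify i1
  have cg : ∀ n, Continuous (mollify (ρ n) g) := fun n =>
    ((hρ n).contDiff_mollify i2).continuous
  have cL : ∀ n, Continuous (mollify (ρ n) L) := fun n =>
    ((hρ n).contDiff_mollify i3).continuous
  have cζ' : Continuous (fderiv ℝ ζ) := hζ.1.continuous_fderiv (by simp)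
  have cζ : Continuous ζ := hζ.1.continuous
  have cξ : ∀ n, ContDiff ℝ 1 fun x => ζ x * Θ (mollify (ρ n) μ x) := fun n =>
    (hζ.1.of_le (by simp)).mul (hΘ1.comp ((cμ n).of_le (by simp)))
  -- The factor `μ_n` gained here is absorbed by Θ': |Θ'(μ_n)| |∇μ_n|² ≤ 4 |μ_n Θ'(μ_n)| (|∇√μ|²)_n,
  -- and tΘ'(t) is bounded. So the quadratic term is dominated by an integrable function, although
  -- |∇μ|² itself may fail to be locally integrable.
  have hcs : ∀ n x, ‖mollify (ρ n) g x‖ ^ 2 ≤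
      4 * mollify (ρ n) μ x * mollify (ρ n) (fun y => ‖gw y‖ ^ 2) x := by
    intro n x
    have h1 := (hρ n).norm_mollify_sq_le (f := g) (p := fun y => 4 * μ y)
      (q := fun y => ‖gw y‖ ^ 2) i2 (i1.smul (4 : ℝ)) i4 ?_
      (Eventually.of_forall fun y => by positivity) ?_ x
    · rwa [mollify_const_mul] at h1
    · filter_upwards [hμ.nonneg] with y hy using by positivity
    · filter_upwards [hμ.nonneg] with y hy
      exact (norm_two_sqrt_smul_sq hy _).le
  have happrox : ∀ n, ∫ x in K, (Θ (mollify (ρ n) μ x) * fderiv ℝ ζ x (mollify (ρ n) g x) +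
      ζ x * Θ' (mollify (ρ n) μ x) * ‖mollify (ρ n) g x‖ ^ 2) =
      - ∫ x in K, mollify (ρ n) L x * (ζ x * Θ (mollify (ρ n) μ x)) := by
    intro n
    rw [setIntegral_eq_integral_of_forall_compl_eq_zero,
      setIntegral_eq_integral_of_forall_compl_eq_zero]
    · rw [← hμ.lap.integral_fderiv_mollify hμ.grad (hρ n) (cξ n) hζ.2.mul_right]
      congr 1; ext x
      have h1 := (hΘ (mollify (ρ n) μ x)).comp_hasFDerivAt x
        ((cμ n).differentiable (by simp) x).hasFDerivAt
      have h2 := (hζ.1.differentiable (by simp) x).hasFDerivAt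
      refine Eq.symm ((congrArg (fun A : RN N →L[ℝ] ℝ => A (mollify (ρ n) g x))
        (h2.mul h1).fderiv).trans ?_)
      rw [hμ.grad.fderiv_mollify_eq (hρ n)]
      simp only [add_apply, smul_apply, innerSL_apply_apply, smul_eq_mul, Function.comp]
      rw [← real_inner_self_eq_norm_sq]
      ring
    · intro x hx
      rw [image_eq_zero_of_notMem_tsupport hx]; ring
    · intro x hx
      rw [fderiv_of_notMem_tsupport ℝ hx, image_eq_zero_of_notMem_tsupport hx]
      simp
  have l1 : Tendsto (fun n => ∫ x in K, (Θ (mollify (ρ n) μ x) *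
      fderiv ℝ ζ x (mollify (ρ n) g x) + ζ x * Θ' (mollify (ρ n) μ x) *
      ‖mollify (ρ n) g x‖ ^ 2)) atTop (𝓝 (∫ x in K, (Θ (μ x) * fderiv ℝ ζ x (g x) +
      ζ x * Θ' (μ x) * ‖g x‖ ^ 2))) := by
    refine tendsto_integral_of_dominated_convergence
      (fun x => C * (B₂ * H x) + B₁ * (C * 4 * H x)) (fun n => ?_)
      (((hH.const_mul _).const_mul _).add ((hH.const_mul _).const_mul _)) (fun n => ?_) ?_
    · exact (((hΘc.comp (cμ n).continuous).mul (cζ'.clm_apply (cg n))).add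
        ((cζ.mul (hΘ'.comp (cμ n).continuous)).mul ((cg n).norm.pow 2))).aestronglyMeasurable
    · filter_upwards [hdom] with x hx
      have hx0 := hx n
      have hx1 : ‖mollify (ρ n) g x‖ ≤ H x := (norm_fst_le _).trans hx0
      have hx2 : mollify (ρ n) (fun y => ‖gw y‖ ^ 2) x ≤ H x :=
        (le_abs_self _).trans ((norm_snd_le _).trans ((norm_snd_le _).trans
          ((norm_snd_le _).trans hx0)))
      have hH0 : 0 ≤ H x := (norm_nonneg _).trans hx1
      have hm0 : 0 ≤ mollify (ρ n) μ x := (hρ n).mollify_nonneg hμ.nonneg x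
      refine (norm_add_le _ _).trans (add_le_add ?_ ?_)
      · rw [norm_mul]
        exact mul_le_mul (hC _) (((fderiv ℝ ζ x).le_opNorm _).trans (mul_le_mul (hB₂ x) hx1
          (norm_nonneg _) hB₂0)) (norm_nonneg _) hC0
      · rw [mul_assoc, norm_mul]
        refine mul_le_mul (hB₁ x) ?_ (norm_nonneg _) hB₁0
        rw [norm_mul, Real.norm_eq_abs, Real.norm_eq_abs, abs_of_nonneg (sq_nonneg ‖mollify (ρ n) g x‖)]
        calc |Θ' (mollify (ρ n) μ x)| * ‖mollify (ρ n) g x‖ ^ 2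
            ≤ |Θ' (mollify (ρ n) μ x)| * (4 * mollify (ρ n) μ x * H x) := by
              refine mul_le_mul_of_nonneg_left ((hcs n x).trans ?_) (abs_nonneg _)
              exact mul_le_mul_of_nonneg_left hx2 (by positivity)
          _ = |mollify (ρ n) μ x * Θ' (mollify (ρ n) μ x)| * 4 * H x := by
              rw [abs_mul, abs_of_nonneg hm0]; ring
          _ ≤ C * 4 * H x := by
              refine mul_le_mul_of_nonneg_right ?_ hH0
              exact mul_le_mul_of_nonneg_right (hC' _ hm0) (by norm_num)
    · filter_upwards [hlim] with x hx
      have hx1 := (continuous_fst.tendsto _).comp hx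
      have hx2 := ((continuous_fst.comp continuous_snd).tendsto _).comp hx
      exact (((hΘc.tendsto _).comp hx2).mul (((fderiv ℝ ζ x).continuous.tendsto _).comp hx1)).add
        (((((hΘ'.tendsto _).comp hx2).const_mul _)).mul (hx1.norm.pow 2))
  have l2 : Tendsto (fun n => ∫ x in K, mollify (ρ n) L x * (ζ x * Θ (mollify (ρ n) μ x))) atTop
      (𝓝 (∫ x in K, L x * (ζ x * Θ (μ x)))) := by
    refine tendsto_integral_of_dominated_convergence (fun x => H x * (B₁ * C)) (fun n => ?_)
      (hH.mul_const _) (fun n => ?_) ?_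
    · exact ((cL n).mul (cξ n).continuous).aestronglyMeasurable
    · filter_upwards [hdom] with x hx
      have hx3 : ‖mollify (ρ n) L x‖ ≤ H x := (norm_fst_le _).trans ((norm_snd_le _).trans
        ((norm_snd_le _).trans (hx n)))
      have hH0 : 0 ≤ H x := (norm_nonneg _).trans hx3
      rw [norm_mul, norm_mul]
      exact mul_le_mul hx3 (mul_le_mul (hB₁ x) (hC _) (norm_nonneg _) hB₁0)
        (by positivity) hH0
    · filter_upwards [hlim] with x hx
      have hx2 := ((continuous_fst.comp continuous_snd).tendsto _).comp hx
      have hx3 := ((continuous_fst.comp (continuous_snd.comp continuous_snd)).tendsto _).comp hx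
      exact hx3.mul (((hΘc.tendsto _).comp hx2).const_mul _)
  have := tendsto_nhds_unique l1 ((l2.neg).congr fun n => (happrox n).symm)
  rw [setIntegral_eq_integral_of_forall_compl_eq_zero,
    setIntegral_eq_integral_of_forall_compl_eq_zero] at this
  · exact this
  · intro x hx
    rw [image_eq_zero_of_notMem_tsupport hx]; ring
  · intro x hx
    rw [fderiv_of_notMem_tsupport ℝ hx, image_eq_zero_of_notMem_tsupport hx]
    simp

end RegularDensity

/-! ### Enlarging the class of test functions: bounded H¹, then φ² R(μ). -/

section BoundedTestFunctions

variable {N : ℕ} {μ : RN N → ℝ} {gw : RN N → RN N} {L : RN N → ℝ}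

/-- The fundamental lemma of the calculus of variations on the open complement of the support. -/
lemma HasWeakGradient.ae_eq_zero_of_notMem_tsupport {f : RN N → ℝ} {g : RN N → RN N}
    (h : HasWeakGradient f g) : ∀ᵐ x, x ∉ tsupport f → g x = 0 := by
  refine (isClosed_tsupport f).isOpen_compl.ae_eq_zero_of_integral_contDiff_smul_eq_zero
    (h.locallyIntegrable_grad.locallyIntegrableOn _) fun ψ hψ hψc hψs => ?_
  have hi : Integrable fun x => ψ x • g x :=
    h.locallyIntegrable_grad.integrable_smul_left_of_hasCompactSupport hψ.continuous hψc
  refine ext_inner_left ℝ fun v => ?_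
  rw [← integral_inner hi, inner_zero_right]
  have h1 := h.integral_eq ψ ⟨hψ, hψc⟩ v
  have h2 : ∀ x, f x * fderiv ℝ ψ x v = 0 := by
    intro x
    by_cases hx : x ∈ tsupport f
    · have hx' : x ∉ tsupport ψ := fun hc => hψs hc hx
      rw [fderiv_of_notMem_tsupport ℝ hx']
      simp
    · rw [image_eq_zero_of_notMem_tsupport hx, zero_mul]
  simp only [h2, integral_zero, zero_eq_neg] at h1
  rw [← h1]
  congr 1; ext x
  rw [inner_smul_right, real_inner_comm, mul_comm]

lemma IsRegularDensity.aestronglyMeasurable (hμ : IsRegularDensity μ gw L) :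
    AEStronglyMeasurable μ volume := hμ.grad.locallyIntegrable.aestronglyMeasurable

/-- Jensen's inequality, as Cauchy–Schwarz with first weight 1. -/
lemma IsMollifier.norm_mollify_sq_le_mollify {ρ : RN N → ℝ} (hρ : IsMollifier ρ)
    {f : RN N → RN N} (hf : LocallyIntegrable f volume)
    (hf2 : LocallyIntegrable (fun x => ‖f x‖ ^ 2) volume) (x : RN N) :
    ‖mollify ρ f x‖ ^ 2 ≤ mollify ρ (fun y => ‖f y‖ ^ 2) x := by
  have := hρ.norm_mollify_sq_le (p := fun _ => 1) hf (locallyIntegrable_const 1) hf2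
    (Eventually.of_forall fun _ => zero_le_one) (Eventually.of_forall fun _ => by positivity)
    (Eventually.of_forall fun y => (one_mul _).ge) x
  rwa [hρ.mollify_const, one_mul] at this

/-- The equation `div (Θ(μ) ∇μ) = Θ(μ) Δμ + Θ'(μ) |∇μ|²`, tested with a bounded compactly
supported function of class `H^1`. -/
theorem IsRegularDensity.integral_test_of_bounded (hμ : IsRegularDensity μ gw L) {Θ Θ' : ℝ → ℝ}
    (hΘ : ∀ s, HasDerivAt Θ (Θ' s) s) (hΘ' : Continuous Θ') {C : ℝ} (hC : ∀ t, |Θ t| ≤ C)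
    (hC' : ∀ t, 0 ≤ t → |t * Θ' t| ≤ C) (hC2 : ∀ t, 0 ≤ t → t * Θ t ^ 2 ≤ C)
    {ζ : RN N → ℝ} {gζ : RN N → RN N} (hζ : HasWeakGradient ζ gζ) (hζc : HasCompactSupport ζ)
    {M : ℝ} (hM : ∀ᵐ x, |ζ x| ≤ M) (hζ2 : LocallyIntegrable (fun x => ‖gζ x‖ ^ 2) volume) :
    ∫ x, (Θ (μ x) * inner ℝ (gζ x) ((2 * √(μ x)) • gw x) +
      ζ x * Θ' (μ x) * ‖(2 * √(μ x)) • gw x‖ ^ 2) = - ∫ x, L x * (ζ x * Θ (μ x)) := by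
  have hC0 : 0 ≤ C := (abs_nonneg _).trans (hC 0)
  have hΘc : Continuous Θ := continuous_iff_continuousAt.mpr fun s => (hΘ s).continuousAt
  set K := Metric.cthickening 1 (tsupport ζ)
  have hK : IsCompact K := IsCompact.cthickening hζc
  have j1 := hζ.locallyIntegrable
  have j2 := hζ.locallyIntegrable_grad
  obtain ⟨ρ, hρ, H, hH, hdom, hlim⟩ := exists_mollifier_seq (j2.prodMk (j1.prodMk hζ2)) hK
  have hmol : ∀ n x, mollify (ρ n) (fun y => (gζ y, ζ y, ‖gζ y‖ ^ 2)) x =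
      (mollify (ρ n) gζ x, mollify (ρ n) ζ x, mollify (ρ n) (fun y => ‖gζ y‖ ^ 2) x) := by
    intro n x
    rw [mollify_prodMk (hρ n) j2 (j1.prodMk hζ2), mollify_prodMk (hρ n) j1 hζ2]
  simp only [hmol] at hdom hlim
  have hz : ∀ n x, x ∉ K → mollify (ρ n) ζ x = 0 := fun n x hx => (hρ n).mollify_eq_zero hx
  have htest : ∀ n, IsTestFunction (mollify (ρ n) ζ) := fun n =>
    ⟨(hρ n).contDiff_mollify j1, HasCompactSupport.intro hK (hz n)⟩
  have hz' : ∀ n x, x ∉ K → mollify (ρ n) gζ x = 0 := by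
    intro n x hx
    refine ext_inner_right ℝ fun v => ?_
    rw [← hζ.fderiv_mollify (hρ n), inner_zero_left]
    have hev : mollify (ρ n) ζ =ᶠ[𝓝 x] fun _ => 0 := by
      filter_upwards [hK.isClosed.isOpen_compl.mem_nhds hx] with y hy using hz n y hy
    rw [hev.fderiv_eq]
    simp
  have hζK : ∀ x, x ∉ K → ζ x = 0 := fun x hx =>
    image_eq_zero_of_notMem_tsupport fun hc => hx (Metric.self_subset_cthickening _ hc)
  have hgζK : ∀ᵐ x, x ∉ K → gζ x = 0 := by
    filter_upwards [hζ.ae_eq_zero_of_notMem_tsupport] with x hx hxK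
    exact hx fun hc => hxK (Metric.self_subset_cthickening _ hc)
  have hMn : ∀ n x, |mollify (ρ n) ζ x| ≤ M := fun n x => (hρ n).abs_mollify_le j1 hM x
  have hM0 : 0 ≤ M := (abs_nonneg _).trans (hMn 0 0)
  have happrox : ∀ n, ∫ x in K, (Θ (μ x) * inner ℝ (mollify (ρ n) gζ x) ((2 * √(μ x)) • gw x) +
      mollify (ρ n) ζ x * Θ' (μ x) * ‖(2 * √(μ x)) • gw x‖ ^ 2) =
      - ∫ x in K, L x * (mollify (ρ n) ζ x * Θ (μ x)) := by
    intro n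
    rw [setIntegral_eq_integral_of_forall_compl_eq_zero,
      setIntegral_eq_integral_of_forall_compl_eq_zero,
      ← hμ.integral_test hΘ hΘ' hC hC' (htest n)]
    · simp only [hζ.fderiv_mollify (hρ n)]
    · intro x hx
      rw [hz n x hx]; ring
    · intro x hx
      rw [hz n x hx, hz' n x hx, inner_zero_left]; ring
  have mμ := hμ.aestronglyMeasurable
  have mgw := hμ.aestronglyMeasurable_grad
  have mg : AEStronglyMeasurable (fun x => (2 * √(μ x)) • gw x) volume :=
    hμ.grad.locallyIntegrable_grad.aestronglyMeasurable
  have mL := hμ.lap.locallyIntegrable_lap.aestronglyMeasurable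
  have mΘ := hΘc.comp_aestronglyMeasurable mμ
  have mΘ' := hΘ'.comp_aestronglyMeasurable mμ
  have hgwK := hμ.grad_sq.integrableOn_isCompact hK
  have hLK := hμ.lap.locallyIntegrable_lap.integrableOn_isCompact hK
  have l1 : Tendsto (fun n => ∫ x in K, (Θ (μ x) * inner ℝ (mollify (ρ n) gζ x)
      ((2 * √(μ x)) • gw x) + mollify (ρ n) ζ x * Θ' (μ x) * ‖(2 * √(μ x)) • gw x‖ ^ 2)) atTop
      (𝓝 (∫ x in K, (Θ (μ x) * inner ℝ (gζ x) ((2 * √(μ x)) • gw x) +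
      ζ x * Θ' (μ x) * ‖(2 * √(μ x)) • gw x‖ ^ 2))) := by
    refine tendsto_integral_of_dominated_convergence
      (fun x => (H x + C * ‖gw x‖ ^ 2) + M * (4 * C * ‖gw x‖ ^ 2)) (fun n => ?_)
      (Integrable.add (Integrable.add hH (hgwK.const_mul C))
        ((hgwK.const_mul (4 * C)).const_mul M)) (fun n => ?_) ?_
    · have c1 := ((hρ n).contDiff_mollify j2).continuous.aestronglyMeasurable (μ := volume)
      have c2 := ((hρ n).contDiff_mollify j1).continuous.aestronglyMeasurable (μ := volume)
      exact ((mΘ.mul (c1.inner mg)).add ((c2.mul mΘ').mul (mg.norm.pow 2))).restrict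
    · filter_upwards [hdom, ae_restrict_of_ae hμ.nonneg] with x hx hμx
      have hx0 := hx n
      have hx2 : mollify (ρ n) (fun y => ‖gζ y‖ ^ 2) x ≤ H x :=
        (le_abs_self _).trans ((norm_snd_le _).trans ((norm_snd_le _).trans hx0))
      have hx3 : ‖mollify (ρ n) gζ x‖ ^ 2 ≤ H x :=
        ((hρ n).norm_mollify_sq_le_mollify j2 hζ2 x).trans hx2
      have hn : ‖(2 * √(μ x)) • gw x‖ ^ 2 = 4 * μ x * ‖gw x‖ ^ 2 := norm_two_sqrt_smul_sq hμx _
      refine (norm_add_le _ _).trans (add_le_add ?_ ?_)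
      · rw [norm_mul, Real.norm_eq_abs]
        have h1 := norm_inner_le_norm (𝕜 := ℝ) (mollify (ρ n) gζ x) ((2 * √(μ x)) • gw x)
        have h2 : |Θ (μ x)| * ‖(inner ℝ (mollify (ρ n) gζ x) ((2 * √(μ x)) • gw x) : ℝ)‖ ≤
            ‖mollify (ρ n) gζ x‖ * (|Θ (μ x)| * ‖(2 * √(μ x)) • gw x‖) := by
          calc _ ≤ |Θ (μ x)| * (‖mollify (ρ n) gζ x‖ * ‖(2 * √(μ x)) • gw x‖) := by gcongr
            _ = _ := by ring
        -- Here boundedness of tΘ(t)² enters: it makes Θ(μ)∇μ square integrable on compact sets, so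
        -- it pairs with the square integrable gradient of the test function.
        have h3 : (|Θ (μ x)| * ‖(2 * √(μ x)) • gw x‖) ^ 2 ≤ 4 * (C * ‖gw x‖ ^ 2) := by
          rw [mul_pow, sq_abs, hn]
          have := mul_le_mul_of_nonneg_right (hC2 _ hμx) (sq_nonneg ‖gw x‖)
          linarith
        nlinarith [sq_nonneg (2 * ‖mollify (ρ n) gζ x‖ - |Θ (μ x)| * ‖(2 * √(μ x)) • gw x‖)]
      · rw [mul_assoc, norm_mul]
        refine mul_le_mul (hMn n x) ?_ (norm_nonneg _) hM0
        rw [hn, norm_mul, Real.norm_eq_abs, Real.norm_eq_abs,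
          abs_of_nonneg (by positivity : 0 ≤ 4 * μ x * ‖gw x‖ ^ 2)]
        have h1 := hC' _ hμx
        rw [abs_mul, abs_of_nonneg hμx] at h1
        nlinarith [mul_le_mul_of_nonneg_right h1 (sq_nonneg ‖gw x‖)]
    · filter_upwards [hlim] with x hx
      have hx1 := (continuous_fst.tendsto _).comp hx
      have hx2 := ((continuous_fst.comp continuous_snd).tendsto _).comp hx
      exact ((hx1.inner tendsto_const_nhds).const_mul _).add ((hx2.mul_const _).mul_const _)
  have l2 : Tendsto (fun n => ∫ x in K, L x * (mollify (ρ n) ζ x * Θ (μ x))) atTop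
      (𝓝 (∫ x in K, L x * (ζ x * Θ (μ x)))) := by
    refine tendsto_integral_of_dominated_convergence (fun x => ‖L x‖ * (M * C)) (fun n => ?_)
      (hLK.norm.mul_const _) (fun n => ?_) ?_
    · have c2 := ((hρ n).contDiff_mollify j1).continuous.aestronglyMeasurable (μ := volume)
      exact (mL.mul (c2.mul mΘ)).restrict
    · refine Eventually.of_forall fun x => ?_
      rw [norm_mul, norm_mul]
      exact mul_le_mul_of_nonneg_left (mul_le_mul (hMn n x) (hC _) (norm_nonneg _) hM0)
        (norm_nonneg _)
    · filter_upwards [hlim] with x hx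
      have hx2 := ((continuous_fst.comp continuous_snd).tendsto _).comp hx
      exact (hx2.mul_const _).const_mul _
  have := tendsto_nhds_unique l1 ((l2.neg).congr fun n => (happrox n).symm)
  rw [setIntegral_eq_integral_of_ae_compl_eq_zero,
    setIntegral_eq_integral_of_forall_compl_eq_zero] at this
  · exact this
  · intro x hx
    rw [hζK x hx]; ring
  · filter_upwards [hgζK] with x hx hxK
    rw [hζK x hxK, hx hxK, inner_zero_left]; ring

/-- The previous identity for the test function `φ² R(μ)`; only `√μ ∇φ` has to be square
integrable. -/
theorem IsRegularDensity.integral_test_sq (hμ : IsRegularDensity μ gw L) {Θ Θ' R R' : ℝ → ℝ}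
    (hΘ : ∀ s, HasDerivAt Θ (Θ' s) s) (hΘ' : Continuous Θ')
    (hR : ∀ s, HasDerivAt R (R' s) s) (hR' : Continuous R') {C : ℝ} (hC : ∀ t, |Θ t| ≤ C)
    (hC' : ∀ t, 0 ≤ t → |t * Θ' t| ≤ C) (hC2 : ∀ t, 0 ≤ t → t * Θ t ^ 2 ≤ C)
    (hRC : ∀ t, |R t| ≤ C) (hRC' : ∀ t, |R' t| ≤ C) (hR2 : ∀ t, 0 ≤ t → R t ^ 2 ≤ C * t)
    (hR2' : ∀ t, 0 ≤ t → t * R' t ^ 2 ≤ C)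
    {φ : RN N → ℝ} {g : RN N → RN N} (hφ : HasWeakGradient φ g) (hφc : HasCompactSupport φ)
    {M : ℝ} (hM : ∀ x, |φ x| ≤ M) (hg : Integrable fun x => μ x * ‖g x‖ ^ 2) :
    ∫ x, (Θ (μ x) * inner ℝ ((2 * φ x * R (μ x)) • g x +
      (φ x ^ 2 * R' (μ x)) • ((2 * √(μ x)) • gw x)) ((2 * √(μ x)) • gw x) +
      φ x ^ 2 * R (μ x) * Θ' (μ x) * ‖(2 * √(μ x)) • gw x‖ ^ 2) =
      - ∫ x, L x * (φ x ^ 2 * R (μ x) * Θ (μ x)) := by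
  have hM0 : 0 ≤ M := (abs_nonneg _).trans (hM 0)
  have hC0 : 0 ≤ C := (abs_nonneg _).trans (hC 0)
  have hRc : Continuous R := continuous_iff_continuousAt.mpr fun s => (hR s).continuousAt
  have hζ := hφ.comp_mul_comp hμ.grad (Eventually.of_forall hM) (T := fun s => s ^ 2)
    (T' := fun s => 2 * s) (fun s => by simpa using hasDerivAt_pow 2 s) (by fun_prop)
    hR hR' hRC hRC'
  refine hμ.integral_test_of_bounded hΘ hΘ' hC hC' hC2 hζ ?_ (M := M ^ 2 * C) ?_ ?_
  · refine hφc.mono fun x hx => ?_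
    contrapose! hx
    simp [Function.notMem_support.mp hx]
  · refine Eventually.of_forall fun x => ?_
    rw [abs_mul, abs_pow]
    exact mul_le_mul (pow_le_pow_left₀ (abs_nonneg _) (hM x) 2) (hRC _) (abs_nonneg _)
      (by positivity)
  · have hdom : LocallyIntegrable (fun x => 8 * M ^ 2 * C * (μ x * ‖g x‖ ^ 2) +
        8 * M ^ 4 * C * ‖gw x‖ ^ 2) volume :=
      (hg.const_mul _).locallyIntegrable.add (hμ.grad_sq.smul (8 * M ^ 4 * C))
    refine hdom.mono (hζ.locallyIntegrable_grad.aestronglyMeasurable.norm.pow 2) ?_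
    filter_upwards [hμ.nonneg] with x hx
    have hn : ‖(2 * √(μ x)) • gw x‖ ^ 2 = 4 * μ x * ‖gw x‖ ^ 2 := norm_two_sqrt_smul_sq hx _
    rw [norm_pow, norm_norm]
    refine le_trans ?_ (le_abs_self _)
    have h0 : ‖(2 * φ x * R (μ x)) • g x + (φ x ^ 2 * R' (μ x)) • ((2 * √(μ x)) • gw x)‖ ^ 2 ≤
        2 * ‖(2 * φ x * R (μ x)) • g x‖ ^ 2 +
        2 * ‖(φ x ^ 2 * R' (μ x)) • ((2 * √(μ x)) • gw x)‖ ^ 2 := by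
      have := norm_add_le ((2 * φ x * R (μ x)) • g x)
        ((φ x ^ 2 * R' (μ x)) • ((2 * √(μ x)) • gw x))
      have h2 := pow_le_pow_left₀ (norm_nonneg _) this 2
      nlinarith [sq_nonneg (‖(2 * φ x * R (μ x)) • g x‖ -
        ‖(φ x ^ 2 * R' (μ x)) • ((2 * √(μ x)) • gw x)‖)]
    have hφ2 : φ x ^ 2 ≤ M ^ 2 := by
      rw [← sq_abs]; exact pow_le_pow_left₀ (abs_nonneg _) (hM x) 2
    have hφ4 : φ x ^ 4 ≤ M ^ 4 := by
      have := pow_le_pow_left₀ (sq_nonneg _) hφ2 2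
      nlinarith
    have h1 : 2 * ‖(2 * φ x * R (μ x)) • g x‖ ^ 2 ≤ 8 * M ^ 2 * C * (μ x * ‖g x‖ ^ 2) := by
      rw [norm_smul, mul_pow, Real.norm_eq_abs, sq_abs]
      have := mul_le_mul hφ2 (hR2 _ hx) (sq_nonneg _) (sq_nonneg _)
      nlinarith [mul_le_mul_of_nonneg_right this (sq_nonneg ‖g x‖)]
    have h2 : 2 * ‖(φ x ^ 2 * R' (μ x)) • ((2 * √(μ x)) • gw x)‖ ^ 2 ≤
        8 * M ^ 4 * C * ‖gw x‖ ^ 2 := by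
      rw [norm_smul, mul_pow, Real.norm_eq_abs, sq_abs, hn]
      have := mul_le_mul hφ4 (hR2' _ hx) (by positivity) (by positivity)
      nlinarith [mul_le_mul_of_nonneg_right this (sq_nonneg ‖gw x‖)]
    linarith

end BoundedTestFunctions

/-! ### Rational cutoffs in the values of μ, and their bounds. -/

section Cutoffs

/-- Smooth cutoff that vanishes at `0` and tends to `1` elsewhere as `k → ∞`. -/
def lowCut (k t : ℝ) : ℝ := k * t ^ 2 / (1 + k * t ^ 2)

/-- Derivative of `lowCut k`. -/
def lowCutDeriv (k t : ℝ) : ℝ := 2 * k * t / (1 + k * t ^ 2) ^ 2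

/-- Smooth cutoff that vanishes at infinity and tends to `1` as `k → ∞`. -/
def highCut (k t : ℝ) : ℝ := k / (k + t ^ 2)

/-- Derivative of `highCut k`. -/
def highCutDeriv (k t : ℝ) : ℝ := -(2 * k * t) / (k + t ^ 2) ^ 2

variable {k : ℝ}

lemma hasDerivAt_lowCut (hk : 1 ≤ k) (t : ℝ) : HasDerivAt (lowCut k) (lowCutDeriv k t) t := by
  have h0 : 1 + k * t ^ 2 ≠ 0 := by positivity
  have h1 : HasDerivAt (fun t : ℝ => k * t ^ 2) (k * (2 * t)) t := by
    simpa using (hasDerivAt_pow 2 t).const_mul k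
  refine (h1.div (h1.const_add 1) h0).congr_deriv ?_
  rw [lowCutDeriv]
  congr 1
  ring

lemma hasDerivAt_highCut (hk : 1 ≤ k) (t : ℝ) : HasDerivAt (highCut k) (highCutDeriv k t) t := by
  have h0 : k + t ^ 2 ≠ 0 := by positivity
  have h1 : HasDerivAt (fun t : ℝ => k + t ^ 2) (2 * t) t := by
    simpa using (hasDerivAt_pow 2 t).const_add k
  refine ((hasDerivAt_const t k).div h1 h0).congr_deriv ?_
  rw [highCutDeriv]
  congr 1
  ring

lemma continuous_lowCutDeriv (hk : 1 ≤ k) : Continuous (lowCutDeriv k) := by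
  unfold lowCutDeriv
  refine Continuous.div (by fun_prop) (by fun_prop) fun t => by positivity

lemma continuous_highCutDeriv (hk : 1 ≤ k) : Continuous (highCutDeriv k) := by
  unfold highCutDeriv
  refine Continuous.div (by fun_prop) (by fun_prop) fun t => by positivity

lemma lowCut_nonneg (hk : 1 ≤ k) (t : ℝ) : 0 ≤ lowCut k t := by unfold lowCut; positivity

lemma lowCut_le_one (hk : 1 ≤ k) (t : ℝ) : lowCut k t ≤ 1 := by
  unfold lowCut
  rw [div_le_one (by positivity)]
  linarith

lemma highCut_nonneg (hk : 1 ≤ k) (t : ℝ) : 0 ≤ highCut k t := by unfold highCut; positivity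

lemma highCut_le_one (hk : 1 ≤ k) (t : ℝ) : highCut k t ≤ 1 := by
  unfold highCut
  rw [div_le_one (by positivity)]
  nlinarith [sq_nonneg t]

lemma abs_mul_lowCutDeriv_le (hk : 1 ≤ k) (t : ℝ) : |t * lowCutDeriv k t| ≤ 1 := by
  unfold lowCutDeriv
  rw [mul_div_assoc', abs_div, abs_of_nonneg (by positivity : 0 ≤ (1 + k * t ^ 2) ^ 2),
    abs_of_nonneg (by nlinarith [mul_nonneg (by linarith : 0 ≤ k) (sq_nonneg t)]),
    div_le_one (by positivity)]
  nlinarith [sq_nonneg (k * t ^ 2)]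

lemma abs_mul_highCutDeriv_le (hk : 1 ≤ k) (t : ℝ) : |t * highCutDeriv k t| ≤ 1 := by
  unfold highCutDeriv
  rw [mul_div_assoc', abs_div, abs_of_nonneg (by positivity : 0 ≤ (k + t ^ 2) ^ 2),
    mul_neg, abs_neg, abs_of_nonneg (by nlinarith [mul_nonneg (by linarith : 0 ≤ k) (sq_nonneg t)]),
    div_le_one (by positivity)]
  nlinarith [sq_nonneg (t ^ 2), sq_nonneg k]

/-- With the two preceding bounds, this lets `highCut` play the role of Θ in
`IsRegularDensity.integral_test_sq`. -/
lemma mul_highCut_sq_le (hk : 1 ≤ k) {t : ℝ} (ht : 0 ≤ t) : t * highCut k t ^ 2 ≤ k := by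
  unfold highCut
  rw [div_pow, mul_div_assoc', div_le_iff₀ (by positivity)]
  have h1 : k * t ≤ (k + t ^ 2) ^ 2 := by
    have : t ≤ k + t ^ 2 := by nlinarith [sq_nonneg (t - 1)]
    nlinarith [mul_le_mul (show k ≤ k + t ^ 2 by nlinarith) this ht (by positivity)]
  nlinarith [mul_le_mul_of_nonneg_left h1 (by linarith : 0 ≤ k)]

lemma abs_lowCutDeriv_le (hk : 1 ≤ k) (t : ℝ) : |lowCutDeriv k t| ≤ k := by
  unfold lowCutDeriv
  rw [abs_div, abs_of_nonneg (by positivity : 0 ≤ (1 + k * t ^ 2) ^ 2), div_le_iff₀ (by positivity),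
    abs_mul, abs_of_nonneg (by linarith : 0 ≤ 2 * k)]
  have h1 : 2 * |t| ≤ 1 + k * t ^ 2 := by
    nlinarith [sq_nonneg (|t| - 1), sq_abs t, mul_le_mul_of_nonneg_right hk (sq_nonneg t)]
  have h2 : 1 + k * t ^ 2 ≤ (1 + k * t ^ 2) ^ 2 := by
    nlinarith [mul_nonneg (by linarith : 0 ≤ k) (sq_nonneg t)]
  nlinarith [mul_le_mul_of_nonneg_left (h1.trans h2) (by linarith : 0 ≤ k)]

/-- This and the next lemma are the conditions that let `lowCut` play the role of R there: vanishing
at 0 is measured against the weight t. -/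
lemma lowCut_sq_le (hk : 1 ≤ k) {t : ℝ} (ht : 0 ≤ t) : lowCut k t ^ 2 ≤ k * t := by
  have h0 := lowCut_nonneg hk t
  have h1 := lowCut_le_one hk t
  have h2 : lowCut k t ≤ k * t := by
    unfold lowCut
    rw [div_le_iff₀ (by positivity)]
    have : t ≤ 1 + k * t ^ 2 := by
      nlinarith [sq_nonneg (t - 1), mul_le_mul_of_nonneg_right hk (sq_nonneg t)]
    nlinarith [mul_le_mul_of_nonneg_left this (by positivity : 0 ≤ k * t)]
  nlinarith

lemma mul_lowCutDeriv_sq_le (hk : 1 ≤ k) {t : ℝ} (ht : 0 ≤ t) :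
    t * lowCutDeriv k t ^ 2 ≤ k := by
  have h0 : 0 ≤ lowCutDeriv k t := by unfold lowCutDeriv; positivity
  have h1 := abs_lowCutDeriv_le hk t
  have h2 := abs_mul_lowCutDeriv_le hk t
  rw [abs_of_nonneg h0] at h1
  rw [abs_of_nonneg (by positivity)] at h2
  nlinarith

lemma abs_mul_highCut_le (hk : 1 ≤ k) (t : ℝ) : |t * highCut k t| ≤ k := by
  unfold highCut
  rw [mul_div_assoc', abs_div, abs_of_nonneg (by positivity : 0 ≤ k + t ^ 2),
    div_le_iff₀ (by positivity), abs_mul, abs_of_nonneg (by linarith : 0 ≤ k), mul_comm]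
  refine mul_le_mul_of_nonneg_left ?_ (by linarith)
  nlinarith [sq_nonneg (|t| - 1), sq_abs t]

lemma tendsto_natCast_add_one : Tendsto (fun n : ℕ => (n : ℝ) + 1) atTop atTop :=
  tendsto_atTop_add_const_right _ _ tendsto_natCast_atTop_atTop

lemma tendsto_lowCut (t : ℝ) : Tendsto (fun n : ℕ => lowCut (n + 1) t) atTop
    (𝓝 (if t = 0 then 0 else 1)) := by
  split_ifs with ht
  · simp [lowCut, ht]
  · have h1 : ∀ n : ℕ, lowCut (n + 1) t = 1 - (1 + ((n : ℝ) + 1) * t ^ 2)⁻¹ := by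
      intro n
      unfold lowCut
      field_simp
      ring
    simp only [h1]
    have h2 : Tendsto (fun n : ℕ => 1 + ((n : ℝ) + 1) * t ^ 2) atTop atTop :=
      tendsto_atTop_add_const_left _ _ (tendsto_natCast_add_one.atTop_mul_const (by positivity))
    simpa using h2.inv_tendsto_atTop.const_sub 1

lemma tendsto_highCut (t : ℝ) : Tendsto (fun n : ℕ => highCut (n + 1) t) atTop (𝓝 1) := by
  have h1 : ∀ n : ℕ, highCut (n + 1) t = 1 - t ^ 2 * ((n : ℝ) + 1 + t ^ 2)⁻¹ := by
    intro n
    have : (n : ℝ) + 1 + t ^ 2 ≠ 0 := by positivity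
    unfold highCut
    field_simp
    ring
  simp only [h1]
  have h2 : Tendsto (fun n : ℕ => (n : ℝ) + 1 + t ^ 2) atTop atTop :=
    tendsto_atTop_add_const_right _ _ tendsto_natCast_add_one
  simpa using (h2.inv_tendsto_atTop.const_mul (t ^ 2)).const_sub 1

/-- For a function of kt² the scaled derivative is again a polynomial in the cutoff. It vanishes
where the cutoff is 0 or 1, hence tends to 0 as k → ∞ at every t. -/
lemma mul_lowCutDeriv (hk : 1 ≤ k) (t : ℝ) :
    t * lowCutDeriv k t = 2 * (lowCut k t * (1 - lowCut k t)) := by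
  unfold lowCut lowCutDeriv
  have : 1 + k * t ^ 2 ≠ 0 := by positivity
  field_simp
  ring

lemma mul_highCutDeriv (hk : 1 ≤ k) (t : ℝ) :
    t * highCutDeriv k t = -2 * (highCut k t * (1 - highCut k t)) := by
  unfold highCut highCutDeriv
  have : k + t ^ 2 ≠ 0 := by positivity
  field_simp
  ring

/-- The product of the two cutoffs. -/
def bandCut (k t : ℝ) : ℝ := highCut k t * lowCut k t

/-- Derivative of `bandCut k`. -/
def bandCutDeriv (k t : ℝ) : ℝ := highCutDeriv k t * lowCut k t + highCut k t * lowCutDeriv k t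

lemma hasDerivAt_bandCut (hk : 1 ≤ k) (t : ℝ) : HasDerivAt (bandCut k) (bandCutDeriv k t) t :=
  (hasDerivAt_highCut hk t).mul (hasDerivAt_lowCut hk t)

lemma continuous_bandCut (hk : 1 ≤ k) : Continuous (bandCut k) :=
  continuous_iff_continuousAt.mpr fun t => (hasDerivAt_bandCut hk t).continuousAt

lemma continuous_bandCutDeriv (hk : 1 ≤ k) : Continuous (bandCutDeriv k) :=
  ((continuous_highCutDeriv hk).mul (continuous_iff_continuousAt.mpr fun t =>
    (hasDerivAt_lowCut hk t).continuousAt)).add ((continuous_iff_continuousAt.mpr fun t =>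
    (hasDerivAt_highCut hk t).continuousAt).mul (continuous_lowCutDeriv hk))

lemma bandCut_nonneg (hk : 1 ≤ k) (t : ℝ) : 0 ≤ bandCut k t :=
  mul_nonneg (highCut_nonneg hk t) (lowCut_nonneg hk t)

lemma abs_bandCut_le (hk : 1 ≤ k) (t : ℝ) : |bandCut k t| ≤ 1 := by
  rw [abs_of_nonneg (bandCut_nonneg hk t)]
  exact mul_le_one₀ (highCut_le_one hk t) (lowCut_nonneg hk t) (lowCut_le_one hk t)

lemma abs_mul_bandCutDeriv_le (hk : 1 ≤ k) (t : ℝ) : |t * bandCutDeriv k t| ≤ 2 := by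
  have h1 := abs_mul_highCutDeriv_le hk t
  have h2 := abs_mul_lowCutDeriv_le hk t
  have h3 : t * bandCutDeriv k t = (t * highCutDeriv k t) * lowCut k t +
      highCut k t * (t * lowCutDeriv k t) := by unfold bandCutDeriv; ring
  rw [h3]
  refine (abs_add_le _ _).trans ?_
  rw [abs_mul _ (lowCut k t), abs_mul (highCut k t), abs_of_nonneg (lowCut_nonneg hk t),
    abs_of_nonneg (highCut_nonneg hk t)]
  have h4 := mul_le_one₀ h1 (lowCut_nonneg hk t) (lowCut_le_one hk t)
  have h5 := mul_le_one₀ (highCut_le_one hk t) (abs_nonneg _) h2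
  linarith

lemma abs_mul_bandCut_le (hk : 1 ≤ k) (t : ℝ) : |t * bandCut k t| ≤ k := by
  rw [bandCut, ← mul_assoc, abs_mul, abs_of_nonneg (lowCut_nonneg hk t)]
  exact (mul_le_of_le_one_right (abs_nonneg _) (lowCut_le_one hk t)).trans (abs_mul_highCut_le hk t)

lemma tendsto_bandCut (t : ℝ) : Tendsto (fun n : ℕ => bandCut (n + 1) t) atTop
    (𝓝 (if t = 0 then 0 else 1)) := by
  simpa [bandCut] using (tendsto_highCut t).mul (tendsto_lowCut t)

lemma tendsto_mul_bandCutDeriv (t : ℝ) :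
    Tendsto (fun n : ℕ => t * bandCutDeriv (n + 1) t) atTop (𝓝 0) := by
  have hk : ∀ n : ℕ, (1 : ℝ) ≤ n + 1 := fun n => by
    linarith [(Nat.cast_nonneg n : (0 : ℝ) ≤ n)]
  have h3 : ∀ n : ℕ, t * bandCutDeriv (n + 1) t =
      (-2 * (highCut (n + 1) t * (1 - highCut (n + 1) t))) * lowCut (n + 1) t +
      highCut (n + 1) t * (2 * (lowCut (n + 1) t * (1 - lowCut (n + 1) t))) := by
    intro n
    rw [← mul_lowCutDeriv (hk n), ← mul_highCutDeriv (hk n)]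
    unfold bandCutDeriv
    ring
  simp only [h3]
  have h1 := tendsto_highCut t
  have h2 := tendsto_lowCut t
  have := (((h1.mul (h1.const_sub 1)).const_mul (-2)).mul h2).add
    (h1.mul ((h2.mul (h2.const_sub 1)).const_mul 2))
  convert this using 2
  split_ifs <;> simp

end Cutoffs

/-! ### Integration by parts against a smooth vector field. -/

section DivergenceTheorem

variable {N : ℕ}

/-- The divergence of a vector field. -/
def divergence (G : RN N → RN N) (x : RN N) : ℝ :=
  ∑ i, fderiv ℝ (fun y => inner ℝ (G y) (EuclideanSpace.basisFun (Fin N) ℝ i)) x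
    (EuclideanSpace.basisFun (Fin N) ℝ i)

lemma continuous_divergence {G : RN N → RN N} (hG : ContDiff ℝ ∞ G) :
    Continuous (divergence G) := by
  refine continuous_finsetSum _ fun i _ => ?_
  have : ContDiff ℝ ∞ fun y => inner ℝ (G y) (EuclideanSpace.basisFun (Fin N) ℝ i) :=
    hG.inner ℝ contDiff_const
  exact (this.continuous_fderiv (by simp)).clm_apply continuous_const

/-- Integration by parts against a smooth vector field. -/
lemma HasWeakGradient.integral_inner_field {f : RN N → ℝ} {g : RN N → RN N}
    (h : HasWeakGradient f g) (hf : HasCompactSupport f) {G : RN N → RN N}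
    (hG : ContDiff ℝ ∞ G) : ∫ x, inner ℝ (g x) (G x) = - ∫ x, f x * divergence G x := by
  obtain ⟨r, hr, hrs⟩ := hf.isCompact.isBounded.subset_ball_lt 0 0
  -- A bump equal to 1 near the support of `f` turns the components of `G` into test functions
  -- without changing the integrals.
  let χ : ContDiffBump (0 : RN N) := ⟨r, r + 1, hr, by linarith⟩
  set b := EuclideanSpace.basisFun (Fin N) ℝ
  have hGi : ∀ i, ContDiff ℝ ∞ fun y => inner ℝ (G y) (b i) := fun i => hG.inner ℝ contDiff_const
  have htest : ∀ i, IsTestFunction fun y => χ y * inner ℝ (G y) (b i) := fun i =>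
    ⟨χ.contDiff.mul (hGi i), χ.hasCompactSupport.mul_right⟩
  have hχ : ∀ x ∈ tsupport f, ∀ᶠ y in 𝓝 x, χ y = 1 := by
    intro x hx
    filter_upwards [Metric.isOpen_ball.mem_nhds (hrs hx)] with y hy
    exact χ.one_of_mem_closedBall (Metric.ball_subset_closedBall hy)
  have h1 : ∀ i, ∫ x, f x * fderiv ℝ (fun y => inner ℝ (G y) (b i)) x (b i) =
      - ∫ x, inner ℝ (g x) (b i) * inner ℝ (G x) (b i) := by
    intro i
    have h2 := h.integral_eq _ (htest i) (b i)
    have h3 : ∀ x, f x * fderiv ℝ (fun y => χ y * inner ℝ (G y) (b i)) x (b i) =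
        f x * fderiv ℝ (fun y => inner ℝ (G y) (b i)) x (b i) := by
      intro x
      by_cases hx : x ∈ tsupport f
      · have : (fun y => χ y * inner ℝ (G y) (b i)) =ᶠ[𝓝 x] fun y => inner ℝ (G y) (b i) := by
          filter_upwards [hχ x hx] with y hy
          rw [hy, one_mul]
        rw [this.fderiv_eq]
      · rw [image_eq_zero_of_notMem_tsupport hx, zero_mul, zero_mul]
    simp only [h3] at h2
    rw [h2]
    congr 1
    refine integral_congr_ae ?_
    filter_upwards [h.ae_eq_zero_of_notMem_tsupport] with x hx
    by_cases hxs : x ∈ tsupport f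
    · rw [(hχ x hxs).self_of_nhds, one_mul]
    · rw [hx hxs, inner_zero_left, zero_mul, zero_mul]
  have h4 : ∀ x, inner ℝ (g x) (G x) = ∑ i, inner ℝ (g x) (b i) * inner ℝ (G x) (b i) := by
    intro x
    rw [← b.sum_inner_mul_inner]
    refine Finset.sum_congr rfl fun i _ => ?_
    rw [real_inner_comm (b i) (G x)]
  have i1 : ∀ i, Integrable fun x => inner ℝ (g x) (b i) * inner ℝ (G x) (b i) := by
    intro i
    have h2 := (h.locallyIntegrable_grad.integrable_smul_left_of_hasCompactSupport
      (htest i).1.continuous (htest i).2).inner_const (𝕜 := ℝ) (b i)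
    refine h2.congr ?_
    filter_upwards [h.ae_eq_zero_of_notMem_tsupport] with x hx
    rw [inner_smul_left, RCLike.conj_to_real]
    by_cases hxs : x ∈ tsupport f
    · rw [(hχ x hxs).self_of_nhds, one_mul, mul_comm]
    · rw [hx hxs, inner_zero_left, mul_zero, zero_mul]
  have i2 : ∀ i, Integrable fun x => f x * fderiv ℝ (fun y => inner ℝ (G y) (b i)) x (b i) := by
    intro i
    have hc : Continuous fun x => χ x * fderiv ℝ (fun y => inner ℝ (G y) (b i)) x (b i) :=
      χ.continuous.mul (((hGi i).continuous_fderiv (by simp)).clm_apply continuous_const)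
    refine (h.locallyIntegrable.integrable_smul_right_of_hasCompactSupport hc
      χ.hasCompactSupport.mul_right).congr (Eventually.of_forall fun x => ?_)
    by_cases hxs : x ∈ tsupport f
    · simp only [(hχ x hxs).self_of_nhds, one_mul, smul_eq_mul]
    · simp only [image_eq_zero_of_notMem_tsupport hxs, zero_smul, zero_mul]
  simp only [h4, divergence, Finset.mul_sum]
  rw [integral_finsetSum _ fun i _ => i1 i, integral_finsetSum _ fun i _ => i2 i]
  simp only [b] at h1
  rw [Finset.sum_congr rfl fun i _ => h1 i, Finset.sum_neg_distrib, neg_neg]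

end DivergenceTheorem

/-! ### The energy inequality for an arbitrary smooth field G. -/

section Energy

variable {N : ℕ} {μ : RN N → ℝ} {gw : RN N → RN N} {L : RN N → ℝ}

/-- A locally integrable function times a bounded function vanishing off a compact set. -/
lemma MeasureTheory.LocallyIntegrable.integrable_mul_of_bounded {f c : RN N → ℝ}
    (hf : LocallyIntegrable f volume) (hc : AEStronglyMeasurable c volume)
    (hs : HasCompactSupport c) {C : ℝ} (hC : ∀ x, |c x| ≤ C) : Integrable fun x => c x * f x := by
  have h1 : IntegrableOn (fun x => c x * f x) (tsupport c) :=
    Integrable.bdd_mul (c := C) (hf.integrableOn_isCompact hs) hc.restrict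
      (Eventually.of_forall hC)
  refine (integrableOn_iff_integrable_of_support_subset fun x hx => ?_).mp h1
  contrapose! hx
  simp [image_eq_zero_of_notMem_tsupport hx]

lemma hasCompactSupport_sq {φ : RN N → ℝ} (hφ : HasCompactSupport φ) :
    HasCompactSupport fun x => φ x ^ 2 := hφ.mono fun x hx => by
  contrapose! hx
  simp [Function.notMem_support.mp hx]

lemma MeasureTheory.LocallyIntegrable.integrable_sq_mul {f φ : RN N → ℝ}
    (hf : LocallyIntegrable f volume) (hφ : AEStronglyMeasurable φ volume)
    (hs : HasCompactSupport φ) {M : ℝ} (hM : ∀ x, |φ x| ≤ M) :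
    Integrable fun x => φ x ^ 2 * f x :=
  hf.integrable_mul_of_bounded (hφ.pow 2) (hasCompactSupport_sq hs) (C := M ^ 2) fun x => by
    rw [abs_pow]; exact pow_le_pow_left₀ (abs_nonneg _) (hM x) 2

lemma MeasureTheory.Integrable.ite_eq_zero_mul {f : RN N → ℝ} (hf : Integrable f)
    (hμ : AEStronglyMeasurable μ volume) :
    Integrable fun x => (if μ x = 0 then (0 : ℝ) else 1) * f x := by
  refine hf.bdd_mul (c := 1) ?_ (Eventually.of_forall fun x => by split_ifs <;> simp)
  have : Measurable fun t : ℝ => if t = 0 then (0 : ℝ) else 1 :=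
    Measurable.ite (measurableSet_singleton 0) measurable_const measurable_const
  exact (this.comp_aemeasurable hμ.aemeasurable).aestronglyMeasurable

lemma tendsto_integral_bandCut_mul (hμm : AEStronglyMeasurable μ volume)
    {f : RN N → ℝ} (hf : Integrable f) :
    Tendsto (fun n : ℕ => ∫ x, bandCut (n + 1) (μ x) * f x) atTop
      (𝓝 (∫ x, (if μ x = 0 then 0 else 1) * f x)) := by
  have hk : ∀ n : ℕ, (1 : ℝ) ≤ n + 1 := fun n => by
    linarith [(Nat.cast_nonneg n : (0 : ℝ) ≤ n)]
  refine tendsto_integral_of_dominated_convergence (fun x => ‖f x‖) (fun n => ?_) hf.norm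
    (fun n => Eventually.of_forall fun x => ?_) (Eventually.of_forall fun x => ?_)
  · exact ((continuous_bandCut (hk n)).comp_aestronglyMeasurable hμm).mul hf.aestronglyMeasurable
  · rw [norm_mul]
    exact mul_le_of_le_one_left (norm_nonneg _) (abs_bandCut_le (hk n) _)
  · exact (tendsto_bandCut (μ x)).mul_const _

/-- Disposes of the errors caused by differentiating the cutoff P(μ): each carries the factor
tP'(t), bounded by 2 and tending to 0 pointwise. -/
lemma tendsto_integral_bandCutDeriv_mul (hμm : AEStronglyMeasurable μ volume)
    {f : RN N → ℝ} (hf : Integrable f) :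
    Tendsto (fun n : ℕ => ∫ x, μ x * bandCutDeriv (n + 1) (μ x) * f x) atTop (𝓝 0) := by
  have hk : ∀ n : ℕ, (1 : ℝ) ≤ n + 1 := fun n => by
    linarith [(Nat.cast_nonneg n : (0 : ℝ) ≤ n)]
  have := tendsto_integral_of_dominated_convergence (μ := volume)
    (F := fun (n : ℕ) x => μ x * bandCutDeriv (n + 1) (μ x) * f x) (f := fun x => 0 * f x)
    (fun x => 2 * ‖f x‖) (fun n => ?_) (hf.norm.const_mul 2)
    (fun n => Eventually.of_forall fun x => ?_) (Eventually.of_forall fun x => ?_)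
  · simpa using this
  · exact (hμm.mul ((continuous_bandCutDeriv (hk n)).comp_aestronglyMeasurable hμm)).mul
      hf.aestronglyMeasurable
  · rw [norm_mul]
    exact mul_le_mul_of_nonneg_right (abs_mul_bandCutDeriv_le (hk n) _) (norm_nonneg _)
  · exact (tendsto_mul_bandCutDeriv (μ x)).mul_const _

/-- Energy inequality: for bounded compactly supported `φ` and any smooth vector field `G`,
`∫ |∇φ|² μ ≥ - ∫ φ² μ (div G + |G|²) - ∫_{μ ≠ 0} φ² (|∇√μ|² - Δμ / 2)`. -/
theorem IsRegularDensity.energy (hμ : IsRegularDensity μ gw L)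
    {φ : RN N → ℝ} {g : RN N → RN N} (hφ : HasWeakGradient φ g) (hφc : HasCompactSupport φ)
    {M : ℝ} (hM : ∀ x, |φ x| ≤ M) (hg : Integrable fun x => μ x * ‖g x‖ ^ 2)
    {G : RN N → RN N} (hG : ContDiff ℝ ∞ G) :
    0 ≤ (∫ x, μ x * ‖g x‖ ^ 2) + (∫ x, φ x ^ 2 * μ x * (‖G x‖ ^ 2 + divergence G x)) +
      ∫ x, (if μ x = 0 then 0 else 1) * (φ x ^ 2 * (‖gw x‖ ^ 2 - 1 / 2 * L x)) := by
  have hk : ∀ n : ℕ, (1 : ℝ) ≤ n + 1 := fun n => by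
    linarith [(Nat.cast_nonneg n : (0 : ℝ) ≤ n)]
  have hM0 : 0 ≤ M := (abs_nonneg _).trans (hM 0)
  have mμ := hμ.aestronglyMeasurable
  have mw : AEStronglyMeasurable (fun x => √(μ x)) volume :=
    Real.continuous_sqrt.comp_aestronglyMeasurable mμ
  have mgw := hμ.aestronglyMeasurable_grad
  have mφ := hφ.locallyIntegrable.aestronglyMeasurable
  have mg := hφ.locallyIntegrable_grad.aestronglyMeasurable
  have cG : Continuous G := hG.continuous
  have mG := cG.aestronglyMeasurable (μ := (volume : Measure (RN N)))
  have hφint : ∀ {f : RN N → ℝ}, LocallyIntegrable f volume →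
      Integrable fun x => φ x ^ 2 * f x := fun hf =>
    hf.integrable_sq_mul mφ hφc hM
  have hμc : ∀ {c : RN N → ℝ}, Continuous c → LocallyIntegrable (fun x => μ x * c x) volume :=
    fun hc => hμ.grad.locallyIntegrable.mul_continuous hc
  have i1 := hg
  have i2 := hφint hμ.grad_sq
  have i3 : Integrable fun x => φ x ^ 2 * (μ x * ‖G x‖ ^ 2) := hφint (hμc (cG.norm.pow 2))
  have i7 := hφint hμ.lap.locallyIntegrable_lap
  have i8 := hφint (hμc (continuous_divergence hG))
  have i4 : Integrable fun x => φ x * √(μ x) * inner ℝ (g x) (gw x) := by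
    refine (i1.add i2).mono' ((mφ.mul mw).mul (mg.inner mgw)) ?_
    filter_upwards [hμ.nonneg] with x hx
    have h1 := abs_real_inner_le_norm (g x) (gw x)
    have h2 : |φ x| * √(μ x) * |inner ℝ (g x) (gw x)| ≤
        (√(μ x) * ‖g x‖) * (|φ x| * ‖gw x‖) := by
      have := mul_le_mul_of_nonneg_left h1 (mul_nonneg (abs_nonneg (φ x)) (Real.sqrt_nonneg (μ x)))
      linarith
    have h3 : (√(μ x) * ‖g x‖) ^ 2 = μ x * ‖g x‖ ^ 2 := by rw [mul_pow, Real.sq_sqrt hx]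
    have h4 : (|φ x| * ‖gw x‖) ^ 2 = φ x ^ 2 * ‖gw x‖ ^ 2 := by rw [mul_pow, sq_abs]
    rw [Real.norm_eq_abs, abs_mul, abs_mul, abs_of_nonneg (Real.sqrt_nonneg (μ x)), Pi.add_apply]
    nlinarith [sq_nonneg (√(μ x) * ‖g x‖ - |φ x| * ‖gw x‖),
      sq_nonneg (√(μ x) * ‖g x‖), sq_nonneg (|φ x| * ‖gw x‖)]
  have i5 : Integrable fun x => φ x * μ x * inner ℝ (g x) (G x) := by
    refine (i1.add i3).mono' ((mφ.mul mμ).mul (mg.inner mG)) ?_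
    filter_upwards [hμ.nonneg] with x hx
    have h1 := abs_real_inner_le_norm (g x) (G x)
    have h2 := mul_le_mul_of_nonneg_left h1 (abs_nonneg (φ x))
    rw [Real.norm_eq_abs, abs_mul, abs_mul, abs_of_nonneg hx, Pi.add_apply]
    have h3 : |φ x| * |inner ℝ (g x) (G x)| ≤ ‖g x‖ ^ 2 + φ x ^ 2 * ‖G x‖ ^ 2 := by
      rw [← sq_abs (φ x)]
      nlinarith [sq_nonneg (‖g x‖ - |φ x| * ‖G x‖), sq_nonneg ‖g x‖, sq_nonneg (|φ x| * ‖G x‖)]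
    nlinarith [mul_le_mul_of_nonneg_left h3 hx]
  have i6 : Integrable fun x => φ x ^ 2 * √(μ x) * inner ℝ (gw x) (G x) := by
    refine (i2.add i3).mono' (((mφ.pow 2).mul mw).mul (mgw.inner mG)) ?_
    filter_upwards [hμ.nonneg] with x hx
    have h1 := abs_real_inner_le_norm (gw x) (G x)
    rw [Real.norm_eq_abs, abs_mul, abs_mul, abs_of_nonneg (Real.sqrt_nonneg (μ x)),
      abs_of_nonneg (sq_nonneg (φ x)), Pi.add_apply]
    have h3 : √(μ x) * |inner ℝ (gw x) (G x)| ≤ ‖gw x‖ ^ 2 + μ x * ‖G x‖ ^ 2 := by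
      have h4 := mul_le_mul_of_nonneg_left h1 (Real.sqrt_nonneg (μ x))
      have h5 : (√(μ x) * ‖G x‖) ^ 2 = μ x * ‖G x‖ ^ 2 := by rw [mul_pow, Real.sq_sqrt hx]
      nlinarith [sq_nonneg (‖gw x‖ - √(μ x) * ‖G x‖), sq_nonneg ‖gw x‖,
        sq_nonneg (√(μ x) * ‖G x‖)]
    nlinarith [mul_le_mul_of_nonneg_left h3 (sq_nonneg (φ x))]
  have mP : ∀ n : ℕ, AEStronglyMeasurable (fun x => bandCut (n + 1) (μ x)) volume := fun n =>
    (continuous_bandCut (hk n)).comp_aestronglyMeasurable mμ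
  have mP' : ∀ n : ℕ, AEStronglyMeasurable (fun x => μ x * bandCutDeriv (n + 1) (μ x)) volume :=
    fun n => mμ.mul ((continuous_bandCutDeriv (hk n)).comp_aestronglyMeasurable mμ)
  have iP : ∀ (n : ℕ) {f : RN N → ℝ}, Integrable f →
      Integrable fun x => bandCut (n + 1) (μ x) * f x := fun n f hf =>
    hf.bdd_mul (mP n) (Eventually.of_forall fun x => abs_bandCut_le (hk n) _)
  have iP' : ∀ (n : ℕ) {f : RN N → ℝ}, Integrable f →
      Integrable fun x => μ x * bandCutDeriv (n + 1) (μ x) * f x := fun n f hf =>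
    hf.bdd_mul (mP' n) (Eventually.of_forall fun x => abs_mul_bandCutDeriv_le (hk n) _)
  -- The integrated square of √μ ∇φ + φ∇√μ - φ√μ G with weight P(μ), P being the band cutoff, after
  -- both integrations by parts. The last two integrals are the errors from differentiating P(μ).
  have hmain : ∀ n : ℕ, 0 ≤ (∫ x, bandCut (n + 1) (μ x) * (μ x * ‖g x‖ ^ 2)) +
      (∫ x, bandCut (n + 1) (μ x) * (φ x ^ 2 * ‖gw x‖ ^ 2)) +
      (∫ x, bandCut (n + 1) (μ x) * (φ x ^ 2 * (μ x * ‖G x‖ ^ 2))) -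
      1 / 2 * (∫ x, bandCut (n + 1) (μ x) * (φ x ^ 2 * L x)) +
      (∫ x, bandCut (n + 1) (μ x) * (φ x ^ 2 * (μ x * divergence G x))) -
      2 * (∫ x, μ x * bandCutDeriv (n + 1) (μ x) * (φ x ^ 2 * ‖gw x‖ ^ 2)) +
      2 * (∫ x, μ x * bandCutDeriv (n + 1) (μ x) *
        (φ x ^ 2 * √(μ x) * inner ℝ (gw x) (G x))) := by
    intro n
    set k : ℝ := n + 1
    have hk1 : 1 ≤ k := hk n
    -- The two factors of P are used separately: the high cutoff tames the field Θ(μ)∇μ where μ is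
    -- large, the low cutoff goes into the test function and compensates the degeneracy where μ is
    -- small.
    have ha := hμ.integral_test_sq (C := k) (hasDerivAt_highCut hk1) (continuous_highCutDeriv hk1)
      (hasDerivAt_lowCut hk1) (continuous_lowCutDeriv hk1)
      (fun t => by rw [abs_of_nonneg (highCut_nonneg hk1 t)]; exact (highCut_le_one hk1 t).trans hk1)
      (fun t _ => (abs_mul_highCutDeriv_le hk1 t).trans hk1)
      (fun t ht => mul_highCut_sq_le hk1 ht)
      (fun t => by rw [abs_of_nonneg (lowCut_nonneg hk1 t)]; exact (lowCut_le_one hk1 t).trans hk1)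
      (abs_lowCutDeriv_le hk1) (fun t ht => lowCut_sq_le hk1 ht)
      (fun t ht => mul_lowCutDeriv_sq_le hk1 ht) hφ hφc hM hg
    -- Although t is unbounded, tP(t) and its derivative are bounded, so φ²μP(μ) has a weak gradient
    -- and can be integrated against `G`.
    have hb0 := hφ.comp_mul_comp hμ.grad (Eventually.of_forall hM) (T := fun s => s ^ 2)
      (T' := fun s => 2 * s) (fun s => by simpa using hasDerivAt_pow 2 s) (by fun_prop)
      (R := fun t => t * bandCut k t) (R' := fun t => bandCut k t + t * bandCutDeriv k t)
      (fun t => ((hasDerivAt_id' t).mul (hasDerivAt_bandCut hk1 t)).congr_deriv (by rw [one_mul]))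
      ((continuous_bandCut hk1).add (continuous_id.mul (continuous_bandCutDeriv hk1)))
      (C := k + 2) (fun t => (abs_mul_bandCut_le hk1 t).trans (by linarith))
      (fun t => (abs_add_le _ _).trans (by
        linarith [abs_bandCut_le hk1 t, abs_mul_bandCutDeriv_le hk1 t]))
    have hb := hb0.integral_inner_field (hasCompactSupport_sq hφc).mul_right hG
    have ha1 : ∫ x, (4 * (bandCut k (μ x) * (φ x * √(μ x) * inner ℝ (g x) (gw x))) +
        4 * (μ x * bandCutDeriv k (μ x) * (φ x ^ 2 * ‖gw x‖ ^ 2))) =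
        - ∫ x, bandCut k (μ x) * (φ x ^ 2 * L x) := by
      have e1 : ∫ x, bandCut k (μ x) * (φ x ^ 2 * L x) =
          ∫ x, L x * (φ x ^ 2 * lowCut k (μ x) * highCut k (μ x)) := by
        congr 1; ext x; unfold bandCut; ring
      rw [e1, ← ha]
      refine integral_congr_ae ?_
      filter_upwards [hμ.nonneg] with x hx
      rw [norm_two_sqrt_smul_sq hx, inner_add_left, inner_smul_left, inner_smul_left,
        real_inner_self_eq_norm_sq, norm_two_sqrt_smul_sq hx, inner_smul_right]
      simp only [RCLike.conj_to_real]
      unfold bandCut bandCutDeriv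
      ring
    have hb1 : ∫ x, (2 * (bandCut k (μ x) * (φ x * μ x * inner ℝ (g x) (G x))) +
        (2 * (bandCut k (μ x) * (φ x ^ 2 * √(μ x) * inner ℝ (gw x) (G x))) +
        2 * (μ x * bandCutDeriv k (μ x) * (φ x ^ 2 * √(μ x) * inner ℝ (gw x) (G x))))) =
        - ∫ x, bandCut k (μ x) * (φ x ^ 2 * (μ x * divergence G x)) := by
      have e1 : ∫ x, bandCut k (μ x) * (φ x ^ 2 * (μ x * divergence G x)) =
          ∫ x, φ x ^ 2 * (μ x * bandCut k (μ x)) * divergence G x := by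
        congr 1; ext x; ring
      rw [e1, ← hb]
      congr 1; ext x
      rw [inner_add_left, inner_smul_left, inner_smul_left, inner_smul_left]
      simp only [RCLike.conj_to_real]
      ring
    have hc1 : 0 ≤ ∫ x, (bandCut k (μ x) * (μ x * ‖g x‖ ^ 2) +
        (bandCut k (μ x) * (φ x ^ 2 * ‖gw x‖ ^ 2) +
        (bandCut k (μ x) * (φ x ^ 2 * (μ x * ‖G x‖ ^ 2)) +
        (2 * (bandCut k (μ x) * (φ x * √(μ x) * inner ℝ (g x) (gw x))) -
        (2 * (bandCut k (μ x) * (φ x * μ x * inner ℝ (g x) (G x))) +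
        2 * (bandCut k (μ x) * (φ x ^ 2 * √(μ x) * inner ℝ (gw x) (G x)))))))) := by
      refine integral_nonneg_of_ae ?_
      filter_upwards [hμ.nonneg] with x hx
      have h1 : 0 ≤ bandCut k (μ x) *
          ‖√(μ x) • g x + φ x • gw x - (φ x * √(μ x)) • G x‖ ^ 2 :=
        mul_nonneg (bandCut_nonneg hk1 _) (sq_nonneg _)
      refine h1.trans_eq ?_
      rw [← real_inner_self_eq_norm_sq]
      simp only [inner_sub_left, inner_sub_right, inner_add_left, inner_add_right,
        inner_smul_left, inner_smul_right, RCLike.conj_to_real, real_inner_self_eq_norm_sq]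
      rw [real_inner_comm (g x) (gw x), real_inner_comm (g x) (G x), real_inner_comm (gw x) (G x)]
      have h2 : √(μ x) * √(μ x) = μ x := Real.mul_self_sqrt hx
      linear_combination (bandCut k (μ x) * (‖g x‖ ^ 2 + φ x ^ 2 * ‖G x‖ ^ 2 -
        2 * φ x * inner ℝ (g x) (G x))) * h2
    have p1 := iP n i1
    have p2 := iP n i2
    have p3 := iP n i3
    have p4 := iP n i4
    have p5 := iP n i5
    have p6 := iP n i6
    have t2 := iP' n i2
    have t6 := iP' n i6
    have q6 : Integrable fun x => 2 * (bandCut k (μ x) * (φ x ^ 2 * √(μ x) * inner ℝ (gw x) (G x))) +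
        2 * (μ x * bandCutDeriv k (μ x) *
        (φ x ^ 2 * √(μ x) * inner ℝ (gw x) (G x))) := (p6.const_mul 2).add (t6.const_mul 2)
    have q5 : Integrable fun x => 2 * (bandCut k (μ x) * (φ x * μ x * inner ℝ (g x) (G x))) +
        2 * (bandCut k (μ x) * (φ x ^ 2 * √(μ x) * inner ℝ (gw x) (G x))) :=
      (p5.const_mul 2).add (p6.const_mul 2)
    have q4 : Integrable fun x => 2 * (bandCut k (μ x) * (φ x * √(μ x) * inner ℝ (g x) (gw x))) -
        (2 * (bandCut k (μ x) * (φ x * μ x * inner ℝ (g x) (G x))) +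
        2 * (bandCut k (μ x) * (φ x ^ 2 * √(μ x) * inner ℝ (gw x) (G x)))) := (p4.const_mul 2).sub q5
    have q3 : Integrable fun x => bandCut k (μ x) * (φ x ^ 2 * (μ x * ‖G x‖ ^ 2)) +
        (2 * (bandCut k (μ x) * (φ x * √(μ x) * inner ℝ (g x) (gw x))) -
        (2 * (bandCut k (μ x) * (φ x * μ x * inner ℝ (g x) (G x))) +
        2 * (bandCut k (μ x) * (φ x ^ 2 * √(μ x) * inner ℝ (gw x) (G x))))) := p3.add q4
    have q2 : Integrable fun x => bandCut k (μ x) * (φ x ^ 2 * ‖gw x‖ ^ 2) +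
        (bandCut k (μ x) * (φ x ^ 2 * (μ x * ‖G x‖ ^ 2)) +
        (2 * (bandCut k (μ x) * (φ x * √(μ x) * inner ℝ (g x) (gw x))) -
        (2 * (bandCut k (μ x) * (φ x * μ x * inner ℝ (g x) (G x))) +
        2 * (bandCut k (μ x) * (φ x ^ 2 * √(μ x) * inner ℝ (gw x) (G x)))))) := p2.add q3
    rw [integral_add (p4.const_mul 4) (t2.const_mul 4), integral_const_mul,
      integral_const_mul] at ha1
    rw [integral_add (p5.const_mul 2) q6, integral_add (p6.const_mul 2) (t6.const_mul 2),
      integral_const_mul, integral_const_mul, integral_const_mul] at hb1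
    rw [integral_add p1 q2, integral_add p2 q3, integral_add p3 q4,
      integral_sub (p4.const_mul 2) q5, integral_add (p5.const_mul 2) (p6.const_mul 2),
      integral_const_mul, integral_const_mul, integral_const_mul] at hc1
    linarith
  have hlim := ((((((tendsto_integral_bandCut_mul mμ i1).add
    (tendsto_integral_bandCut_mul mμ i2)).add (tendsto_integral_bandCut_mul mμ i3)).sub
    ((tendsto_integral_bandCut_mul mμ i7).const_mul (1 / 2))).add
    (tendsto_integral_bandCut_mul mμ i8)).sub
    ((tendsto_integral_bandCutDeriv_mul mμ i2).const_mul 2)).add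
    ((tendsto_integral_bandCutDeriv_mul mμ i6).const_mul 2)
  have hfin := ge_of_tendsto' hlim hmain
  -- Terms with a factor μ lose the indicator of {μ ≠ 0}. It must stay on |∇√μ|² - ½Δμ, whose
  -- vanishing on {μ = 0} is not known here.
  have hχ : ∀ {f : RN N → ℝ}, (∀ x, μ x = 0 → f x = 0) →
      ∫ x, (if μ x = 0 then 0 else 1) * f x = ∫ x, f x := by
    intro f hf
    congr 1; ext x
    split_ifs with h
    · rw [hf x h, mul_zero]
    · rw [one_mul]
  rw [hχ (fun x hx => by rw [hx, zero_mul]), hχ (f := fun x => φ x ^ 2 * (μ x * ‖G x‖ ^ 2))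
    (fun x hx => by rw [hx]; ring), hχ (f := fun x => φ x ^ 2 * (μ x * divergence G x))
    (fun x hx => by rw [hx]; ring)] at hfin
  have e1 : ∫ x, φ x ^ 2 * μ x * (‖G x‖ ^ 2 + divergence G x) =
      (∫ x, φ x ^ 2 * (μ x * ‖G x‖ ^ 2)) + ∫ x, φ x ^ 2 * (μ x * divergence G x) := by
    rw [← integral_add i3 i8]
    congr 1; ext x; ring
  have e2 : ∫ x, (if μ x = 0 then 0 else 1) * (φ x ^ 2 * (‖gw x‖ ^ 2 - 1 / 2 * L x)) =
      (∫ x, (if μ x = 0 then 0 else 1) * (φ x ^ 2 * ‖gw x‖ ^ 2)) -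
      1 / 2 * ∫ x, (if μ x = 0 then 0 else 1) * (φ x ^ 2 * L x) := by
    rw [← integral_const_mul, ← integral_sub (i2.ite_eq_zero_mul mμ) ((i7.ite_eq_zero_mul mμ).const_mul _)]
    congr 1; ext x; ring
  rw [e1, e2]
  linarith

end Energy

/-! ### The Hardy field with logarithmic remainder. -/

section HardyField

variable {N : ℕ}

/-- The logarithmic weight `1 / log (e + 1 / s)`. -/
def logWeight (s : ℝ) : ℝ := (Real.log (Real.exp 1 + 1 / s))⁻¹

lemma one_le_log_exp_add {s : ℝ} (hs : 0 < s) : 1 ≤ Real.log (Real.exp 1 + 1 / s) := by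
  rw [Real.le_log_iff_exp_le (by positivity)]
  have : 0 < 1 / s := by positivity
  linarith

lemma logWeight_nonneg {s : ℝ} (hs : 0 < s) : 0 ≤ logWeight s :=
  inv_nonneg.mpr (zero_le_one.trans (one_le_log_exp_add hs))

lemma logWeight_le_one {s : ℝ} (hs : 0 < s) : logWeight s ≤ 1 :=
  inv_le_one_of_one_le₀ (one_le_log_exp_add hs)

/-- The weight 1/log(1/s) satisfies the Riccati equation b' = b²/s. Adding e inside the logarithm
keeps it at least 1 for every s > 0, at the price of the factor 1 + es, harmless near 0. -/
lemma hasDerivAt_logWeight {s : ℝ} (hs : 0 < s) :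
    HasDerivAt logWeight (logWeight s ^ 2 / (1 + Real.exp 1 * s) / s) s := by
  have h1 : HasDerivAt (fun s : ℝ => Real.exp 1 + 1 / s) (-(s ^ 2)⁻¹) s := by
    simpa using (hasDerivAt_inv hs.ne').const_add (Real.exp 1)
  have h0 : Real.exp 1 + 1 / s ≠ 0 := by positivity
  have hl : Real.log (Real.exp 1 + 1 / s) ≠ 0 := by linarith [one_le_log_exp_add hs]
  refine ((h1.log h0).inv hl).congr_deriv ?_
  unfold logWeight
  have : 0 < Real.exp 1 := Real.exp_pos 1
  field_simp
  ring

lemma contDiffAt_logWeight {s : ℝ} (hs : 0 < s) : ContDiffAt ℝ ∞ logWeight s := by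
  have h0 : Real.exp 1 + 1 / s ≠ 0 := by positivity
  have hl : Real.log (Real.exp 1 + 1 / s) ≠ 0 := by linarith [one_le_log_exp_add hs]
  exact ((contDiffAt_const.add (contDiffAt_const.div contDiffAt_id hs.ne')).log h0).inv hl

/-- The radial factor of the vector field in the improved Hardy inequality. -/
def hardyFactor (a s : ℝ) : ℝ := -(a + logWeight s) / s

lemma hasDerivAt_hardyFactor (a : ℝ) {s : ℝ} (hs : 0 < s) :
    HasDerivAt (hardyFactor a) ((a + logWeight s) / s ^ 2 -
      logWeight s ^ 2 / (1 + Real.exp 1 * s) / s ^ 2) s := by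
  refine (((hasDerivAt_logWeight hs).const_add a).neg.div (hasDerivAt_id' s) hs.ne').congr_deriv ?_
  have : 0 < Real.exp 1 := Real.exp_pos 1
  simp only [Pi.neg_apply]
  field_simp
  ring

lemma contDiffAt_hardyFactor (a : ℝ) {s : ℝ} (hs : 0 < s) : ContDiffAt ℝ ∞ (hardyFactor a) s :=
  (contDiffAt_const.add (contDiffAt_logWeight hs)).neg.div contDiffAt_id hs.ne'

/-- The regularised vector field `∇h / h` for the ground state `h` of the Hardy operator with a
logarithmic remainder. -/
def hardyField (a ε : ℝ) (x : RN N) : RN N := hardyFactor a (‖x‖ ^ 2 + ε ^ 2) • x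

lemma contDiff_hardyField (a : ℝ) {ε : ℝ} (hε : 0 < ε) :
    ContDiff ℝ ∞ (hardyField a ε : RN N → RN N) := by
  have h : ContDiff ℝ ∞ fun x : RN N => hardyFactor a (‖x‖ ^ 2 + ε ^ 2) := by
    rw [contDiff_iff_contDiffAt]
    intro x
    have h1 : ContDiff ℝ ∞ fun x : RN N => ‖x‖ ^ 2 + ε ^ 2 :=
      (contDiff_norm_sq ℝ).add contDiff_const
    exact (contDiffAt_hardyFactor a (by positivity : 0 < ‖x‖ ^ 2 + ε ^ 2)).comp x h1.contDiffAt
  exact h.smul contDiff_id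

/-- For a field k(s)x with s = |x|² + ε², the divergence is N k(s) + 2|x|² k'(s). -/
lemma divergence_hardyField (a : ℝ) {ε : ℝ} (hε : 0 < ε) (x : RN N) :
    divergence (hardyField a ε) x = N * hardyFactor a (‖x‖ ^ 2 + ε ^ 2) +
      2 * ‖x‖ ^ 2 * ((a + logWeight (‖x‖ ^ 2 + ε ^ 2)) / (‖x‖ ^ 2 + ε ^ 2) ^ 2 -
      logWeight (‖x‖ ^ 2 + ε ^ 2) ^ 2 / (1 + Real.exp 1 * (‖x‖ ^ 2 + ε ^ 2)) /
      (‖x‖ ^ 2 + ε ^ 2) ^ 2) := by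
  set s := ‖x‖ ^ 2 + ε ^ 2 with hs
  have hs0 : 0 < s := by positivity
  set k' := (a + logWeight s) / s ^ 2 - logWeight s ^ 2 / (1 + Real.exp 1 * s) / s ^ 2
  set b := EuclideanSpace.basisFun (Fin N) ℝ with hb
  have h1 : ∀ i, fderiv ℝ (fun y : RN N => inner ℝ (hardyField a ε y) (b i)) x (b i) =
      hardyFactor a s + 2 * k' * (inner ℝ x (b i) * inner ℝ (b i) x) := by
    intro i
    have e1 : HasFDerivAt (fun y : RN N => ‖y‖ ^ 2 + ε ^ 2) (2 • innerSL ℝ x) x :=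
      (hasStrictFDerivAt_norm_sq x).hasFDerivAt.add_const _
    have e2 := (hasDerivAt_hardyFactor a hs0).comp_hasFDerivAt x e1
    have e3 : HasFDerivAt (fun y : RN N => inner ℝ y (b i)) (innerSL ℝ (b i)) x := by
      have := (innerSL ℝ (b i)).hasFDerivAt (x := x)
      refine this.congr_of_eventuallyEq (Eventually.of_forall fun y => ?_)
      rw [innerSL_apply_apply, real_inner_comm]
    have e4 : (fun y : RN N => inner ℝ (hardyField a ε y) (b i)) =
        fun y => (hardyFactor a ∘ fun y : RN N => ‖y‖ ^ 2 + ε ^ 2) y * inner ℝ y (b i) := by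
      ext y
      rw [hardyField, inner_smul_left]
      rfl
    rw [e4]
    refine (congrArg (fun A : RN N →L[ℝ] ℝ => A (b i)) (e2.mul e3).fderiv).trans ?_
    simp only [add_apply, smul_apply, innerSL_apply_apply, smul_eq_mul, Function.comp,
      nsmul_eq_mul, Nat.cast_ofNat]
    rw [real_inner_self_eq_norm_sq, b.norm_eq_one, ← hs, real_inner_comm x (b i)]
    ring
  rw [divergence]
  simp only [← hb, h1]
  rw [Finset.sum_add_distrib, ← Finset.mul_sum, b.sum_inner_mul_inner,
    real_inner_self_eq_norm_sq]
  simp only [Finset.sum_const, Finset.card_univ, Fintype.card_fin, nsmul_eq_mul]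
  ring

/-- With s = r + δ and c = b²/(1 + Es), the difference of the two sides is [2(c - b² + Es)s + δ(2(a
+ b) - 2c + (a + b)²)]/s². The first bracket is nonnegative since b ≤ 1 costs at most Es when b² is
replaced by c; the second since c ≤ b² ≤ b. Regularisation by δ thus has the favourable sign, and
the constant 2E pays for the factor 1 + Es. -/
lemma hardy_radial_inequality {a b r δ E : ℝ} (ha : 0 ≤ a) (hb : 0 ≤ b) (hb1 : b ≤ 1)
    (hr : 0 ≤ r) (hδ : 0 < δ) (hE : 0 < E) :
    (a ^ 2 + b ^ 2) / (r + δ) - 2 * E ≤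
      -((2 * a + 2) * (-(a + b) / (r + δ)) + 2 * r * ((a + b) / (r + δ) ^ 2 -
        b ^ 2 / (1 + E * (r + δ)) / (r + δ) ^ 2)) - r * ((a + b) / (r + δ)) ^ 2 := by
  set s := r + δ with hs
  have hs0 : 0 < s := by positivity
  set c := b ^ 2 / (1 + E * s) with hc
  have hc0 : 0 ≤ c := by positivity
  have hcb : c ≤ b ^ 2 := div_le_self (sq_nonneg b) (by nlinarith [mul_pos hE hs0])
  have hc2 : b ^ 2 - E * s ≤ c := by
    rw [hc, le_div_iff₀ (by positivity)]
    have : b ^ 2 ≤ 1 := by nlinarith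
    nlinarith [mul_nonneg (mul_pos hE hs0).le (by linarith : 0 ≤ 1 - b ^ 2), sq_nonneg (E * s)]
  have key : -((2 * a + 2) * (-(a + b) / s) + 2 * r * ((a + b) / s ^ 2 - c / s ^ 2)) -
      r * ((a + b) / s) ^ 2 - ((a ^ 2 + b ^ 2) / s - 2 * E) =
      (2 * (c - (b ^ 2 - E * s)) * s + δ * (2 * (a + b) - 2 * c + (a + b) ^ 2)) / s ^ 2 := by
    have : r = s - δ := by rw [hs]; ring
    rw [this]
    field_simp
    ring
  have h2 : 0 ≤ 2 * (a + b) - 2 * c + (a + b) ^ 2 := by nlinarith [mul_nonneg ha hb]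
  have h3 : 0 ≤ (2 * (c - (b ^ 2 - E * s)) * s + δ * (2 * (a + b) - 2 * c + (a + b) ^ 2)) / s ^ 2 :=
    div_nonneg (add_nonneg (mul_nonneg (by linarith) hs0.le) (mul_nonneg hδ.le h2)) (sq_nonneg s)
  linarith

/-- The radial inequality with r = |x|², δ = ε², E = e and a = (N - 2)/2, for which 2a + 2 = N and
a² = c_0(N). -/
lemma le_neg_divergence_hardyField (hN : 2 ≤ N) {ε : ℝ} (hε : 0 < ε) (x : RN N) :
    (hardyConst N + logWeight (‖x‖ ^ 2 + ε ^ 2) ^ 2) / (‖x‖ ^ 2 + ε ^ 2) - 2 * Real.exp 1 ≤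
      -(‖hardyField (((N : ℝ) - 2) / 2) ε x‖ ^ 2 +
        divergence (hardyField (((N : ℝ) - 2) / 2) ε) x) := by
  have hN' : (2 : ℝ) ≤ N := by exact_mod_cast hN
  have hs0 : 0 < ‖x‖ ^ 2 + ε ^ 2 := by positivity
  have h := hardy_radial_inequality (a := ((N : ℝ) - 2) / 2) (by linarith)
    (logWeight_nonneg hs0) (logWeight_le_one hs0) (sq_nonneg ‖x‖) (sq_pos_of_pos hε)
    (Real.exp_pos 1)
  rw [divergence_hardyField _ hε, hardyField, norm_smul, mul_pow, Real.norm_eq_abs, sq_abs]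
  unfold hardyConst
  unfold hardyFactor at *
  have e : 2 * (((N : ℝ) - 2) / 2) + 2 = N := by ring
  rw [e] at h
  refine h.trans_eq ?_
  rw [neg_div]
  ring

/-- Put l = -2 log r. The weight is 1/(l + log(1 + er²)), and the extra logarithm is at most er², so
replacing 1/l² by the squared weight costs at most 2er²: a constant after division by r². The
restriction r ≤ 1/2 ensures l ≥ 1. -/
lemma log_weight_comparison {r : ℝ} (hr : 0 < r) (hr2 : r ≤ 1 / 2) :
    1 / 4 * (1 / |Real.log r| ^ 2) / r ^ 2 ≤ logWeight (r ^ 2) ^ 2 / r ^ 2 + 2 * Real.exp 1 := by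
  set s := r ^ 2 with hs
  have hs0 : 0 < s := by positivity
  set l := -2 * Real.log r with hl
  have hl1 : 1 ≤ l := by
    have h1 : Real.log r ≤ Real.log (1 / 2) := Real.log_le_log hr hr2
    rw [one_div, Real.log_inv] at h1
    linarith [Real.log_two_gt_d9]
  set d := Real.exp 1 * s with hd
  have hd0 : 0 < d := mul_pos (Real.exp_pos 1) hs0
  have h1 : Real.log (Real.exp 1 + 1 / s) = l + Real.log (1 + d) := by
    have : Real.exp 1 + 1 / s = s⁻¹ * (1 + d) := by
      rw [hd]; field_simp; ring
    rw [this, Real.log_mul (by positivity) (by positivity), Real.log_inv, hs, Real.log_pow, hl]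
    push_cast; ring
  have h2 : Real.log (1 + d) ≤ d := by
    have := Real.log_le_sub_one_of_pos (by positivity : 0 < 1 + d)
    linarith
  have h3 : 0 ≤ Real.log (1 + d) := Real.log_nonneg (by linarith)
  set m := Real.log (1 + d)
  have e1 : 1 / 4 * (1 / |Real.log r| ^ 2) = 1 / l ^ 2 := by
    rw [sq_abs, hl]
    have : Real.log r ≠ 0 := by intro h; rw [hl, h] at hl1; norm_num at hl1
    field_simp
    ring
  have e2 : 1 / l ^ 2 ≤ logWeight s ^ 2 + 2 * d := by
    have : logWeight s ^ 2 = 1 / (l + m) ^ 2 := by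
      rw [logWeight, h1, inv_pow, one_div]
    rw [this, ← sub_le_iff_le_add', div_sub_div _ _ (by positivity) (by positivity),
      div_le_iff₀ (by positivity)]
    have h5 : 1 ≤ l ^ 2 := by nlinarith
    have h6 : 1 ≤ l + m := by linarith
    have h7 : (l + m) ≤ l ^ 2 * (l + m) ^ 2 := by
      nlinarith [mul_le_mul h5 (show l + m ≤ (l + m) ^ 2 by nlinarith) (by positivity)
        (sq_nonneg l)]
    nlinarith [mul_le_mul_of_nonneg_left h7 hd0.le, mul_nonneg h3 (by linarith : 0 ≤ l + m)]
  rw [e1, div_le_iff₀ hs0, add_mul, div_mul_cancel₀ _ hs0.ne']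
  linarith

end HardyField

/-! ### The Hardy inequality for bounded functions of compact support. -/

section BoundedHardy

variable {N : ℕ} {μ : RN N → ℝ} {gw : RN N → RN N} {L : RN N → ℝ}

lemma continuousAt_logWeight {s : ℝ} (hs : 0 < s) : ContinuousAt logWeight s :=
  (contDiffAt_logWeight hs).continuousAt

/-- The improved Hardy inequality in the ground state representation, for bounded functions of
compact support. -/
theorem IsRegularDensity.integrable_hardy (hμ : IsRegularDensity μ gw L) (hN : 2 ≤ N)
    {φ : RN N → ℝ} {g : RN N → RN N} (hφ : HasWeakGradient φ g) (hφc : HasCompactSupport φ)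
    {M : ℝ} (hM : ∀ x, |φ x| ≤ M) (hg : Integrable fun x => μ x * ‖g x‖ ^ 2) :
    let h := fun x => φ x ^ 2 * (μ x * ((hardyConst N + logWeight (‖x‖ ^ 2) ^ 2) / ‖x‖ ^ 2))
    Integrable h ∧ ∫ x, h x ≤ (∫ x, μ x * ‖g x‖ ^ 2) +
      (∫ x, (if μ x = 0 then 0 else 1) * (φ x ^ 2 * (‖gw x‖ ^ 2 - 1 / 2 * L x))) +
      2 * Real.exp 1 * ∫ x, φ x ^ 2 * μ x := by
  intro h
  have : Nonempty (Fin N) := ⟨⟨0, by omega⟩⟩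
  have hne : ∀ᵐ x : RN N, x ≠ 0 := by
    simp [ae_iff, measure_singleton]
  set B : ℝ := (∫ x, μ x * ‖g x‖ ^ 2) +
      (∫ x, (if μ x = 0 then 0 else 1) * (φ x ^ 2 * (‖gw x‖ ^ 2 - 1 / 2 * L x))) +
      2 * Real.exp 1 * ∫ x, φ x ^ 2 * μ x with hB
  set ε : ℕ → ℝ := fun n => 1 / ((n : ℝ) + 1) with hε
  have hε0 : ∀ n, 0 < ε n := fun n => by simp only [hε]; positivity
  have hεlim : Tendsto ε atTop (𝓝 0) := tendsto_one_div_add_atTop_nhds_zero_nat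
  set c : ℕ → RN N → ℝ := fun n x => (hardyConst N + logWeight (‖x‖ ^ 2 + ε n ^ 2) ^ 2) /
    (‖x‖ ^ 2 + ε n ^ 2) with hc
  have hconst : 0 ≤ hardyConst N := sq_nonneg _
  have hs0 : ∀ n (x : RN N), 0 < ‖x‖ ^ 2 + ε n ^ 2 := fun n x => by
    have := hε0 n
    positivity
  have hc0 : ∀ n x, 0 ≤ c n x := fun n x => div_nonneg (by positivity) (hs0 n x).le
  have hcc : ∀ n, Continuous (c n) := by
    intro n
    have hs : Continuous fun x : RN N => ‖x‖ ^ 2 + ε n ^ 2 := by fun_prop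
    have hlw : Continuous fun x : RN N => logWeight (‖x‖ ^ 2 + ε n ^ 2) :=
      continuous_iff_continuousAt.mpr fun x =>
        (continuousAt_logWeight (hs0 n x)).comp (f := fun x : RN N => ‖x‖ ^ 2 + ε n ^ 2)
          hs.continuousAt
    exact (continuous_const.add (hlw.pow 2)).div hs fun x => (hs0 n x).ne'
  have mφ := hφ.locallyIntegrable.aestronglyMeasurable
  have lμ := hμ.grad.locallyIntegrable
  have mμ := hμ.aestronglyMeasurable
  have iμ : Integrable fun x => φ x ^ 2 * μ x := lμ.integrable_sq_mul mφ hφc hM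
  have ic : ∀ {d : RN N → ℝ}, Continuous d → Integrable fun x => φ x ^ 2 * (μ x * d x) :=
    fun hd => (lμ.mul_continuous hd).integrable_sq_mul mφ hφc hM
  have hbound : ∀ n, ∫ x, φ x ^ 2 * (μ x * c n x) ≤ B := by
    intro n
    have hG := contDiff_hardyField (N := N) (((N : ℝ) - 2) / 2) (hε0 n)
    have h1 := hμ.energy hφ hφc hM hg hG
    have cd : Continuous fun x : RN N => -(‖hardyField (((N : ℝ) - 2) / 2) (ε n) x‖ ^ 2 +
        divergence (hardyField (((N : ℝ) - 2) / 2) (ε n)) x) :=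
      ((hG.continuous.norm.pow 2).add (continuous_divergence hG)).neg
    have h2 : ∫ x, (φ x ^ 2 * (μ x * c n x) - 2 * Real.exp 1 * (φ x ^ 2 * μ x)) ≤
        ∫ x, φ x ^ 2 * (μ x * -(‖hardyField (((N : ℝ) - 2) / 2) (ε n) x‖ ^ 2 +
        divergence (hardyField (((N : ℝ) - 2) / 2) (ε n)) x)) := by
      refine integral_mono_ae ((ic (hcc n)).sub (iμ.const_mul _)) (ic cd) ?_
      filter_upwards [hμ.nonneg] with x hx
      have h3 := mul_le_mul_of_nonneg_left (le_neg_divergence_hardyField hN (hε0 n) x)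
        (mul_nonneg (sq_nonneg (φ x)) hx)
      simp only [hc]
      linarith
    rw [integral_sub (ic (hcc n)) (iμ.const_mul _), integral_const_mul] at h2
    have h4 : ∫ x, φ x ^ 2 * (μ x * -(‖hardyField (((N : ℝ) - 2) / 2) (ε n) x‖ ^ 2 +
        divergence (hardyField (((N : ℝ) - 2) / 2) (ε n)) x)) =
        - ∫ x, φ x ^ 2 * μ x * (‖hardyField (((N : ℝ) - 2) / 2) (ε n) x‖ ^ 2 +
        divergence (hardyField (((N : ℝ) - 2) / 2) (ε n)) x) := by
      rw [← integral_neg]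
      congr 1; ext x; ring
    rw [h4] at h2
    linarith
  have hlim : ∀ᵐ x, Tendsto (fun n => φ x ^ 2 * (μ x * c n x)) atTop (𝓝 (h x)) := by
    filter_upwards [hne] with x hx
    have hx0 : 0 < ‖x‖ ^ 2 := by have := norm_pos_iff.mpr hx; positivity
    have h1 : Tendsto (fun n => ‖x‖ ^ 2 + ε n ^ 2) atTop (𝓝 (‖x‖ ^ 2)) := by
      simpa using (hεlim.pow 2).const_add (‖x‖ ^ 2)
    exact (((((continuousAt_logWeight hx0).tendsto.comp h1).pow 2).const_add _).div h1
      hx0.ne').const_mul (μ x) |>.const_mul _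
  have hnn : ∀ n, 0 ≤ᵐ[volume] fun x => φ x ^ 2 * (μ x * c n x) := fun n => by
    filter_upwards [hμ.nonneg] with x hx
    exact mul_nonneg (sq_nonneg _) (mul_nonneg hx (hc0 n x))
  have hh0 : 0 ≤ᵐ[volume] h := by
    filter_upwards [hμ.nonneg] with x hx
    exact mul_nonneg (sq_nonneg _) (mul_nonneg hx (div_nonneg (by positivity) (sq_nonneg _)))
  have hmeas : AEStronglyMeasurable h volume :=
    aestronglyMeasurable_of_tendsto_ae atTop (fun n => (ic (hcc n)).aestronglyMeasurable) hlim
  have hB0 : 0 ≤ B := (integral_nonneg_of_ae (hnn 0)).trans (hbound 0)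
  -- The bound `B` does not depend on ε, so Fatou's lemma yields integrability of the singular limit
  -- together with the inequality.
  have hfatou : ∫⁻ x, ENNReal.ofReal (h x) ≤ ENNReal.ofReal B := by
    calc ∫⁻ x, ENNReal.ofReal (h x)
        = ∫⁻ x, liminf (fun n => ENNReal.ofReal (φ x ^ 2 * (μ x * c n x))) atTop := by
          refine lintegral_congr_ae ?_
          filter_upwards [hlim] with x hx
          exact ((ENNReal.continuous_ofReal.tendsto _).comp hx).liminf_eq.symm
      _ ≤ liminf (fun n => ∫⁻ x, ENNReal.ofReal (φ x ^ 2 * (μ x * c n x))) atTop :=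
          lintegral_liminf_le' fun n => (ic (hcc n)).aestronglyMeasurable.aemeasurable.ennreal_ofReal
      _ ≤ liminf (fun _ : ℕ => ENNReal.ofReal B) atTop := by
          refine liminf_le_liminf (Eventually.of_forall fun n => ?_)
          rw [← ofReal_integral_eq_lintegral_ofReal (ic (hcc n)) (hnn n)]
          exact ENNReal.ofReal_le_ofReal (hbound n)
      _ = ENNReal.ofReal B := liminf_const _
  have hint : Integrable h := by
    refine ⟨hmeas, ?_⟩
    rw [hasFiniteIntegral_iff_ofReal hh0]
    exact hfatou.trans_lt ENNReal.ofReal_lt_top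
  refine ⟨hint, ?_⟩
  rw [← ofReal_integral_eq_lintegral_ofReal hint hh0] at hfatou
  exact (ENNReal.ofReal_le_ofReal_iff hB0).mp hfatou

/-- Weighted Hardy inequality for bounded functions of compact support, under a pointwise bound
for the potential. -/
theorem IsRegularDensity.hardy_of_bounded (hμ : IsRegularDensity μ gw L) (hN : 2 ≤ N) {c₀ K : ℝ}
    (hc₀ : 0 ≤ c₀)
    (hpot : ∀ᵐ x, μ x ≠ 0 → c₀ / ‖x‖ ^ 2 * μ x ≤
      μ x * ((hardyConst N + logWeight (‖x‖ ^ 2) ^ 2) / ‖x‖ ^ 2) -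
      (‖gw x‖ ^ 2 - 1 / 2 * L x) + K * μ x)
    {φ : RN N → ℝ} {g : RN N → RN N} (hφ : HasWeakGradient φ g) (hφc : HasCompactSupport φ)
    {M : ℝ} (hM : ∀ x, |φ x| ≤ M) (hg : Integrable fun x => μ x * ‖g x‖ ^ 2) :
    ∫⁻ x, ENNReal.ofReal (c₀ * (φ x ^ 2 / ‖x‖ ^ 2) * μ x) ≤
      ENNReal.ofReal ((∫ x, μ x * ‖g x‖ ^ 2) + (2 * Real.exp 1 + K) * ∫ x, φ x ^ 2 * μ x) := by
  obtain ⟨hint, hle⟩ := hμ.integrable_hardy hN hφ hφc hM hg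
  have mφ := hφ.locallyIntegrable.aestronglyMeasurable
  have mμ := hμ.aestronglyMeasurable
  have iμ : Integrable fun x => φ x ^ 2 * μ x :=
    hμ.grad.locallyIntegrable.integrable_sq_mul mφ hφc hM
  have i1 : Integrable fun x => (if μ x = 0 then 0 else 1) *
      (φ x ^ 2 * (‖gw x‖ ^ 2 - 1 / 2 * L x)) :=
    (((hμ.grad_sq.sub (hμ.lap.locallyIntegrable_lap.smul (1 / 2 : ℝ))).integrable_sq_mul mφ hφc
      hM)).ite_eq_zero_mul mμ
  have hpt : ∀ᵐ x, c₀ * (φ x ^ 2 / ‖x‖ ^ 2) * μ x ≤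
      φ x ^ 2 * (μ x * ((hardyConst N + logWeight (‖x‖ ^ 2) ^ 2) / ‖x‖ ^ 2)) -
      (if μ x = 0 then 0 else 1) * (φ x ^ 2 * (‖gw x‖ ^ 2 - 1 / 2 * L x)) +
      K * (φ x ^ 2 * μ x) := by
    filter_upwards [hpot] with x hx
    split_ifs with h0
    · simp [h0]
    · have := mul_le_mul_of_nonneg_left (hx h0) (sq_nonneg (φ x))
      have e : c₀ * (φ x ^ 2 / ‖x‖ ^ 2) * μ x = φ x ^ 2 * (c₀ / ‖x‖ ^ 2 * μ x) := by ring
      rw [e]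
      linarith
  have i2 := hint.sub i1
  have i3 := i2.add (iμ.const_mul K)
  calc ∫⁻ x, ENNReal.ofReal (c₀ * (φ x ^ 2 / ‖x‖ ^ 2) * μ x)
      ≤ ∫⁻ x, ENNReal.ofReal (φ x ^ 2 * (μ x * ((hardyConst N + logWeight (‖x‖ ^ 2) ^ 2) /
          ‖x‖ ^ 2)) - (if μ x = 0 then 0 else 1) * (φ x ^ 2 * (‖gw x‖ ^ 2 - 1 / 2 * L x)) +
          K * (φ x ^ 2 * μ x)) := by
        refine lintegral_mono_ae ?_
        filter_upwards [hpt] with x hx using ENNReal.ofReal_le_ofReal hx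
    _ = ENNReal.ofReal (∫ x, (φ x ^ 2 * (μ x * ((hardyConst N + logWeight (‖x‖ ^ 2) ^ 2) /
          ‖x‖ ^ 2)) - (if μ x = 0 then 0 else 1) * (φ x ^ 2 * (‖gw x‖ ^ 2 - 1 / 2 * L x)) +
          K * (φ x ^ 2 * μ x))) := by
        refine (ofReal_integral_eq_lintegral_ofReal i3 ?_).symm
        filter_upwards [hpt, hμ.nonneg] with x hx hx0
        refine le_trans ?_ hx
        positivity
    _ ≤ _ := by
        refine ENNReal.ofReal_le_ofReal ?_
        have e1 := integral_add i2 (iμ.const_mul K)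
        have e2 := integral_sub hint i1
        rw [integral_const_mul] at e1
        simp only [Pi.sub_apply] at e1 e2
        rw [e1, e2]
        linarith

end BoundedHardy

/-! ### Removing boundedness and compact support. -/

section GeneralHardy

variable {N : ℕ} {μ : RN N → ℝ} {gw : RN N → RN N} {L : RN N → ℝ}

/-- Dilated cutoff functions exhausting the space. -/
def spaceCut (N n : ℕ) (x : RN N) : ℝ :=
  (⟨1, 2, one_pos, one_lt_two⟩ : ContDiffBump (0 : RN N)) (((n : ℝ) + 1)⁻¹ • x)

lemma contDiff_spaceCut (n : ℕ) : ContDiff ℝ ∞ (spaceCut N n) :=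
  (ContDiffBump.contDiff _).comp (contDiff_id.const_smul _)

lemma hasCompactSupport_spaceCut (n : ℕ) : HasCompactSupport (spaceCut N n) := by
  have h : ((n : ℝ) + 1)⁻¹ ≠ 0 := by positivity
  exact (ContDiffBump.hasCompactSupport _).comp_homeomorph (Homeomorph.smulOfNeZero _ h)

lemma abs_spaceCut_le (n : ℕ) (x : RN N) : |spaceCut N n x| ≤ 1 := by
  rw [spaceCut, abs_of_nonneg (ContDiffBump.nonneg _)]
  exact ContDiffBump.le_one _

lemma tendsto_inv_smul (x : RN N) :
    Tendsto (fun n : ℕ => ((n : ℝ) + 1)⁻¹ • x) atTop (𝓝 0) := by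
  simpa using (tendsto_natCast_add_one.inv_tendsto_atTop).smul_const x

lemma tendsto_spaceCut (x : RN N) : Tendsto (fun n => spaceCut N n x) atTop (𝓝 1) := by
  refine tendsto_const_nhds.congr' ?_
  filter_upwards [(tendsto_inv_smul x).eventually (Metric.ball_mem_nhds 0 one_pos)] with n hn
  exact (ContDiffBump.one_of_mem_closedBall _ (Metric.ball_subset_closedBall hn)).symm

lemma norm_gradient_eq (f : RN N → ℝ) (x : RN N) : ‖gradient f x‖ = ‖fderiv ℝ f x‖ := by
  rw [gradient, LinearIsometryEquiv.norm_map]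

lemma exists_norm_gradient_spaceCut_le (N : ℕ) :
    ∃ D : ℝ, 0 ≤ D ∧ ∀ n (x : RN N), ‖gradient (spaceCut N n) x‖ ≤ D * ((n : ℝ) + 1)⁻¹ := by
  set χ : ContDiffBump (0 : RN N) := ⟨1, 2, one_pos, one_lt_two⟩ with hχ
  obtain ⟨D, hD⟩ := (χ.hasCompactSupport.fderiv (𝕜 := ℝ)).exists_bound_of_continuous
    (χ.contDiff.continuous_fderiv (n := ∞) (by simp))
  refine ⟨D, (norm_nonneg _).trans (hD 0), fun n x => ?_⟩
  have h0 : 0 < ((n : ℝ) + 1)⁻¹ := by positivity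
  have h1 : fderiv ℝ (spaceCut N n) x =
      ((n : ℝ) + 1)⁻¹ • fderiv ℝ χ (((n : ℝ) + 1)⁻¹ • x) :=
    fderiv_comp_smul (f := χ) _
  rw [norm_gradient_eq, h1, norm_smul, Real.norm_eq_abs, abs_of_pos h0, mul_comm]
  exact mul_le_mul_of_nonneg_right (hD _) h0.le

lemma sq_norm_add_le (u v : RN N) : ‖u + v‖ ^ 2 ≤ 2 * ‖u‖ ^ 2 + 2 * ‖v‖ ^ 2 := by
  have h := pow_le_pow_left₀ (norm_nonneg _) (norm_add_le u v) 2
  nlinarith [sq_nonneg (‖u‖ - ‖v‖)]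

/-- Approximation of a weakly differentiable function by bounded functions of compact support. -/
lemma HasWeakGradient.exists_bounded_approx {φ : RN N → ℝ} {g : RN N → RN N}
    (hφ : HasWeakGradient φ g) :
    ∃ (f : ℕ → RN N → ℝ) (G : ℕ → RN N → RN N) (D : ℝ), (∀ n, HasWeakGradient (f n) (G n)) ∧
      (∀ n, HasCompactSupport (f n)) ∧ (∀ (n : ℕ) x, |f n x| ≤ n + 1) ∧
      (∀ n x, |f n x| ≤ |φ x|) ∧
      (∀ n x, ‖G n x‖ ^ 2 ≤ 2 * ‖g x‖ ^ 2 + 2 * (D ^ 2 * φ x ^ 2)) ∧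
      (∀ x, Tendsto (fun n => f n x) atTop (𝓝 (φ x))) ∧
      ∀ x, Tendsto (fun n => G n x) atTop (𝓝 (g x)) := by
  have hk : ∀ n : ℕ, (1 : ℝ) ≤ n + 1 := fun n => by
    linarith [(Nat.cast_nonneg n : (0 : ℝ) ≤ n)]
  obtain ⟨D, hD0, hD⟩ := exists_norm_gradient_spaceCut_le N
  -- A smooth truncation: bounded by n + 1, dominated by |t|, and 1-Lipschitz because its derivative
  -- is H(2H - 1) with H the cutoff, 0 ≤ H ≤ 1.
  set S : ℕ → ℝ → ℝ := fun n t => t * highCut (n + 1) t with hS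
  set S' : ℕ → ℝ → ℝ := fun n t => highCut (n + 1) t + t * highCutDeriv (n + 1) t with hS'
  have dS : ∀ n t, HasDerivAt (S n) (S' n t) t := fun n t =>
    ((hasDerivAt_id' t).mul (hasDerivAt_highCut (hk n) t)).congr_deriv (by rw [one_mul])
  have cH : ∀ n : ℕ, Continuous (highCut ((n : ℝ) + 1)) := fun n =>
    continuous_iff_continuousAt.mpr fun t => (hasDerivAt_highCut (hk n) t).continuousAt
  have cS' : ∀ n, Continuous (S' n) := fun n =>
    (cH n).add (continuous_id.mul (continuous_highCutDeriv (hk n)))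
  have bS : ∀ n t, |S n t| ≤ n + 1 := fun n t => abs_mul_highCut_le (hk n) t
  have bS1 : ∀ n t, |S n t| ≤ |t| := fun n t => by
    rw [hS, abs_mul, abs_of_nonneg (highCut_nonneg (hk n) t)]
    exact mul_le_of_le_one_right (abs_nonneg _) (highCut_le_one (hk n) t)
  have eS' : ∀ n t, S' n t = highCut (n + 1) t * (2 * highCut (n + 1) t - 1) := fun n t => by
    simp only [hS']
    rw [mul_highCutDeriv (hk n)]
    ring
  have bS' : ∀ n t, |S' n t| ≤ 1 := fun n t => by
    have h1 := highCut_nonneg (hk n) t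
    have h2 := highCut_le_one (hk n) t
    rw [eS', abs_le]
    constructor <;> nlinarith
  have lS : ∀ t, Tendsto (fun n => S n t) atTop (𝓝 t) := fun t => by
    simpa [hS] using (tendsto_highCut t).const_mul t
  have lS' : ∀ t, Tendsto (fun n => S' n t) atTop (𝓝 1) := fun t => by
    simp only [eS']
    have h1 := tendsto_highCut t
    have := h1.mul ((h1.const_mul 2).sub_const 1)
    norm_num at this
    exact this
  set f : ℕ → RN N → ℝ := fun n x => spaceCut N n x * S n (φ x) with hf
  set G : ℕ → RN N → RN N := fun n x => spaceCut N n x • (S' n (φ x) • g x) +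
    S n (φ x) • gradient (spaceCut N n) x with hG
  have hfG : ∀ n, HasWeakGradient (f n) (G n) := fun n =>
    (hφ.comp (dS n) (cS' n) (C := n + 1) (bS n)
      (fun t => (bS' n t).trans (hk n))).smooth_mul (contDiff_spaceCut n)
  have bf : ∀ n x, |f n x| ≤ |φ x| := fun n x => by
    rw [hf, abs_mul]
    exact (mul_le_of_le_one_left (abs_nonneg _) (abs_spaceCut_le n x)).trans (bS1 n _)
  have bG : ∀ n x, ‖G n x‖ ^ 2 ≤ 2 * ‖g x‖ ^ 2 + 2 * (D ^ 2 * φ x ^ 2) := fun n x => by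
    refine (sq_norm_add_le _ _).trans ?_
    have h1 : ‖spaceCut N n x • (S' n (φ x) • g x)‖ ≤ ‖g x‖ := by
      rw [norm_smul, norm_smul]
      exact (mul_le_of_le_one_left (by positivity) (abs_spaceCut_le n x)).trans
        (mul_le_of_le_one_left (norm_nonneg _) (bS' n _))
    have h2 : ‖S n (φ x) • gradient (spaceCut N n) x‖ ≤ |φ x| * D := by
      rw [norm_smul]
      refine mul_le_mul (bS1 n _) ((hD n x).trans ?_) (norm_nonneg _) (abs_nonneg _)
      exact mul_le_of_le_one_right hD0 (inv_le_one_of_one_le₀ (hk n))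
    have h3 := pow_le_pow_left₀ (norm_nonneg _) h1 2
    have h4 := pow_le_pow_left₀ (norm_nonneg _) h2 2
    rw [mul_pow, sq_abs] at h4
    linarith
  have lf : ∀ x, Tendsto (fun n => f n x) atTop (𝓝 (φ x)) := fun x => by
    simpa [hf] using (tendsto_spaceCut x).mul (lS (φ x))
  have lG : ∀ x, Tendsto (fun n => G n x) atTop (𝓝 (g x)) := fun x => by
    have h1 : Tendsto (fun n => gradient (spaceCut N n) x) atTop (𝓝 0) := by
      refine squeeze_zero_norm (hD · x) ?_
      simpa using tendsto_natCast_add_one.inv_tendsto_atTop.const_mul D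
    simpa [hG] using ((tendsto_spaceCut x).smul ((lS' (φ x)).smul_const (g x))).add
      ((lS (φ x)).smul h1)
  refine ⟨f, G, D, hfG, fun n => (hasCompactSupport_spaceCut n).mul_right, fun n x => ?_, bf, bG,
    lf, lG⟩
  rw [hf, abs_mul]
  exact (mul_le_of_le_one_left (abs_nonneg _) (abs_spaceCut_le n x)).trans (bS n _)

/-- Extension of a weighted Hardy inequality from bounded compactly supported functions to all
functions of finite energy. -/
theorem hardy_of_forall_bounded (hμ0 : ∀ᵐ x, 0 ≤ μ x) (hμm : AEStronglyMeasurable μ volume)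
    {c₀ C : ℝ}
    (H : ∀ (φ : RN N → ℝ) (g : RN N → RN N) (M : ℝ), HasWeakGradient φ g → HasCompactSupport φ →
      (∀ x, |φ x| ≤ M) → Integrable (fun x => μ x * ‖g x‖ ^ 2) →
      ∫⁻ x, ENNReal.ofReal (c₀ * (φ x ^ 2 / ‖x‖ ^ 2) * μ x) ≤
        ENNReal.ofReal ((∫ x, μ x * ‖g x‖ ^ 2) + C * ∫ x, φ x ^ 2 * μ x))
    {φ : RN N → ℝ} {g : RN N → RN N} (hφ : HasWeakGradient φ g)
    (hg : Integrable fun x => μ x * ‖g x‖ ^ 2) (hφ2 : Integrable fun x => φ x ^ 2 * μ x) :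
    ∫⁻ x, ENNReal.ofReal (c₀ * (φ x ^ 2 / ‖x‖ ^ 2) * μ x) ≤
      ENNReal.ofReal ((∫ x, μ x * ‖g x‖ ^ 2) + C * ∫ x, φ x ^ 2 * μ x) := by
  obtain ⟨f, G, D, hfG, hfc, bn, bf, bG, lf, lG⟩ := hφ.exists_bounded_approx
  have mf : ∀ n, AEStronglyMeasurable (f n) volume := fun n =>
    (hfG n).locallyIntegrable.aestronglyMeasurable
  have mG : ∀ n, AEStronglyMeasurable (G n) volume := fun n =>
    (hfG n).locallyIntegrable_grad.aestronglyMeasurable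
  have idom : Integrable fun x => 2 * (μ x * ‖g x‖ ^ 2) + 2 * D ^ 2 * (φ x ^ 2 * μ x) :=
    (hg.const_mul 2).add (hφ2.const_mul _)
  have dG : ∀ n, ∀ᵐ x, ‖μ x * ‖G n x‖ ^ 2‖ ≤
      2 * (μ x * ‖g x‖ ^ 2) + 2 * D ^ 2 * (φ x ^ 2 * μ x) := fun n => by
    filter_upwards [hμ0] with x hx
    rw [Real.norm_eq_abs, abs_of_nonneg (by positivity)]
    nlinarith [mul_le_mul_of_nonneg_left (bG n x) hx]
  have df : ∀ n, ∀ᵐ x, ‖f n x ^ 2 * μ x‖ ≤ φ x ^ 2 * μ x := fun n => by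
    filter_upwards [hμ0] with x hx
    rw [Real.norm_eq_abs, abs_of_nonneg (by positivity), ← sq_abs, ← sq_abs (φ x)]
    exact mul_le_mul_of_nonneg_right (pow_le_pow_left₀ (abs_nonneg _) (bf n x) 2) hx
  have l1 : Tendsto (fun n => ∫ x, μ x * ‖G n x‖ ^ 2) atTop (𝓝 (∫ x, μ x * ‖g x‖ ^ 2)) :=
    tendsto_integral_of_dominated_convergence _ (fun n => hμm.mul ((mG n).norm.pow 2)) idom dG
      (Eventually.of_forall fun x => (((lG x).norm).pow 2).const_mul _)
  have l2 : Tendsto (fun n => ∫ x, f n x ^ 2 * μ x) atTop (𝓝 (∫ x, φ x ^ 2 * μ x)) :=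
    tendsto_integral_of_dominated_convergence _ (fun n => ((mf n).pow 2).mul hμm) hφ2 df
      (Eventually.of_forall fun x => ((lf x).pow 2).mul_const _)
  have hn : ∀ n, ∫⁻ x, ENNReal.ofReal (c₀ * (f n x ^ 2 / ‖x‖ ^ 2) * μ x) ≤
      ENNReal.ofReal ((∫ x, μ x * ‖G n x‖ ^ 2) + C * ∫ x, f n x ^ 2 * μ x) := fun n =>
    H (f n) (G n) (n + 1) (hfG n) (hfc n) (bn n)
      (idom.mono' (hμm.mul ((mG n).norm.pow 2)) (dG n))
  have mnorm : AEStronglyMeasurable (fun x : RN N => ‖x‖ ^ 2) volume :=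
    (continuous_norm.pow 2).aestronglyMeasurable
  have l3 : ∀ x, liminf (fun n => ENNReal.ofReal (c₀ * (f n x ^ 2 / ‖x‖ ^ 2) * μ x)) atTop =
      ENNReal.ofReal (c₀ * (φ x ^ 2 / ‖x‖ ^ 2) * μ x) := fun x => by
    have h1 : Tendsto (fun n => c₀ * (f n x ^ 2 / ‖x‖ ^ 2) * μ x) atTop
        (𝓝 (c₀ * (φ x ^ 2 / ‖x‖ ^ 2) * μ x)) :=
      ((((lf x).pow 2).div_const _).const_mul _).mul_const _
    exact (ENNReal.tendsto_ofReal h1).liminf_eq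
  have l4 : liminf (fun n => ENNReal.ofReal ((∫ x, μ x * ‖G n x‖ ^ 2) +
      C * ∫ x, f n x ^ 2 * μ x)) atTop =
      ENNReal.ofReal ((∫ x, μ x * ‖g x‖ ^ 2) + C * ∫ x, φ x ^ 2 * μ x) :=
    (ENNReal.tendsto_ofReal (l1.add (l2.const_mul C))).liminf_eq
  -- Fatou's lemma on the singular side, whose finiteness is not yet known; the right side converges
  -- by domination.
  have l5 := lintegral_liminf_le' (μ := (volume : Measure (RN N))) (u := atTop)
    (f := fun n x => ENNReal.ofReal (c₀ * (f n x ^ 2 / ‖x‖ ^ 2) * μ x)) fun n =>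
    (((((mf n).pow 2).aemeasurable.div mnorm.aemeasurable).const_mul c₀).mul
      hμm.aemeasurable).ennreal_ofReal
  simp only [l3] at l5
  rw [← l4]
  exact l5.trans (liminf_le_liminf (Eventually.of_forall hn))

end GeneralHardy

/-! ### From hypothesis (H2) to the inequality on H^1_μ. -/

section Density

variable {N : ℕ} {μ : RN N → ℝ}

lemma locallyIntegrable_norm_sq_of_memLp {E : Type*} [NormedAddCommGroup E] {f : RN N → E}
    (hf : ∀ K : Set (RN N), IsCompact K → MemLp f 2 (volume.restrict K)) :
    LocallyIntegrable (fun x => ‖f x‖ ^ 2) volume := by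
  rw [locallyIntegrable_iff]
  intro K hK
  exact (memLp_two_iff_integrable_sq_norm (hf K hK).1).mp (hf K hK)

/-- The weak gradient of the square of a function of class `H^1_loc`. -/
lemma HasWeakGradient.sq {w : RN N → ℝ} {g : RN N → RN N} (h : HasWeakGradient w g)
    (hw : LocallyIntegrable (fun x => ‖w x‖ ^ 2) volume)
    (hg : LocallyIntegrable (fun x => ‖g x‖ ^ 2) volume) :
    HasWeakGradient (fun x => w x ^ 2) (fun x => (2 * w x) • g x) := by
  have hk : ∀ n : ℕ, (1 : ℝ) ≤ n + 1 := fun n => by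
    linarith [(Nat.cast_nonneg n : (0 : ℝ) ≤ n)]
  have cH : ∀ n : ℕ, Continuous (highCut ((n : ℝ) + 1)) := fun n =>
    continuous_iff_continuousAt.mpr fun t => (hasDerivAt_highCut (hk n) t).continuousAt
  have mw := h.locallyIntegrable.aestronglyMeasurable
  have mg := h.locallyIntegrable_grad.aestronglyMeasurable
  have lw : LocallyIntegrable (fun x => w x ^ 2) volume := by simpa using hw
  have hle : ∀ x, ‖(2 * w x) • g x‖ ≤ ‖w x‖ ^ 2 + ‖g x‖ ^ 2 := fun x => by
    rw [norm_smul, norm_mul, Real.norm_ofNat]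
    nlinarith [sq_nonneg (‖w x‖ - ‖g x‖)]
  have hlg : LocallyIntegrable (fun x => (2 * w x) • g x) volume := by
    refine (hw.add hg).mono ((mw.const_mul 2).smul mg) (Eventually.of_forall fun x => ?_)
    exact (hle x).trans (le_abs_self _)
  -- The square is unbounded, so the chain rule is applied to t²H(t), with H the high cutoff; its
  -- derivative simplifies to 2tH(t)².
  have happrox : ∀ n : ℕ, HasWeakGradient (fun x => w x ^ 2 * highCut (n + 1) (w x))
      (fun x => (2 * w x * highCut (n + 1) (w x) ^ 2) • g x) := by
    intro n
    refine h.comp (R := fun t => t ^ 2 * highCut (n + 1) t)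
      (R' := fun t => 2 * t * highCut (n + 1) t ^ 2) (C := 2 * ((n : ℝ) + 1)) (fun t => ?_) ?_
      (fun t => ?_) fun t => ?_
    · refine ((hasDerivAt_pow 2 t).mul (hasDerivAt_highCut (hk n) t)).congr_deriv ?_
      have := mul_highCutDeriv (hk n) t
      simp only [Nat.cast_ofNat, Nat.add_one_sub_one, pow_one]
      linear_combination t * this
    · exact (continuous_const.mul continuous_id).mul ((cH n).pow 2)
    · have h1 := highCut_nonneg (hk n) t
      rw [abs_of_nonneg (by positivity)]
      unfold highCut
      have h2 : 0 < (n : ℝ) + 1 + t ^ 2 := by positivity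
      rw [mul_div_assoc', div_le_iff₀ h2]
      nlinarith [hk n, sq_nonneg t]
    · have h1 := abs_mul_highCut_le (hk n) t
      have h2 := highCut_nonneg (hk n) t
      have h3 := highCut_le_one (hk n) t
      have h4 : 2 * t * highCut (n + 1) t ^ 2 = 2 * (t * highCut (n + 1) t) * highCut (n + 1) t := by
        ring
      rw [h4, abs_mul, abs_mul, abs_of_nonneg h2, abs_two]
      nlinarith [abs_nonneg (t * highCut ((n : ℝ) + 1) t)]
  refine ⟨lw, hlg, fun ψ hψ v => ?_⟩
  have i1 : Integrable fun x => w x ^ 2 * fderiv ℝ ψ x v :=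
    lw.integrable_smul_right_of_hasCompactSupport
      ((hψ.1.continuous_fderiv (by simp)).clm_apply continuous_const)
      (hψ.2.fderiv_apply (𝕜 := ℝ) v)
  have i2 : Integrable fun x => ‖(2 * w x) • g x‖ * ‖v‖ * ‖ψ x‖ := by
    have := hlg.norm'.integrable_smul_right_of_hasCompactSupport (g := fun x => ‖v‖ * ‖ψ x‖)
      (continuous_const.mul hψ.1.continuous.norm) hψ.2.norm.mul_left
    simpa [mul_assoc] using this
  have l1 : Tendsto (fun n : ℕ => ∫ x, w x ^ 2 * highCut (n + 1) (w x) * fderiv ℝ ψ x v) atTop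
      (𝓝 (∫ x, w x ^ 2 * fderiv ℝ ψ x v)) := by
    refine tendsto_integral_of_dominated_convergence (fun x => ‖w x ^ 2 * fderiv ℝ ψ x v‖)
      (fun n => ?_) i1.norm (fun n => Eventually.of_forall fun x => ?_)
      (Eventually.of_forall fun x => ?_)
    · exact ((mw.pow 2).mul ((cH n).comp_aestronglyMeasurable mw)).mul
        ((hψ.1.continuous_fderiv (by simp)).clm_apply continuous_const).aestronglyMeasurable
    · rw [norm_mul, norm_mul, norm_mul, Real.norm_eq_abs (highCut _ _),
        abs_of_nonneg (highCut_nonneg (hk n) _)]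
      exact mul_le_mul_of_nonneg_right (mul_le_of_le_one_right (norm_nonneg _)
        (highCut_le_one (hk n) _)) (norm_nonneg _)
    · simpa using ((tendsto_highCut (w x)).const_mul (w x ^ 2)).mul_const (fderiv ℝ ψ x v)
  have l2 : Tendsto (fun n : ℕ => ∫ x, inner ℝ ((2 * w x * highCut (n + 1) (w x) ^ 2) • g x) v *
      ψ x) atTop (𝓝 (∫ x, inner ℝ ((2 * w x) • g x) v * ψ x)) := by
    refine tendsto_integral_of_dominated_convergence (fun x => ‖(2 * w x) • g x‖ * ‖v‖ * ‖ψ x‖)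
      (fun n => ?_) i2 (fun n => Eventually.of_forall fun x => ?_)
      (Eventually.of_forall fun x => ?_)
    · exact ((((mw.const_mul 2).mul (((cH n).comp_aestronglyMeasurable mw).pow 2)).smul
        mg).inner aestronglyMeasurable_const).mul hψ.1.continuous.aestronglyMeasurable
    · rw [norm_mul]
      refine mul_le_mul_of_nonneg_right ((norm_inner_le_norm _ _).trans
        (mul_le_mul_of_nonneg_right ?_ (norm_nonneg _))) (norm_nonneg _)
      rw [norm_smul, norm_smul, norm_mul, Real.norm_eq_abs (highCut _ _ ^ 2),
        abs_of_nonneg (sq_nonneg _)]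
      exact mul_le_mul_of_nonneg_right (mul_le_of_le_one_right (norm_nonneg _)
        (pow_le_one₀ (highCut_nonneg (hk n) _) (highCut_le_one (hk n) _))) (norm_nonneg _)
    · have h1 : Tendsto (fun n : ℕ => (2 * w x * highCut (n + 1) (w x) ^ 2) • g x) atTop
          (𝓝 ((2 * w x) • g x)) := by
        simpa using (((tendsto_highCut (w x)).pow 2).const_mul (2 * w x)).smul_const (g x)
      exact (h1.inner tendsto_const_nhds).mul_const _
  exact tendsto_nhds_unique l1 ((l2.neg).congr fun n =>
    ((happrox n).integral_eq ψ hψ v).symm)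

lemma HypH2.isRegularDensity (h : HypH2 μ) :
    IsRegularDensity μ (weakGrad fun x => √(μ x)) (weakLaplacian μ) := by
  have hw := hasWeakGradient_weakGrad h.sqrt_memH1Loc.exists_weakGrad
  have h1 := locallyIntegrable_norm_sq_of_memLp h.sqrt_memH1Loc.memLp
  have h2 := locallyIntegrable_norm_sq_of_memLp h.sqrt_memH1Loc.memLp_grad
  refine ⟨h.nonneg, (hw.sq h1 h2).congr_left ?_, h2,
    hw.locallyIntegrable_grad.aestronglyMeasurable,
    hasWeakLaplacian_weakLaplacian h.laplacian_memL1Loc⟩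
  filter_upwards [h.nonneg] with x hx
  exact Real.sq_sqrt hx

lemma ae_densityMeasure_iff (hμm : AEStronglyMeasurable μ volume) {p : RN N → Prop} :
    (∀ᵐ x ∂(densityMeasure μ), p x) ↔ ∀ᵐ x, 0 < μ x → p x := by
  rw [densityMeasure, ae_withDensity_iff' hμm.aemeasurable.ennreal_ofReal]
  simp only [ne_eq, ENNReal.ofReal_eq_zero, not_le]

lemma integrable_densityMeasure_iff (hμm : AEStronglyMeasurable μ volume)
    (hμ0 : ∀ᵐ x, 0 ≤ μ x) {f : RN N → ℝ} :
    Integrable f (densityMeasure μ) ↔ Integrable fun x => μ x * f x := by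
  rw [densityMeasure, integrable_withDensity_iff_integrable_smul₀' hμm.aemeasurable.ennreal_ofReal
    (Eventually.of_forall fun x => ENNReal.ofReal_lt_top)]
  refine integrable_congr ?_
  filter_upwards [hμ0] with x hx
  rw [ENNReal.toReal_ofReal hx, smul_eq_mul]

lemma lintegral_densityMeasure (hμm : AEStronglyMeasurable μ volume)
    (hμ0 : ∀ᵐ x, 0 ≤ μ x) {f : RN N → ℝ} (hf : AEMeasurable f volume) :
    ∫⁻ x, ENNReal.ofReal (f x) ∂(densityMeasure μ) = ∫⁻ x, ENNReal.ofReal (f x * μ x) := by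
  rw [densityMeasure, lintegral_withDensity_eq_lintegral_mul₀ hμm.aemeasurable.ennreal_ofReal
    hf.ennreal_ofReal]
  refine lintegral_congr_ae ?_
  filter_upwards [hμ0] with x hx
  rw [Pi.mul_apply, ← ENNReal.ofReal_mul hx, mul_comm]

/-- The map y ↦ c_0(N) - y on the extended reals is continuous and antitone, hence exchanges the
upper limit with the lower one. Finiteness of the latter excludes the default values of `toReal`. -/
lemma limsupPotential_eq {c₀ : ℝ} (hc : hardyConstMu μ = (c₀ : EReal)) :
    (limsupPotential μ).toReal = hardyConst N - c₀ := by
  -- A lower limit along the trivial filter would be `⊤`, contrary to its finiteness.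
  have hne : (essNhdsZero μ).NeBot := by
    rw [neBot_iff]
    intro hbot
    rw [hardyConstMu, hbot, liminf_bot] at hc
    exact EReal.coe_ne_top _ hc.symm
  have hanti : Antitone fun y : EReal => (hardyConst N : EReal) - y := fun a b hab =>
    EReal.sub_le_sub le_rfl hab
  have hcont : ContinuousAt (fun y : EReal => (hardyConst N : EReal) - y) (limsupPotential μ) := by
    have h1 := EReal.continuousAt_add (p := ((hardyConst N : EReal), -limsupPotential μ))
      (Or.inl (EReal.coe_ne_top _)) (Or.inl (EReal.coe_ne_bot _))
    have h2 : ContinuousAt (fun y : EReal => ((hardyConst N : EReal), -y)) (limsupPotential μ) :=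
      continuousAt_const.prodMk continuous_neg.continuousAt
    exact ContinuousAt.comp (f := fun y : EReal => ((hardyConst N : EReal), -y)) h1 h2
  have h := hanti.map_limsup_of_continuousAt (F := essNhdsZero μ)
    (fun x => ((‖x‖ ^ 2 * potentialMu μ x : ℝ) : EReal)) hcont
  have h2 : (hardyConst N : EReal) - limsupPotential μ = (c₀ : EReal) := by
    rw [← hc]
    exact h
  induction hl : limsupPotential μ with
  | bot => rw [hl] at h2; simp at h2
  | top => rw [hl] at h2; simp at h2
  | coe r =>
    rw [hl, ← EReal.coe_sub, EReal.coe_eq_coe_iff] at h2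
    rw [EReal.toReal_coe]
    linarith

/-- Pointwise form of the hypothesis on the potential. -/
lemma HypH2.exists_potential_bound (h : HypH2 μ) {c₀ : ℝ}
    (hc : hardyConstMu μ = (c₀ : EReal)) (hN : 2 ≤ N) :
    ∃ K : ℝ, 0 ≤ K ∧ ∀ᵐ x, μ x ≠ 0 → c₀ / ‖x‖ ^ 2 * μ x ≤
      μ x * ((hardyConst N + logWeight (‖x‖ ^ 2) ^ 2) / ‖x‖ ^ 2) -
      (‖weakGrad (fun x => √(μ x)) x‖ ^ 2 - 1 / 2 * weakLaplacian μ x) + K * μ x := by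
  have hreg := h.isRegularDensity
  have hμm := hreg.aestronglyMeasurable
  have : Nonempty (Fin N) := ⟨⟨0, by omega⟩⟩
  have hne : ∀ᵐ x : RN N, x ≠ 0 := by
    simp [ae_iff, measure_singleton]
  obtain ⟨R₀, hR₀, hlog⟩ := h.log_bound
  -- The bound 1/2 is the range of `log_weight_comparison`.
  set r₀ := min R₀ (1 / 2) with hr₀
  have hr₀0 : 0 < r₀ := lt_min hR₀ (by norm_num)
  obtain ⟨K₁, hK₁⟩ := h.bddAbove_away r₀ hr₀0
  rw [ae_densityMeasure_iff hμm] at hlog hK₁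
  -- Away from the origin the constant is the bound of (H2) iii); near it, it is the error 2e in
  -- comparing logarithms.
  refine ⟨max K₁ (2 * Real.exp 1), le_trans (by positivity) (le_max_right _ _), ?_⟩
  filter_upwards [hne, hlog, hK₁, h.nonneg, hreg.grad.weakGrad_ae_eq] with x hx0 hx1 hx2 hx3 hx4 hx5
  have hμ : 0 < μ x := lt_of_le_of_ne hx3 (Ne.symm hx5)
  have hn : 0 < ‖x‖ := norm_pos_iff.mpr hx0
  have hn2 : 0 < ‖x‖ ^ 2 := by positivity
  have hU : potentialU μ x ≤ logWeight (‖x‖ ^ 2) ^ 2 / ‖x‖ ^ 2 + max K₁ (2 * Real.exp 1) := by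
    rcases lt_or_ge ‖x‖ r₀ with hlt | hge
    · have h1 := hx1 hμ (hlt.trans_le (min_le_left _ _))
      have h2 := log_weight_comparison hn (hlt.le.trans (min_le_right _ _))
      have h3 : potentialU μ x ≤ 1 / 4 * (1 / |Real.log ‖x‖| ^ 2) / ‖x‖ ^ 2 := by
        rw [le_div_iff₀ hn2]
        linarith
      linarith [le_max_right K₁ (2 * Real.exp 1)]
    · have h1 := hx2 hμ hge
      have h2 : 0 ≤ logWeight (‖x‖ ^ 2) ^ 2 / ‖x‖ ^ 2 := by positivity
      linarith [le_max_left K₁ (2 * Real.exp 1)]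
  have hP : potentialMu μ x * μ x =
      ‖weakGrad (fun x => √(μ x)) x‖ ^ 2 - 1 / 2 * weakLaplacian μ x := by
    rw [potentialMu, hx4, norm_smul, mul_pow, norm_two_sqrt_smul_sq hx3, Real.norm_eq_abs, sq_abs]
    field_simp
  rw [potentialU, limsupPotential_eq hc] at hU
  have h5 := mul_le_mul_of_nonneg_right hU hμ.le
  rw [← hP]
  have e1 : (hardyConst N + logWeight (‖x‖ ^ 2) ^ 2) / ‖x‖ ^ 2 =
      c₀ / ‖x‖ ^ 2 + 1 / ‖x‖ ^ 2 * (hardyConst N - c₀) + logWeight (‖x‖ ^ 2) ^ 2 / ‖x‖ ^ 2 := by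
    field_simp
    ring
  rw [e1]
  linarith

lemma weightedHardy_of_le (hN : 2 ≤ N) (h : HypH2 μ) {c c₀ : ℝ} (hc₀ : 0 ≤ c₀)
    (hc : hardyConstMu μ = (c₀ : EReal)) (hle : c ≤ c₀) : WeightedHardy μ c := by
  have hreg := h.isRegularDensity
  have hμm := hreg.aestronglyMeasurable
  have hμ0 := h.nonneg
  obtain ⟨K, hK0, hK⟩ := h.exists_potential_bound hc hN
  -- The term 2e comes from the Hardy field, `K` from the potential.
  refine ⟨2 * Real.exp 1 + K, fun φ hφ => ?_⟩
  have hw := hasWeakGradient_weakGrad hφ.exists_weakGrad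
  have mφ := hw.locallyIntegrable.aestronglyMeasurable
  have mg := hw.locallyIntegrable_grad.aestronglyMeasurable
  have i1 : Integrable fun x => φ x ^ 2 * μ x := by
    have := (integrable_densityMeasure_iff hμm hμ0).mp hφ.memLp.integrable_sq
    simpa only [mul_comm] using this
  have i2 : Integrable fun x => μ x * ‖weakGrad φ x‖ ^ 2 :=
    (integrable_densityMeasure_iff hμm hμ0).mp
      ((memLp_two_iff_integrable_sq_norm hφ.memLp_grad.1).mp hφ.memLp_grad)
  have hmain := hardy_of_forall_bounded hμ0 hμm (c₀ := c₀) (C := 2 * Real.exp 1 + K)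
    (fun φ g M h1 h2 h3 h4 => hreg.hardy_of_bounded hN hc₀ hK h1 h2 h3 h4) hw i2 i1
  set A := ∫⁻ x, ENNReal.ofReal (φ x ^ 2 / ‖x‖ ^ 2) ∂(densityMeasure μ) with hA
  have mnorm : AEMeasurable (fun x : RN N => ‖x‖ ^ 2) volume :=
    (continuous_norm.pow 2).aemeasurable
  have eA : ∫⁻ x, ENNReal.ofReal (c₀ * (φ x ^ 2 / ‖x‖ ^ 2) * μ x) = ENNReal.ofReal c₀ * A := by
    rw [hA, lintegral_densityMeasure (f := fun x => φ x ^ 2 / ‖x‖ ^ 2) hμm hμ0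
      ((mφ.aemeasurable.pow_const 2).div mnorm),
      ← lintegral_const_mul' _ _ ENNReal.ofReal_ne_top]
    refine lintegral_congr fun x => ?_
    rw [← ENNReal.ofReal_mul hc₀, mul_assoc]
  have eB : ∫⁻ x, ENNReal.ofReal (‖weakGrad φ x‖ ^ 2) ∂(densityMeasure μ) =
      ENNReal.ofReal (∫ x, μ x * ‖weakGrad φ x‖ ^ 2) := by
    rw [lintegral_densityMeasure hμm hμ0 (mg.norm.aemeasurable.pow_const 2),
      ofReal_integral_eq_lintegral_ofReal i2]
    · simp only [mul_comm]
    · filter_upwards [hμ0] with x hx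
      exact mul_nonneg hx (sq_nonneg _)
  have eD : ∫⁻ x, ENNReal.ofReal (φ x ^ 2) ∂(densityMeasure μ) =
      ENNReal.ofReal (∫ x, φ x ^ 2 * μ x) := by
    rw [lintegral_densityMeasure hμm hμ0 (mφ.aemeasurable.pow_const 2),
      ofReal_integral_eq_lintegral_ofReal i1]
    filter_upwards [hμ0] with x hx
    exact mul_nonneg (sq_nonneg _) hx
  have hI : 0 ≤ ∫ x, μ x * ‖weakGrad φ x‖ ^ 2 := integral_nonneg_of_ae (by
    filter_upwards [hμ0] with x hx
    exact mul_nonneg hx (sq_nonneg _))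
  have hJ : 0 ≤ ∫ x, φ x ^ 2 * μ x := integral_nonneg_of_ae (by
    filter_upwards [hμ0] with x hx
    exact mul_nonneg (sq_nonneg _) hx)
  rw [eA] at hmain
  rw [HardyIneq, eB, eD, EReal.coe_ennreal_ofReal, EReal.coe_ennreal_ofReal, max_eq_left hI,
    max_eq_left hJ, ← EReal.coe_mul, ← EReal.coe_add]
  -- The constant `c` may be negative; comparison with `c₀` needs only A ≥ 0.
  have h1 : (c : EReal) * (A : EReal) ≤ (c₀ : EReal) * (A : EReal) :=
    mul_le_mul_of_nonneg_right (EReal.coe_le_coe_iff.mpr hle) (EReal.coe_ennreal_nonneg A)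
  refine h1.trans ?_
  have h2 : (c₀ : EReal) * (A : EReal) = ((ENNReal.ofReal c₀ * A : ENNReal) : EReal) := by
    rw [EReal.coe_ennreal_mul, EReal.coe_ennreal_ofReal, max_eq_left hc₀]
  rw [h2]
  refine (EReal.coe_ennreal_le_coe_ennreal_iff.mpr hmain).trans ?_
  rw [EReal.coe_ennreal_ofReal, max_eq_left (by positivity)]

end Density

/-! ### Powers with a cutoff, as functions of one variable. -/

section PowerCut

/-- The function `s ^ (γ / 2)`, cut off smoothly between `s = 3` and `s = 6`. -/
def powerCut (γ s : ℝ) : ℝ :=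
  s ^ (γ / 2) * (⟨3, 6, by norm_num, by norm_num⟩ : ContDiffBump (0 : ℝ)) s

variable {γ s : ℝ}

lemma contDiffAt_powerCut (hs : 0 < s) : ContDiffAt ℝ 1 (powerCut γ) s :=
  (Real.contDiffAt_rpow_const_of_ne hs.ne').mul (ContDiffBump.contDiff _).contDiffAt

lemma powerCut_eq (hs : 0 ≤ s) (hs3 : s ≤ 3) : powerCut γ s = s ^ (γ / 2) := by
  rw [powerCut, ContDiffBump.one_of_mem_closedBall, mul_one]
  rw [Metric.mem_closedBall, dist_zero_right, Real.norm_eq_abs, abs_of_nonneg hs]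
  exact hs3

lemma powerCut_eq_zero (hs : 6 ≤ s) : powerCut γ s = 0 := by
  rw [powerCut, ContDiffBump.zero_of_le_dist, mul_zero]
  rw [dist_zero_right, Real.norm_eq_abs, abs_of_nonneg (by linarith)]
  exact hs

lemma deriv_powerCut (hs : 0 < s) (hs3 : s < 3) :
    deriv (powerCut γ) s = γ / 2 * s ^ (γ / 2 - 1) := by
  have h : powerCut γ =ᶠ[𝓝 s] fun t => t ^ (γ / 2) := by
    filter_upwards [Ioo_mem_nhds hs hs3] with t ht
    exact powerCut_eq ht.1.le ht.2.le
  rw [h.deriv_eq, Real.deriv_rpow_const]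

lemma deriv_powerCut_eq_zero (hs : 6 < s) : deriv (powerCut γ) s = 0 := by
  have h : powerCut γ =ᶠ[𝓝 s] fun _ => 0 := by
    filter_upwards [Ioi_mem_nhds hs] with t ht
    exact powerCut_eq_zero (le_of_lt ht)
  rw [h.deriv_eq, deriv_const]

lemma powerCut_sq_le (hs : 0 ≤ s) : powerCut γ s ^ 2 ≤ s ^ γ := by
  rw [powerCut, mul_pow, ← Real.rpow_natCast (s ^ (γ / 2)), ← Real.rpow_mul hs]
  have h0 := ContDiffBump.nonneg (⟨3, 6, by norm_num, by norm_num⟩ : ContDiffBump (0 : ℝ)) (x := s)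
  have h1 := ContDiffBump.le_one (⟨3, 6, by norm_num, by norm_num⟩ : ContDiffBump (0 : ℝ)) (x := s)
  have e : γ / 2 * ((2 : ℕ) : ℝ) = γ := by push_cast; ring
  rw [e]
  exact mul_le_of_le_one_right (Real.rpow_nonneg hs _) (pow_le_one₀ h0 h1)

lemma exists_bound_deriv_powerCut (γ : ℝ) :
    ∃ M : ℝ, 0 ≤ M ∧ ∀ s, 1 ≤ s → |deriv (powerCut γ) s| ≤ M := by
  have hc : ContDiffOn ℝ 1 (powerCut γ) (Set.Ioi 0) := fun s hs =>
    (contDiffAt_powerCut hs).contDiffWithinAt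
  have hd : ContinuousOn (deriv (powerCut γ)) (Set.Icc 1 6) :=
    (hc.continuousOn_deriv_of_isOpen isOpen_Ioi le_rfl).mono fun s hs =>
      lt_of_lt_of_le one_pos hs.1
  obtain ⟨M, hM⟩ := isCompact_Icc.exists_bound_of_continuousOn hd
  refine ⟨max M 0, le_max_right _ _, fun s hs => ?_⟩
  rcases le_or_gt s 6 with h | h
  · exact (hM s ⟨hs, h⟩).trans (le_max_left _ _)
  · rw [deriv_powerCut_eq_zero h, abs_zero]
    exact le_max_right _ _

end PowerCut

/-! ### Near-extremal test functions. -/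

section PowerTest

variable {N : ℕ}

/-- The regularised power `(‖x‖ ^ 2 + ε ^ 2) ^ (γ / 2)`, cut off away from the origin. -/
def powerTest (γ ε : ℝ) (x : RN N) : ℝ := powerCut γ (‖x‖ ^ 2 + ε ^ 2)

variable {γ ε : ℝ} {x : RN N}

lemma contDiff_powerTest (hε : 0 < ε) : ContDiff ℝ 1 (powerTest γ ε : RN N → ℝ) := by
  rw [contDiff_iff_contDiffAt]
  intro x
  exact (contDiffAt_powerCut (by positivity)).comp x
    (((contDiff_norm_sq ℝ).add contDiff_const).contDiffAt)

lemma powerTest_eq_zero (hx : 3 < ‖x‖) : powerTest γ ε x = 0 :=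
  powerCut_eq_zero (by nlinarith [sq_nonneg ε])

lemma hasCompactSupport_powerTest : HasCompactSupport (powerTest γ ε : RN N → ℝ) := by
  refine HasCompactSupport.intro (isCompact_closedBall 0 3) fun x hx => powerTest_eq_zero ?_
  simpa using hx

lemma norm_gradient_powerTest (hε : 0 < ε) :
    ‖gradient (powerTest γ ε) x‖ = 2 * |deriv (powerCut γ) (‖x‖ ^ 2 + ε ^ 2)| * ‖x‖ := by
  have hs : 0 < ‖x‖ ^ 2 + ε ^ 2 := by positivity
  have h1 := ((contDiffAt_powerCut (γ := γ) hs).differentiableAt one_ne_zero).hasDerivAt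
  have h2 := (hasStrictFDerivAt_norm_sq x).hasFDerivAt.add_const (ε ^ 2)
  have h3 : HasFDerivAt (powerTest γ ε : RN N → ℝ) _ x := h1.comp_hasFDerivAt x h2
  rw [norm_gradient_eq, h3.fderiv, norm_smul, ← Nat.cast_smul_eq_nsmul ℝ, norm_smul,
    innerSL_apply_norm, Real.norm_eq_abs, Real.norm_eq_abs]
  push_cast
  rw [abs_two]
  ring

/-- With s = |x|² + ε² < 2 the cutoff is inactive and the squared gradient is γ²s^{γ-2}|x|², where
|x|² ≤ s. The same power s^{γ-1} bounds the Hardy integrand from below in `le_powerTest_sq_div`;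
comparing coefficients γ² and c is the whole point. -/
lemma norm_gradient_powerTest_sq_le_of_lt (hε : 0 < ε) (hε1 : ε ≤ 1) (hx : ‖x‖ < 1) :
    ‖gradient (powerTest γ ε) x‖ ^ 2 ≤ γ ^ 2 * (‖x‖ ^ 2 + ε ^ 2) ^ (γ - 1) := by
  have hs : 0 < ‖x‖ ^ 2 + ε ^ 2 := by positivity
  rw [norm_gradient_powerTest hε, deriv_powerCut hs (by nlinarith [norm_nonneg x])]
  set s := ‖x‖ ^ 2 + ε ^ 2
  have e : (s ^ (γ / 2 - 1)) ^ 2 * s = s ^ (γ - 1) := by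
    rw [← Real.rpow_natCast, ← Real.rpow_mul hs.le, ← Real.rpow_add_one hs.ne']
    congr 1
    push_cast
    ring
  rw [← e, mul_pow, mul_pow, sq_abs, mul_pow]
  have hxs : ‖x‖ ^ 2 ≤ s := le_add_of_nonneg_right (sq_nonneg ε)
  have h := mul_le_mul_of_nonneg_left hxs (by positivity : 0 ≤ γ ^ 2 * (s ^ (γ / 2 - 1)) ^ 2)
  linarith

lemma norm_gradient_powerTest_sq_le_of_le {M : ℝ} (hM0 : 0 ≤ M)
    (hM : ∀ s, 1 ≤ s → |deriv (powerCut γ) s| ≤ M) (hε : 0 < ε) (hx : 1 ≤ ‖x‖) :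
    ‖gradient (powerTest γ ε) x‖ ^ 2 ≤
      (Metric.closedBall (0 : RN N) 3).indicator (fun _ => 36 * M ^ 2) x := by
  rw [norm_gradient_powerTest hε]
  by_cases h : x ∈ Metric.closedBall (0 : RN N) 3
  · rw [Set.indicator_of_mem h]
    rw [mem_closedBall_zero_iff] at h
    have h1 := hM (‖x‖ ^ 2 + ε ^ 2) (by nlinarith)
    calc _ ≤ (2 * M * 3) ^ 2 := by gcongr
      _ = _ := by ring
  · rw [Set.indicator_of_notMem h]
    rw [mem_closedBall_zero_iff, not_le] at h
    rw [deriv_powerCut_eq_zero (by nlinarith)]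
    simp

lemma le_powerTest_sq_div (hε : 0 < ε) (hε1 : ε ≤ 1) (hx : ‖x‖ < 1) (hx0 : x ≠ 0) :
    (‖x‖ ^ 2 + ε ^ 2) ^ (γ - 1) ≤ powerTest γ ε x ^ 2 / ‖x‖ ^ 2 := by
  have hn : 0 < ‖x‖ := norm_pos_iff.mpr hx0
  have hs : 0 < ‖x‖ ^ 2 + ε ^ 2 := by positivity
  rw [powerTest, powerCut_eq hs.le (by nlinarith)]
  set s := ‖x‖ ^ 2 + ε ^ 2
  have e : (s ^ (γ / 2)) ^ 2 = s ^ (γ - 1) * s := by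
    rw [← Real.rpow_natCast, ← Real.rpow_mul hs.le, ← Real.rpow_add_one hs.ne']
    congr 1
    push_cast
    ring
  rw [e, le_div_iff₀ (by positivity)]
  exact mul_le_mul_of_nonneg_left (le_add_of_nonneg_right (sq_nonneg ε)) (Real.rpow_nonneg hs.le _)

/-- Where the test function is nonzero, s < 6: for γ ≥ 0 this gives s^γ ≤ 6^γ, for γ < 0
monotonicity gives s^γ ≤ |x|^{2γ}. The sum covers both signs and does not depend on ε. -/
lemma powerTest_sq_le (hε : 0 < ε) (hx0 : x ≠ 0) :
    powerTest γ ε x ^ 2 ≤ (Metric.closedBall (0 : RN N) 3).indicator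
      (fun x => ‖x‖ ^ (2 * γ) + 6 ^ |γ|) x := by
  have hn : 0 < ‖x‖ := norm_pos_iff.mpr hx0
  have hs : 0 < ‖x‖ ^ 2 + ε ^ 2 := by positivity
  by_cases h : x ∈ Metric.closedBall (0 : RN N) 3
  · rw [Set.indicator_of_mem h, powerTest]
    have h6 : (0 : ℝ) ≤ 6 ^ |γ| := by positivity
    have hp : (0 : ℝ) ≤ ‖x‖ ^ (2 * γ) := by positivity
    rcases le_or_gt 6 (‖x‖ ^ 2 + ε ^ 2) with h1 | h1
    · rw [powerCut_eq_zero h1]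
      norm_num
      linarith
    · refine (powerCut_sq_le hs.le).trans ?_
      rcases le_or_gt 0 γ with hγ | hγ
      · have := Real.rpow_le_rpow hs.le h1.le hγ
        rw [abs_of_nonneg hγ]
        rw [abs_of_nonneg hγ] at h6
        linarith
      · have := Real.rpow_le_rpow_of_nonpos (by positivity : 0 < ‖x‖ ^ 2)
          (le_add_of_nonneg_right (sq_nonneg ε) : ‖x‖ ^ 2 ≤ ‖x‖ ^ 2 + ε ^ 2) hγ.le
        rw [Real.rpow_mul hn.le, Real.rpow_two]
        linarith
  · rw [Set.indicator_of_notMem h]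
    rw [mem_closedBall_zero_iff, not_le] at h
    rw [powerTest_eq_zero h]
    norm_num

end PowerTest

/-! ### Necessity of c ≤ c_0(N₀). -/

section Optimality

variable {N : ℕ} {μ : RN N → ℝ}

lemma isFiniteMeasureOnCompacts_densityMeasure (h : LocallyIntegrable μ volume) :
    IsFiniteMeasureOnCompacts (densityMeasure μ) := by
  refine ⟨fun K hK => ?_⟩
  rw [densityMeasure, withDensity_apply _ hK.measurableSet]
  exact (h.integrableOn_isCompact hK).lintegral_lt_top

lemma densityMeasure_absolutelyContinuous : densityMeasure μ ≪ volume :=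
  withDensity_absolutelyContinuous _ _

lemma ae_densityMeasure_ne_zero (hN : 0 < N) : ∀ᵐ x ∂(densityMeasure μ), x ≠ 0 := by
  have : Nonempty (Fin N) := ⟨⟨0, hN⟩⟩
  have h : ∀ᵐ x : RN N, x ≠ 0 := by simp [ae_iff, measure_singleton]
  exact densityMeasure_absolutelyContinuous h

/-- Weakening C to |C| makes all terms nonnegative, so the inequality can be used in `ENNReal`. -/
lemma HardyIneq.le_of_nonneg {c C : ℝ} {φ : RN N → ℝ} (hc : 0 ≤ c) (h : HardyIneq μ c C φ) :
    ENNReal.ofReal c * ∫⁻ x, ENNReal.ofReal (φ x ^ 2 / ‖x‖ ^ 2) ∂(densityMeasure μ) ≤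
      ∫⁻ x, ENNReal.ofReal (‖weakGrad φ x‖ ^ 2) ∂(densityMeasure μ) +
      ENNReal.ofReal |C| * ∫⁻ x, ENNReal.ofReal (φ x ^ 2) ∂(densityMeasure μ) := by
  rw [← EReal.coe_ennreal_le_coe_ennreal_iff, EReal.coe_ennreal_add, EReal.coe_ennreal_mul,
    EReal.coe_ennreal_mul, EReal.coe_ennreal_ofReal, EReal.coe_ennreal_ofReal, max_eq_left hc,
    max_eq_left (abs_nonneg C)]
  refine le_trans h (add_le_add le_rfl ?_)
  exact mul_le_mul_of_nonneg_right (EReal.coe_le_coe_iff.mpr (le_abs_self C))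
    (EReal.coe_ennreal_nonneg _)

lemma memH1Mu_of_contDiff (h : LocallyIntegrable μ volume) {φ : RN N → ℝ}
    (hφ : ContDiff ℝ 1 φ) (hs : HasCompactSupport φ) : MemH1Mu μ φ := by
  have := isFiniteMeasureOnCompacts_densityMeasure h
  have hw := hasWeakGradient_of_contDiff hφ
  have hg : Continuous (gradient φ) :=
    (InnerProductSpace.toDual ℝ (RN N)).symm.continuous.comp (hφ.continuous_fderiv one_ne_zero)
  refine ⟨hφ.continuous.memLp_of_hasCompactSupport hs, ⟨_, hw⟩, ?_⟩
  refine (memLp_congr_ae (densityMeasure_absolutelyContinuous hw.weakGrad_ae_eq)).mpr ?_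
  refine hg.memLp_of_hasCompactSupport ?_
  exact (hs.fderiv (𝕜 := ℝ)).comp_left (map_zero (InnerProductSpace.toDual ℝ (RN N)).symm)

/-- If the weighted Hardy inequality holds with a constant `c > γ ^ 2` and `|x| ^ (2 γ)` is
integrable near the origin, then so is `|x| ^ (2 γ - 2)`. -/
lemma WeightedHardy.lintegral_lt_top (hN : 2 ≤ N) (hμ : LocallyIntegrable μ volume) {c γ : ℝ}
    (h : WeightedHardy μ c) (hγ : γ ^ 2 < c)
    (hint : IntegrableOn (fun x => ‖x‖ ^ (2 * γ)) (Metric.closedBall 0 3) (densityMeasure μ)) :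
    ∫⁻ x in Metric.ball 0 1, ENNReal.ofReal (‖x‖ ^ (2 * γ - 2)) ∂(densityMeasure μ) < ⊤ := by
  obtain ⟨C, hC⟩ := h
  have := isFiniteMeasureOnCompacts_densityMeasure hμ
  have hne := ae_densityMeasure_ne_zero (μ := μ) (by omega)
  obtain ⟨M, hM0, hM⟩ := exists_bound_deriv_powerCut γ
  set ν := densityMeasure μ with hν
  set D := ∫⁻ x, ENNReal.ofReal ((Metric.closedBall (0 : RN N) 3).indicator
      (fun x => ‖x‖ ^ (2 * γ) + 6 ^ |γ|) x) ∂ν with hD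
  set E := ∫⁻ x, ENNReal.ofReal ((Metric.closedBall (0 : RN N) 3).indicator
      (fun _ => 36 * M ^ 2) x) ∂ν with hE
  have hball : ν (Metric.closedBall 0 3) ≠ ⊤ := (isCompact_closedBall 0 3).measure_lt_top.ne
  have hDfin : D < ⊤ := by
    refine Integrable.lintegral_lt_top ?_
    rw [integrable_indicator_iff measurableSet_closedBall]
    exact hint.add (integrableOn_const hball)
  have hEfin : E < ⊤ := by
    refine Integrable.lintegral_lt_top ?_
    rw [integrable_indicator_iff measurableSet_closedBall]
    exact integrableOn_const hball
  set L := E + ENNReal.ofReal |C| * D with hL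
  have hLfin : L ≠ ⊤ := (ENNReal.add_lt_top.mpr
    ⟨hEfin, ENNReal.mul_lt_top ENNReal.ofReal_lt_top hDfin⟩).ne
  have hc0 : 0 < c := lt_of_le_of_lt (sq_nonneg γ) hγ
  have key : ∀ ε : ℝ, 0 < ε → ε ≤ 1 →
      ∫⁻ x in Metric.ball (0 : RN N) 1, ENNReal.ofReal ((‖x‖ ^ 2 + ε ^ 2) ^ (γ - 1)) ∂ν ≤
        ENNReal.ofReal (L.toReal / (c - γ ^ 2)) := by
    intro ε hε hε1
    set k : RN N → ℝ := fun x => (‖x‖ ^ 2 + ε ^ 2) ^ (γ - 1) with hk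
    have hkc : Continuous k := by
      refine Continuous.rpow_const (by fun_prop) fun x => Or.inl ?_
      positivity
    set J := ∫⁻ x in Metric.ball (0 : RN N) 1, ENNReal.ofReal (k x) ∂ν with hJ
    -- For ε > 0 the integrand is continuous, hence J is finite. Only then can γ²J be moved to the
    -- left, giving (c - γ²)J ≤ L with L independent of ε.
    have hJfin : J ≠ ⊤ := by
      have h1 : IntegrableOn k (Metric.ball 0 1) ν :=
        (hkc.locallyIntegrable.integrableOn_isCompact (isCompact_closedBall 0 1)).mono_set
          Metric.ball_subset_closedBall
      exact (Integrable.lintegral_lt_top h1).ne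
    have hw := hasWeakGradient_of_contDiff (contDiff_powerTest (N := N) (γ := γ) hε)
    have hwg := densityMeasure_absolutelyContinuous (μ := μ) hw.weakGrad_ae_eq
    have hmain := (hC _ (memH1Mu_of_contDiff hμ (contDiff_powerTest hε)
      (hasCompactSupport_powerTest (γ := γ) (ε := ε)))).le_of_nonneg hc0.le
    have b1 : J ≤ ∫⁻ x, ENNReal.ofReal (powerTest γ ε x ^ 2 / ‖x‖ ^ 2) ∂ν := by
      refine le_trans ?_ (setLIntegral_le_lintegral (Metric.ball 0 1) _)
      refine lintegral_mono_ae ?_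
      filter_upwards [ae_restrict_of_ae hne, ae_restrict_mem Metric.isOpen_ball.measurableSet]
        with x hx0 hx
      exact ENNReal.ofReal_le_ofReal
        (le_powerTest_sq_div hε hε1 (mem_ball_zero_iff.mp hx) hx0)
    have b2 : ∫⁻ x, ENNReal.ofReal (‖weakGrad (powerTest γ ε) x‖ ^ 2) ∂ν ≤
        ENNReal.ofReal (γ ^ 2) * J + E := by
      rw [← lintegral_add_compl _ (Metric.isOpen_ball (x := (0 : RN N)) (ε := 1)).measurableSet]
      refine add_le_add ?_ ?_
      · rw [hJ, ← lintegral_const_mul' _ _ ENNReal.ofReal_ne_top]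
        refine lintegral_mono_ae ?_
        filter_upwards [ae_restrict_of_ae hwg, ae_restrict_mem Metric.isOpen_ball.measurableSet]
          with x hx0 hx
        rw [← ENNReal.ofReal_mul (sq_nonneg γ), hx0]
        exact ENNReal.ofReal_le_ofReal
          (norm_gradient_powerTest_sq_le_of_lt hε hε1 (mem_ball_zero_iff.mp hx))
      · refine le_trans ?_ (setLIntegral_le_lintegral (Metric.ball 0 1)ᶜ _)
        refine lintegral_mono_ae ?_
        filter_upwards [ae_restrict_of_ae hwg,
          ae_restrict_mem Metric.isOpen_ball.measurableSet.compl] with x hx0 hx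
        rw [hx0]
        refine ENNReal.ofReal_le_ofReal (norm_gradient_powerTest_sq_le_of_le hM0 hM hε ?_)
        rwa [Set.mem_compl_iff, mem_ball_zero_iff, not_lt] at hx
    have b3 : ∫⁻ x, ENNReal.ofReal (powerTest γ ε x ^ 2) ∂ν ≤ D := by
      refine lintegral_mono_ae ?_
      filter_upwards [hne] with x hx0
      exact ENNReal.ofReal_le_ofReal (powerTest_sq_le hε hx0)
    have b4 : ENNReal.ofReal c * J ≤ ENNReal.ofReal (γ ^ 2) * J + L := by
      calc _ ≤ _ := mul_le_mul_right b1 _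
        _ ≤ _ := hmain
        _ ≤ (ENNReal.ofReal (γ ^ 2) * J + E) + ENNReal.ofReal |C| * D :=
            add_le_add b2 (mul_le_mul_right b3 _)
        _ = _ := by rw [hL, add_assoc]
    have b5 := ENNReal.toReal_mono (ENNReal.add_ne_top.mpr
      ⟨ENNReal.mul_ne_top ENNReal.ofReal_ne_top hJfin, hLfin⟩) b4
    rw [ENNReal.toReal_add (ENNReal.mul_ne_top ENNReal.ofReal_ne_top hJfin) hLfin,
      ENNReal.toReal_mul, ENNReal.toReal_mul, ENNReal.toReal_ofReal hc0.le,
      ENNReal.toReal_ofReal (sq_nonneg γ)] at b5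
    rw [← ENNReal.ofReal_toReal hJfin]
    refine ENNReal.ofReal_le_ofReal ?_
    rw [le_div_iff₀ (sub_pos.mpr hγ)]
    linarith
  set ε : ℕ → ℝ := fun n => 1 / ((n : ℝ) + 1) with hε
  have hε0 : ∀ n, 0 < ε n := fun n => by positivity
  have hε1 : ∀ n, ε n ≤ 1 := fun n => by
    rw [hε, div_le_one (by positivity)]
    linarith [(Nat.cast_nonneg n : (0 : ℝ) ≤ n)]
  have hlim : Tendsto ε atTop (𝓝 0) := tendsto_one_div_add_atTop_nhds_zero_nat
  have fatou := lintegral_liminf_le (u := atTop) (μ := ν.restrict (Metric.ball 0 1))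
    (f := fun n (x : RN N) => ENNReal.ofReal ((‖x‖ ^ 2 + ε n ^ 2) ^ (γ - 1)))
    (fun n => by fun_prop)
  have e : ∫⁻ x in Metric.ball 0 1, ENNReal.ofReal (‖x‖ ^ (2 * γ - 2)) ∂ν =
      ∫⁻ x in Metric.ball 0 1, liminf
        (fun n => ENNReal.ofReal ((‖x‖ ^ 2 + ε n ^ 2) ^ (γ - 1))) atTop ∂ν := by
    refine lintegral_congr_ae ?_
    filter_upwards [ae_restrict_of_ae hne] with x hx0
    have hn : 0 < ‖x‖ := norm_pos_iff.mpr hx0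
    have h1 : Tendsto (fun n => ‖x‖ ^ 2 + ε n ^ 2) atTop (𝓝 (‖x‖ ^ 2)) := by
      simpa using (hlim.pow 2).const_add (‖x‖ ^ 2)
    have h2 := ENNReal.tendsto_ofReal
      (h1.rpow_const (p := γ - 1) (Or.inl (by positivity)))
    rw [h2.liminf_eq, ← Real.rpow_two, ← Real.rpow_mul hn.le]
    congr 2
    ring
  rw [e]
  refine lt_of_le_of_lt (fatou.trans ?_) (ENNReal.ofReal_lt_top (r := L.toReal / (c - γ ^ 2)))
  exact liminf_le_of_le (by isBoundedDefault) fun b hb => by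
    obtain ⟨n, hn⟩ := hb.exists
    exact hn.trans (key (ε n) (hε0 n) (hε1 n))

/-- Too large a constant would improve integrability: from |x|^{2γ} to |x|^{2γ-2} near 0, past the
critical exponent N₀. -/
lemma WeightedHardy.le_hardyConst (hN : 2 ≤ N) {N₀ c : ℝ} (h3 : HypH3 μ N₀)
    (h : WeightedHardy μ c) : c ≤ hardyConst N₀ := by
  by_contra! hc
  have := isFiniteMeasureOnCompacts_densityMeasure h3.memL1Loc
  have hne := ae_densityMeasure_ne_zero (μ := μ) (by omega)
  -- The exponent δ = 0 is admissible since dμ is finite on compact sets. This makes 2 - 2γ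
  -- positive, so the power is bounded by 1 off the unit ball.
  have hN₀ : 0 ≤ N₀ := by
    refine h3.isLUB.1 ?_
    simp only [Set.mem_ofPred_eq, Real.rpow_zero]
    exact locallyIntegrable_const _
  set a := (2 - N₀) / 2 with ha
  have hca : a ^ 2 < c := by
    have : a ^ 2 = hardyConst N₀ := by rw [hardyConst, ha]; ring
    rwa [this]
  -- γ > a - 1 means -2γ < N₀, so |x|^{2γ} is locally integrable; γ < a means 2 - 2γ > N₀, so
  -- |x|^{2γ-2} must not be.
  obtain ⟨γ, hγc, hγ1, hγa⟩ : ∃ γ : ℝ, γ ^ 2 < c ∧ a - 1 < γ ∧ γ < a := by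
    have e1 : ∀ᶠ γ in 𝓝[<] a, γ ^ 2 < c :=
      (((continuous_pow 2).tendsto a).mono_left nhdsWithin_le_nhds).eventually_lt_const hca
    have e2 : ∀ᶠ γ in 𝓝[<] a, a - 1 < γ :=
      nhdsWithin_le_nhds (Ioi_mem_nhds (by linarith))
    exact (e1.and (e2.and self_mem_nhdsWithin)).exists
  obtain ⟨δ, hδ, hδγ, -⟩ := h3.isLUB.exists_between (show -(2 * γ) < N₀ by linarith)
  -- Comparison with an admissible exponent δ > -2γ: on the ball, |x|^{2γ} ≤ 3^{2γ+δ} |x|^{-δ}.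
  have hint : IntegrableOn (fun x => ‖x‖ ^ (2 * γ)) (Metric.closedBall 0 3) (densityMeasure μ) := by
    have h1 := (LocallyIntegrable.integrableOn_isCompact hδ (isCompact_closedBall 0 3)).const_mul
      (3 ^ (2 * γ + δ))
    refine h1.mono' (Measurable.aestronglyMeasurable (measurable_norm.pow_const _)) ?_
    filter_upwards [ae_restrict_of_ae hne, ae_restrict_mem measurableSet_closedBall] with x hx0 hx
    have hn : 0 < ‖x‖ := norm_pos_iff.mpr hx0
    rw [mem_closedBall_zero_iff] at hx
    have h2 := Real.rpow_le_rpow hn.le hx (show 0 ≤ 2 * γ + δ by linarith)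
    rw [Real.norm_eq_abs, abs_of_nonneg (Real.rpow_nonneg hn.le _), mul_one_div,
      le_div_iff₀ (by positivity), ← Real.rpow_add hn]
    exact h2
  have hfin := h.lintegral_lt_top hN h3.memL1Loc hγc hint
  have hmem : LocallyIntegrable (fun x : RN N => 1 / ‖x‖ ^ (2 - 2 * γ)) (densityMeasure μ) := by
    have hm : AEStronglyMeasurable (fun x : RN N => 1 / ‖x‖ ^ (2 - 2 * γ)) (densityMeasure μ) :=
      Measurable.aestronglyMeasurable (by fun_prop)
    have hi : Integrable ((Metric.ball (0 : RN N) 1).indicator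
        fun x => 1 / ‖x‖ ^ (2 - 2 * γ)) (densityMeasure μ) := by
      rw [integrable_indicator_iff Metric.isOpen_ball.measurableSet]
      refine ⟨hm.restrict, ?_⟩
      rw [hasFiniteIntegral_iff_ofReal (Eventually.of_forall fun x => by positivity)]
      refine lt_of_le_of_lt (le_of_eq ?_) hfin
      refine lintegral_congr fun x => ?_
      rw [one_div, ← Real.rpow_neg (norm_nonneg x), neg_sub]
    refine (hi.locallyIntegrable.add (locallyIntegrable_const (1 : ℝ))).mono hm
      (Eventually.of_forall fun x => ?_)
    have h0 : 0 ≤ 1 / ‖x‖ ^ (2 - 2 * γ) := by positivity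
    rw [Pi.add_apply, Real.norm_eq_abs, abs_of_nonneg h0, Real.norm_eq_abs]
    refine le_trans ?_ (le_abs_self _)
    by_cases hx : x ∈ Metric.ball (0 : RN N) 1
    · rw [Set.indicator_of_mem hx]
      linarith
    · rw [Set.indicator_of_notMem hx, zero_add]
      rw [mem_ball_zero_iff, not_lt] at hx
      exact div_le_one_of_le₀ (Real.one_le_rpow hx (by linarith)) (by positivity)
  have := h3.isLUB.1 hmem
  linarith

end Optimality

end

theorem theorem1p2 (N : ℕ) (hN : 2 ≤ N) (μ : RN N → ℝ) (N₀ : ℝ)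
    (h2 : HypH2 μ) (h3 : HypH3 μ N₀) (hc : hardyConstMu μ = (hardyConst N₀ : EReal)) (c : ℝ) :
    WeightedHardy μ c ↔ c ≤ hardyConst N₀ :=
  ⟨fun h => h.le_hardyConst hN h3, weightedHardy_of_le hN h2 (sq_nonneg _) hc⟩
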